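/- For $n\ge 0$ let $N=2^n$, identify $[N]$ with $\{0,1\}^n$, and let $\oplus$ be bitwise XOR. A relation is a finite multiset of pairs in $[N]\times[N]$; $\mathcal R^{\mathcal I}$ (resp. $\mathcal R^{\mathcal D}$) is the set of relations whose second (resp. first) coordinates are pairwise distinct, and $\operatorname{Dom}(R)$, $\operatorname{Im}(R)$ are the sets of first and second coordinates. For such a relation $L=\{(x_1,y_1),\dots,(x_t,y_t)\}$ let $$|L\rangle=\frac1{\sqrt{t!}}\sum_{\pi\in\mathrm{Sym}_t}|x_{\pi^{-1}(1)},y_{\pi^{-1}(1)},\dots,x_{\pi^{-1}(t)},y_{\pi^{-1}(t)}\rangle\in\bigoplus_{s\ge0}(\mathbb C^N\otimes\mathbb C^N)^{\otimes s}.$$ On registers $\mathsf A$ (of dimension $N$), $\mathsf S$, $\mathsf T$, for $L\in\mathcal R^{\mathcal I}$, $R\in\mathcal R^{\mathcal D}$ with $|L|+|R|<N$, let $$F^L:|x\rangle|L\rangle|R\rangle\mapsto\frac1{\sqrt N}\sum_{y\notin\operatorname{Im}(L)}|y\rangle|L\cup\{(x,y)\}\rangle|R\rangle,\qquad F^R:|y\rangle|L\rangle|R\rangle\mapsto\frac1{\sqrt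 N}\sum_{x\notin\operatorname{Dom}(R)}|x\rangle|L\rangle|R\cup\{(x,y)\}\rangle,$$ let both be $0$ on the orthogonal complement of the span of these vectors $|x\rangle|L\rangle|R\rangle$, and put $$F=F^L(\mathrm{id}-F^RF^{R,\dagger})+(\mathrm{id}-F^LF^{L,\dagger})F^{R,\dagger}.$$ Let $X^k|a\rangle=|a\oplus k\rangle$ on $\mathsf A$. An adversary making $t$ queries to each oracle is a sequence $(A_1,\dots,A_{4t})$ of unitaries on $\mathsf A\mathsf B$, where $\mathsf B$ is an arbitrary finite-dimensional ancilla register. Products $\prod_{i=1}^t$ below have the factor $i=1$ applied first. Two independent oracles: let $F_j$ be $F$ acting on $\mathsf A\mathsf S_j\mathsf T_j$ $(j=1,2)$, let $$|\mathbf H_3\rangle=\prod_{i=1}^t\bigl(F_2^\dagger A_{4i}F_1^\dagger A_{4i-1}F_2A_{4i-2}F_1A_{4i-3}\bigr)|0\rangle_{\mathsf A}|0\rangle_{\mathsf B}|\varnothing\rangle_{\mathsf S_1}|\varnothing\rangle_{\mathsf T_1}|\varnothing\rangle_{\mathsf S_2}|\varnothing\rangle_{\mathsf T_2},$$ and let $\rho_3=\operatorname{Tr}_{\mathsf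 S_1\mathsf T_1\mathsf S_2\mathsf T_2}|\mathbf H_3\rangle\langle\mathbf H_3|$. A single oracle with uniformly random keys: let $$|\mathbf H_4\rangle=\frac1{\sqrt{N^3}}\sum_{k_1,k_2,k_3\in\{0,1\}^n}\prod_{i=1}^t\bigl(F^\dagger X^{k_2}F^\dagger A_{4i}\,X^{k_1}F^\dagger X^{k_3}A_{4i-1}\,FX^{k_2}F\,A_{4i-2}\,X^{k_3}FX^{k_1}A_{4i-3}\bigr)|0\rangle_{\mathsf A}|0\rangle_{\mathsf B}|\varnothing\rangle_{\mathsf S}|\varnothing\rangle_{\mathsf T}|k_1,k_2,k_3\rangle_{\mathsf K},$$ and let $\rho_4=\operatorname{Tr}_{\mathsf S\mathsf T\mathsf K}|\mathbf H_4\rangle\langle\mathbf H_4|$. Then there is an absolute constant $C$ such that for all $n,t\ge0$, every finite-dimensional ancilla register $\mathsf B$ and every adversary $(A_1,\dots,A_{4t})$, $$\tfrac12\|\rho_3-\rho_4\|_1\le C\,\frac{t^2}{\sqrt N},\qquad \|M\|_1=\operatorname{Tr}\sqrt{M^\dagger M}.$$ -/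

import Mathlib

open scoped Matrix Kronecker ComplexOrder

noncomputable section

namespace PathRecording

/-! Everything below is finite dimensional, so a vector is a function from the basis labels to `ℂ`
and an operator is a square matrix over the basis labels; the column with label `j` is the image of
the basis vector `|j⟩`, and `Mᴴ` is the adjoint. -/

/-- The set `{0,1}^n`, of size `N = 2 ^ n`. Addition is the bitwise XOR, `0` is the all-zero
string. -/
abbrev Bits (n : ℕ) : Type := Fin n → ZMod 2

instance (n : ℕ) : DecidableEq (Bits n) := inferInstance

instance (n : ℕ) : Fintype (Bits n) := inferInstance

/-- A relation is `I`-distinct (injective) if its second coordinates are pairwise distinct. (A multiset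
of pairs with distinct second coordinates has no repetition, so relations are taken to be
`Finset`s.) -/
def IDistinct {n : ℕ} (L : Finset (Bits n × Bits n)) : Prop :=
  ∀ p ∈ L, ∀ q ∈ L, p.2 = q.2 → p = q

/-- A relation is `D`-distinct if its first coordinates are pairwise distinct. -/
def DDistinct {n : ℕ} (R : Finset (Bits n × Bits n)) : Prop :=
  ∀ p ∈ R, ∀ q ∈ R, p.1 = q.1 → p = q

/-- The `I`-distinct relations. -/
abbrev RelI (n : ℕ) : Type := {L : Finset (Bits n × Bits n) // IDistinct L}

/-- The `D`-distinct relations. -/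
abbrev RelD (n : ℕ) : Type := {R : Finset (Bits n × Bits n) // DDistinct R}

instance (n : ℕ) : DecidableEq (RelI n) := inferInstance

instance (n : ℕ) : DecidableEq (RelD n) := inferInstance

instance (n : ℕ) : Fintype (RelI n) := Fintype.ofFinite _

instance (n : ℕ) : Fintype (RelD n) := Fintype.ofFinite _

/-- The domain of a relation. -/
def dom {n : ℕ} (R : Finset (Bits n × Bits n)) : Finset (Bits n) := R.image Prod.fst

/-- The image of a relation. -/
def im {n : ℕ} (L : Finset (Bits n × Bits n)) : Finset (Bits n) := L.image Prod.snd

/-- The empty relation as an `I`-distinct relation. -/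
def emptyI (n : ℕ) : RelI n := ⟨∅, by simp [IDistinct]⟩

/-- The empty relation as a `D`-distinct relation. -/
def emptyD (n : ℕ) : RelD n := ⟨∅, by simp [DDistinct]⟩

/-- Basis labels `(L, R)` of a pair of database registers `S, T`. The label stands for
`|L⟩_S |R⟩_T`, where `|L⟩` is the relation state `relationState L` below. Relation states are
orthonormal (`orthonormal_relationState`) and all operators below act on the span of the vectors
`|L⟩|R⟩` only (they vanish on its orthogonal complement), so states and operators are written in
coordinates with respect to them. -/
abbrev Database (n : ℕ) : Type := RelI n × RelD n

instance (n : ℕ) : DecidableEq (Database n) := inferInstance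

instance (n : ℕ) : Fintype (Database n) := inferInstance

/-- The variable-length register `⨁_t (ℂ^N ⊗ ℂ^N)^{⊗ t}`, with orthonormal basis
`|x₁, y₁, …, x_t, y_t⟩`. -/
abbrev VarReg (n : ℕ) : Type := lp (fun _ : List (Bits n × Bits n) => ℂ) 2

/-- The relation state
`|L⟩ = (1/√t!) ∑_{π ∈ Sym_t} |x_{π⁻¹(1)}, y_{π⁻¹(1)}, …, x_{π⁻¹(t)}, y_{π⁻¹(t)}⟩`
of `L = {(x₁, y₁), …, (x_t, y_t)}`, for `L` without repetitions. -/
def relationState {n : ℕ} (L : Finset (Bits n × Bits n)) : VarReg n :=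
  ((1 / √(L.card.factorial : ℝ) : ℝ) : ℂ) • ∑ π : Equiv.Perm (Fin L.card),
    lp.single 2 (List.ofFn fun i => (L.equivFin.symm (π⁻¹ i) : Bits n × Bits n)) (1 : ℂ)

lemma orthonormal_relationState (n : ℕ) :
    Orthonormal ℂ (relationState : Finset (Bits n × Bits n) → VarReg n) := by
  classical
  have key : ∀ L L' : Finset (Bits n × Bits n), ∀ (π : Equiv.Perm (Fin L.card))
      (π' : Equiv.Perm (Fin L'.card)),
      (List.ofFn fun i => (L.equivFin.symm (π⁻¹ i) : Bits n × Bits n)) =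
        (List.ofFn fun i => (L'.equivFin.symm (π'⁻¹ i) : Bits n × Bits n)) → L = L' := by
    intro L L' π π' h
    have hm : ∀ (M : Finset (Bits n × Bits n)) (σ : Equiv.Perm (Fin M.card)) (p),
        p ∈ (List.ofFn fun i => (M.equivFin.symm (σ⁻¹ i) : Bits n × Bits n)) ↔ p ∈ M := by
      intro M σ p
      rw [List.mem_ofFn]
      constructor
      · rintro ⟨i, rfl⟩
        exact Subtype.property _
      · intro hp
        exact ⟨σ (M.equivFin ⟨p, hp⟩), by simp⟩
    ext p
    rw [← hm L π p, h, hm L' π' p]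
  rw [orthonormal_iff_ite]
  intro L L'
  simp only [relationState, inner_smul_left, inner_smul_right, sum_inner, inner_sum,
    lp.inner_single_left]
  split_ifs with hL
  · subst hL
    have h1 : ∀ π π' : Equiv.Perm (Fin L.card),
        (inner ℂ (1 : ℂ) ((lp.single 2
          (List.ofFn fun i => (L.equivFin.symm (π'⁻¹ i) : Bits n × Bits n)) (1 : ℂ) : VarReg n)
          (List.ofFn fun i => (L.equivFin.symm (π⁻¹ i) : Bits n × Bits n))) : ℂ) =
        if π = π' then 1 else 0 := by
      intro π π'
      split_ifs with h
      · subst h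
        simp
      · rw [lp.single_apply_ne]
        · simp
        · intro h2
          apply h
          rw [List.ofFn_inj] at h2
          rw [← inv_inj]
          ext i
          have := congrFun h2 i
          simpa [Fin.ext_iff] using congrArg Fin.val (L.equivFin.symm.injective (Subtype.ext this))
    simp only [h1]
    have hf : (0 : ℝ) < (L.card.factorial : ℝ) := by exact_mod_cast Nat.factorial_pos _
    have hs : (((√(L.card.factorial : ℝ) : ℝ) : ℂ)) * ((√(L.card.factorial : ℝ) : ℝ) : ℂ) =
        (L.card.factorial : ℂ) := by
      rw [← Complex.ofReal_mul, Real.mul_self_sqrt hf.le]; simp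
    have hne : ((√(L.card.factorial : ℝ) : ℝ) : ℂ) ≠ 0 := by
      exact_mod_cast (Real.sqrt_pos.mpr hf).ne'
    simp [Fintype.card_perm, Complex.conj_ofReal]
    field_simp
    rw [sq, hs]
  · have h1 : ∀ (π : Equiv.Perm (Fin L.card)) (π' : Equiv.Perm (Fin L'.card)),
        (inner ℂ (1 : ℂ) ((lp.single 2
          (List.ofFn fun i => (L'.equivFin.symm (π'⁻¹ i) : Bits n × Bits n)) (1 : ℂ) : VarReg n)
          (List.ofFn fun i => (L.equivFin.symm (π⁻¹ i) : Bits n × Bits n))) : ℂ) = 0 := by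
      intro π π'
      rw [lp.single_apply_ne]
      · simp
      · intro h2
        exact hL (key _ _ _ _ h2)
    simp only [h1, Finset.sum_const_zero, mul_zero]

/-- The operator `F^L` on the registers `A, S, T`: for `|L| + |R| < N`,
`|x⟩|L⟩|R⟩ ↦ (1/√N) ∑_{y ∉ Im L} |y⟩|L ∪ {(x,y)}⟩|R⟩`; all other basis vectors are mapped to
`0`. -/
def FL (n : ℕ) : Matrix (Bits n × Database n) (Bits n × Database n) ℂ :=
  Matrix.of fun (y, L', R') (x, L, R) =>
    if L.1.card + R.1.card < 2 ^ n ∧ y ∉ im L.1 ∧ L'.1 = L.1 ∪ {(x, y)} ∧ R' = R then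
      ((1 / √(2 ^ n : ℝ) : ℝ) : ℂ) else 0

/-- The operator `F^R` on the registers `A, S, T`: for `|L| + |R| < N`,
`|y⟩|L⟩|R⟩ ↦ (1/√N) ∑_{x ∉ Dom R} |x⟩|L⟩|R ∪ {(x,y)}⟩`; all other basis vectors are mapped to
`0`. -/
def FR (n : ℕ) : Matrix (Bits n × Database n) (Bits n × Database n) ℂ :=
  Matrix.of fun (x, L', R') (y, L, R) =>
    if L.1.card + R.1.card < 2 ^ n ∧ x ∉ dom R.1 ∧ L' = L ∧ R'.1 = R.1 ∪ {(x, y)} then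
      ((1 / √(2 ^ n : ℝ) : ℝ) : ℂ) else 0

/-- The (modified) path-recording oracle
`F = F^L (id - F^R F^{R,†}) + (id - F^L F^{L,†}) F^{R,†}`. -/
def F (n : ℕ) : Matrix (Bits n × Database n) (Bits n × Database n) ℂ :=
  FL n * (1 - FR n * (FR n)ᴴ) + (1 - FL n * (FL n)ᴴ) * (FR n)ᴴ

/-- `X^k`, mapping `|a⟩` to `|a ⊕ k⟩` on the register `A`, and acting trivially on a register with
basis labels `D`. -/
def X {n : ℕ} {D : Type*} [DecidableEq D] (k : Bits n) :
    Matrix (Bits n × D) (Bits n × D) ℂ :=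
  Matrix.of fun p q => if p = (q.1 + k, q.2) then 1 else 0

/-! ### The adversary -/

section Adversary

variable {n : ℕ} {B E : Type*} [DecidableEq B] [Fintype B] [DecidableEq E] [Fintype E]

/-- An operator on the registers `A, E`, acting trivially on the ancilla register `B`. -/
def onAE (B : Type*) [DecidableEq B] (O : Matrix (Bits n × E) (Bits n × E) ℂ) :
    Matrix ((Bits n × B) × E) ((Bits n × B) × E) ℂ :=
  Matrix.of fun p q => if p.1.2 = q.1.2 then O (p.1.1, p.2) (q.1.1, q.2) else 0

/-- An operator on the registers `A, B`, acting trivially on the purifying register `E`. -/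
def onAB (E : Type*) [DecidableEq E] (M : Matrix (Bits n × B) (Bits n × B) ℂ) :
    Matrix ((Bits n × B) × E) ((Bits n × B) × E) ℂ :=
  M ⊗ₖ (1 : Matrix E E ℂ)

/-- The state of the adversary `(A₁, A₂, …, A_{4t})` after `t` rounds,
`∏_{i=1}^{t} (O₂† A_{4i} O₁† A_{4i-1} O₂ A_{4i-2} O₁ A_{4i-3}) ψ₀`, with round `i = 1` applied
first. The sequence is indexed from `1`, and only `A₁, …, A_{4t}` are used. The oracles act on the
query register `A` and on a purifying register `E`. -/
def finalState (O₁ O₂ : Matrix (Bits n × E) (Bits n × E) ℂ)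
    (A : ℕ → Matrix.unitaryGroup (Bits n × B) ℂ) (ψ₀ : (Bits n × B) × E → ℂ) :
    ℕ → ((Bits n × B) × E → ℂ)
  | 0 => ψ₀
  | i + 1 =>
    (onAE B O₂ᴴ * onAB E (A (4 * i + 4)).1 * onAE B O₁ᴴ * onAB E (A (4 * i + 3)).1 *
      onAE B O₂ * onAB E (A (4 * i + 2)).1 * onAE B O₁ * onAB E (A (4 * i + 1)).1) *ᵥ
        finalState O₁ O₂ A ψ₀ i

/-- The partial trace `Tr_E |ψ⟩⟨ψ|`. -/
def reducedState {P E : Type*} [Fintype E] (ψ : P × E → ℂ) : Matrix P P ℂ :=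
  Matrix.of fun p q => ∑ e, ψ (p, e) * star (ψ (q, e))

end Adversary

/-! ### Two independent oracles -/

/-- `F` acting on the registers `A, S₁, T₁`. -/
def F₁ (n : ℕ) : Matrix (Bits n × Database n × Database n) (Bits n × Database n × Database n) ℂ :=
  Matrix.of fun (a, d₁, d₂) (a', d₁', d₂') => if d₂ = d₂' then F n (a, d₁) (a', d₁') else 0

/-- `F` acting on the registers `A, S₂, T₂`. -/
def F₂ (n : ℕ) : Matrix (Bits n × Database n × Database n) (Bits n × Database n × Database n) ℂ :=
  Matrix.of fun (a, d₁, d₂) (a', d₁', d₂') => if d₁ = d₁' then F n (a, d₂) (a', d₂') else 0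

/-- `|0⟩_A |0⟩_B |∅⟩_{S₁} |∅⟩_{T₁} |∅⟩_{S₂} |∅⟩_{T₂}`, where `b₀` is the label of `|0⟩_B`. -/
def initTwo (n : ℕ) {B : Type*} [DecidableEq B] (b₀ : B) :
    (Bits n × B) × (Database n × Database n) → ℂ :=
  Pi.single ((0, b₀), ((emptyI n, emptyD n), (emptyI n, emptyD n))) 1

/-- The adversary's reduced state on `A, B` after `t` rounds with the two independent oracles
`F₁, F₂`. -/
def rhoTwo (n : ℕ) {B : Type*} [DecidableEq B] [Fintype B] (b₀ : B)
    (A : ℕ → Matrix.unitaryGroup (Bits n × B) ℂ) (t : ℕ) :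
    Matrix (Bits n × B) (Bits n × B) ℂ :=
  reducedState (finalState (F₁ n) (F₂ n) A (initTwo n b₀) t)

/-! ### A single oracle with three keys -/

/-- Basis labels of the key registers `K₁, K₂, K₃`. -/
abbrev Keys (n : ℕ) : Type := Bits n × Bits n × Bits n

instance (n : ℕ) : DecidableEq (Keys n) := inferInstance

instance (n : ℕ) : Fintype (Keys n) := inferInstance

/-- An operator on the registers `A, S, T`, controlled by the key registers. -/
def controlled {n : ℕ}
    (O : Keys n → Matrix (Bits n × Database n) (Bits n × Database n) ℂ) :
    Matrix (Bits n × Database n × Keys n) (Bits n × Database n × Keys n) ℂ :=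
  Matrix.of fun (a, d, k) (a', d', k') => if k = k' then O k' (a, d) (a', d') else 0

/-- The oracle `X^{k₃} F X^{k₁}`. -/
def keyedOne (n : ℕ) :
    Matrix (Bits n × Database n × Keys n) (Bits n × Database n × Keys n) ℂ :=
  controlled fun (k₁, _, k₃) => X (D := Database n) k₃ * F n * X (D := Database n) k₁

/-- The oracle `F X^{k₂} F`. -/
def keyedTwo (n : ℕ) :
    Matrix (Bits n × Database n × Keys n) (Bits n × Database n × Keys n) ℂ :=
  controlled fun (_, k₂, _) => F n * X (D := Database n) k₂ * F n

/-- `(1/√N³) ∑_{k₁,k₂,k₃} |0⟩_A |0⟩_B |∅⟩_S |∅⟩_T |k₁⟩|k₂⟩|k₃⟩`. -/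
def initKeyed (n : ℕ) {B : Type*} [DecidableEq B] (b₀ : B) :
    (Bits n × B) × (Database n × Keys n) → ℂ :=
  ((1 / √((2 ^ n : ℝ) ^ 3) : ℝ) : ℂ) •
    ∑ k : Keys n, Pi.single ((0, b₀), ((emptyI n, emptyD n), k)) 1

/-- The adversary's reduced state on `A, B` after `t` rounds with the oracles `X^{k₃} F X^{k₁}` and
`F X^{k₂} F`, for uniformly random keys kept in a purifying register. The inverse oracles are the
adjoints `X^{k₁} F† X^{k₃}` and `F† X^{k₂} F†`. -/
def rhoKeyed (n : ℕ) {B : Type*} [DecidableEq B] [Fintype B] (b₀ : B)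
    (A : ℕ → Matrix.unitaryGroup (Bits n × B) ℂ) (t : ℕ) :
    Matrix (Bits n × B) (Bits n × B) ℂ :=
  reducedState (finalState (keyedOne n) (keyedTwo n) A (initKeyed n b₀) t)

/-! ### Trace distance -/

open scoped MatrixOrder Matrix.Norms.L2Operator in
/-- The trace norm `‖M‖₁ = Tr √(M† M)`. -/
def traceNorm {P : Type*} [Fintype P] [DecidableEq P] (M : Matrix P P ℂ) : ℝ :=
  (CFC.sqrt (Mᴴ * M)).trace.re

/-- The trace distance `TD(ρ, ρ') = ½ ‖ρ - ρ'‖₁`. -/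
def traceDistance {P : Type*} [Fintype P] [DecidableEq P] (ρ ρ' : Matrix P P ℂ) : ℝ :=
  1 / 2 * traceNorm (ρ - ρ')

end PathRecording

end

/-!
The single keyed oracle simulates two independent path-recording oracles: a query `x ↦ y` to
`X^{k₃} F X^{k₁}` leaves the pair `(x ⊕ k₁, y ⊕ k₃)` in its database, and a query `x ↦ y` to
`F X^{k₂} F` leaves two pairs `(x, z)`, `(z ⊕ k₂, y)` with a random intermediate value `z`, which are
linked by `k₂`. Given the keys, a relation whose links form a matching therefore decodes into a
relation for the first oracle (its unlinked pairs, with `k₁`, `k₃` removed) and a relation for the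
second one (the outer entries of its linked pairs); see `Dec`. The encoding map `enc` sends a pair of
databases to the uniform superposition of the keys and databases that decode into it. Decoding is
unique, so `enc` maps distinct basis vectors to orthogonal vectors, and it is a contraction
(`opNorm_enc_le`).

On databases with at most `s` records, `enc` intertwines the elementary operators of the two
experiments up to an error `O(√(s / N))` in operator norm: `F^L` on the first oracle with
`X^{k₃} F^L X^{k₁}`, `F^L` on the second oracle with `F^L X^{k₂} F^L`, and similarly for the adjoints
(`opNorm_forward_one`, `opNorm_backward_one`, `opNorm_forward_two`, `opNorm_backward_two`). In
all these matrices the nonzero entries of a column are equal, so a sparsity bound (`opNorm_ind_sub_ind_le`)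
reduces the estimates to counting the encodings for which adding or removing a pair does not commute
with decoding. This requires a coincidence between the keys, the intermediate values and the
recorded entries, and each of the `O(s)` possible coincidences holds for a fraction of at most
`1 / N` of the choices (`rare_conflictOne`, `rare_conflictTwo`). The statements for `F^R` follow by exchanging
queries and answers. Besides, `F^{L†} X^{k₂} F^R` is small and `F^L` is nearly an isometry on small
databases (`opNorm_FL_adjoint_keyTwo_FR`, `opNorm_FL_adjoint_FL_sub_one`). Expanding
`F = F^L (1 - F^R F^{R†}) + (1 - F^L F^{L†}) F^{R†}`, one finds that `enc` intertwines both oracles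
and their adjoints up to a constant number of such errors (`intertwines_pathRecording`,
`intertwines_pathRecording_mul`).

All oracles are contractions (`opNorm_pathRecording_le`), so the errors of the `4 t` queries add up:
the final state of the keyed experiment is within `O(t √(t / N))` of the encoding of the final state
of the other one. As the adjoints are intertwined, too, `enc† enc` almost commutes with the oracles;
since it fixes the initial state, it almost fixes the final one (`close_finalState`). As `enc` acts on
the purifying registers only, the two reduced states give nearly the same expectation to every
observable on `A, B`, which bounds their trace distance by `O(t √(t / N))`, hence by
`O(t² / √N)`. If `t` is too large compared with `N` for these estimates to apply, the claimed bound
is at least `1`, while the trace distance of the two reduced states is at most `1`.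
-/

open scoped Matrix Kronecker ComplexOrder

noncomputable section

namespace PathRecording

set_option linter.unusedSectionVars false

/-! ### Operator norms of matrices -/

section OpNorm

open scoped Matrix.Norms.L2Operator

variable {ι κ : Type*} [Fintype ι] [Fintype κ] [DecidableEq ι] [DecidableEq κ]

lemma sum_sq_mulVec_le (M : Matrix ι κ ℂ) (v : κ → ℂ) :
    ∑ i, ‖(M *ᵥ v) i‖ ^ 2 ≤ ‖M‖ ^ 2 * ∑ j, ‖v j‖ ^ 2 := by
  have h := Matrix.l2_opNorm_mulVec M (WithLp.toLp 2 v)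
  have h2 := pow_le_pow_left₀ (norm_nonneg _) h 2
  rw [mul_pow, EuclideanSpace.norm_sq_eq, EuclideanSpace.norm_sq_eq] at h2
  simpa using h2

lemma opNorm_le_of_sum_sq {M : Matrix ι κ ℂ} {c : ℝ} (hc : 0 ≤ c)
    (h : ∀ v : κ → ℂ, ∑ i, ‖(M *ᵥ v) i‖ ^ 2 ≤ c ^ 2 * ∑ j, ‖v j‖ ^ 2) : ‖M‖ ≤ c := by
  rw [Matrix.l2_opNorm_def]
  refine ContinuousLinearMap.opNorm_le_bound _ hc fun x => ?_
  refine (pow_le_pow_iff_left₀ (by positivity) (by positivity) two_ne_zero).mp ?_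
  rw [mul_pow, EuclideanSpace.norm_sq_eq, EuclideanSpace.norm_sq_eq]
  simpa using h x.ofLp

/-- A matrix with at most `r` nonzero entries in every row, and whose columns have squared norm at
most `K`, has operator norm at most `√(r K)`, by the Cauchy–Schwarz inequality in every row. -/
lemma opNorm_le_of_sparse (M : Matrix ι κ ℂ) {r K : ℝ} (hr0 : 0 ≤ r) (hK0 : 0 ≤ K)
    (hr : ∀ i, ((Finset.univ.filter fun j => M i j ≠ 0).card : ℝ) ≤ r)
    (hK : ∀ j, ∑ i, ‖M i j‖ ^ 2 ≤ K) : ‖M‖ ≤ √(r * K) := by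
  refine opNorm_le_of_sum_sq (Real.sqrt_nonneg _) fun v => ?_
  rw [Real.sq_sqrt (by positivity)]
  have row : ∀ i, ‖(M *ᵥ v) i‖ ^ 2 ≤ r * ∑ j, ‖M i j‖ ^ 2 * ‖v j‖ ^ 2 := by
    intro i
    have h1 : (M *ᵥ v) i = ∑ j ∈ Finset.univ.filter (fun j => M i j ≠ 0), M i j * v j := by
      rw [Matrix.mulVec, dotProduct, Finset.sum_filter]
      refine Finset.sum_congr rfl fun j _ => ?_
      split_ifs with h
      · rfl
      · rw [not_not.mp h, zero_mul]
    have h2 : ‖(M *ᵥ v) i‖ ≤ ∑ j ∈ Finset.univ.filter (fun j => M i j ≠ 0), ‖M i j‖ * ‖v j‖ := by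
      rw [h1]
      refine (norm_sum_le _ _).trans (le_of_eq ?_)
      simp only [norm_mul]
    calc ‖(M *ᵥ v) i‖ ^ 2
        ≤ (∑ j ∈ Finset.univ.filter (fun j => M i j ≠ 0), ‖M i j‖ * ‖v j‖) ^ 2 :=
          pow_le_pow_left₀ (norm_nonneg _) h2 2
      _ ≤ ((Finset.univ.filter fun j => M i j ≠ 0).card : ℝ) *
            ∑ j ∈ Finset.univ.filter (fun j => M i j ≠ 0), (‖M i j‖ * ‖v j‖) ^ 2 :=
          sq_sum_le_card_mul_sum_sq
      _ ≤ r * ∑ j, ‖M i j‖ ^ 2 * ‖v j‖ ^ 2 := by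
          refine mul_le_mul (hr i) ?_ (Finset.sum_nonneg fun _ _ => sq_nonneg _) hr0
          simp only [mul_pow]
          exact Finset.sum_le_sum_of_subset_of_nonneg (Finset.filter_subset _ _)
            fun _ _ _ => by positivity
  calc ∑ i, ‖(M *ᵥ v) i‖ ^ 2 ≤ ∑ i, r * ∑ j, ‖M i j‖ ^ 2 * ‖v j‖ ^ 2 :=
        Finset.sum_le_sum fun i _ => row i
    _ = r * ∑ j, (∑ i, ‖M i j‖ ^ 2) * ‖v j‖ ^ 2 := by
        rw [← Finset.mul_sum, Finset.sum_comm]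
        simp only [Finset.sum_mul]
    _ ≤ r * ∑ j, K * ‖v j‖ ^ 2 := by
        refine mul_le_mul_of_nonneg_left ?_ hr0
        exact Finset.sum_le_sum fun j _ => mul_le_mul_of_nonneg_right (hK j) (sq_nonneg _)
    _ = r * K * ∑ j, ‖v j‖ ^ 2 := by rw [← Finset.mul_sum, mul_assoc]

lemma opNorm_submatrix_le {ι' κ' : Type*} [Fintype ι'] [Fintype κ'] [DecidableEq ι']
    [DecidableEq κ'] (M : Matrix ι κ ℂ) (e : ι' ≃ ι) (f : κ' ≃ κ) : ‖M.submatrix e f‖ ≤ ‖M‖ := by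
  refine opNorm_le_of_sum_sq (norm_nonneg _) fun v => ?_
  have h := sum_sq_mulVec_le M (v ∘ f.symm)
  rw [Matrix.submatrix_mulVec_equiv]
  rw [← f.sum_comp (fun j => ‖(v ∘ f.symm) j‖ ^ 2)] at h
  rw [← e.sum_comp] at h
  simpa using h

lemma opNorm_blockDiagonal_le {o : Type*} [Fintype o] [DecidableEq o] (M : o → Matrix ι κ ℂ)
    {c : ℝ} (hc : 0 ≤ c) (h : ∀ k, ‖M k‖ ≤ c) : ‖Matrix.blockDiagonal M‖ ≤ c := by
  refine opNorm_le_of_sum_sq hc fun v => ?_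
  have h1 : ∀ i k, (Matrix.blockDiagonal M *ᵥ v) (i, k) = (M k *ᵥ fun j => v (j, k)) i := by
    intro i k
    simp [Matrix.mulVec, dotProduct, Fintype.sum_prod_type, Matrix.blockDiagonal_apply]
  rw [Fintype.sum_prod_type_right, Fintype.sum_prod_type_right, Finset.mul_sum]
  refine Finset.sum_le_sum fun k _ => ?_
  simp only [h1]
  refine (sum_sq_mulVec_le (M k) _).trans ?_
  gcongr
  exact h k

lemma opNorm_diagonal_le (v : ι → ℂ) {c : ℝ} (hc : 0 ≤ c) (h : ∀ i, ‖v i‖ ≤ c) :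
    ‖(Matrix.diagonal v : Matrix ι ι ℂ)‖ ≤ c := by
  rw [Matrix.l2_opNorm_diagonal]
  exact (pi_norm_le_iff_of_nonneg hc).mpr h

/-- If `l`, `r` are contractions then so is `l (1 - r r†) + (1 - l l†) r†`: it is the composition of
`ψ ↦ ((1 - r r†) ψ, r† ψ)` and `(a, b) ↦ l a + (1 - l l†) b`, and both maps are contractions. -/
lemma opNorm_pathRecording_le {l r : Matrix ι ι ℂ} (hl : ‖l‖ ≤ 1) (hr : ‖r‖ ≤ 1) :
    ‖l * (1 - r * rᴴ) + (1 - l * lᴴ) * rᴴ‖ ≤ 1 := by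
  have key : ∀ l r : EuclideanSpace ℂ ι →L[ℂ] EuclideanSpace ℂ ι, ‖l‖ ≤ 1 → ‖r‖ ≤ 1 →
      ‖l * (1 - r * star r) + (1 - l * star l) * star r‖ ≤ 1 := by
    intro l r hl hr
    refine ContinuousLinearMap.opNorm_le_bound _ zero_le_one fun ψ => ?_
    rw [one_mul]
    refine (pow_le_pow_iff_left₀ (by positivity) (by positivity) two_ne_zero).mp ?_
    set b := (star r) ψ with hb
    set a := ψ - r b with ha
    have happ : (l * (1 - r * star r) + (1 - l * star l) * star r) ψ =
        b + l (a - (star l) b) := by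
      simp [ha, hb, map_sub]
      abel
    have hle : ∀ (f : EuclideanSpace ℂ ι →L[ℂ] EuclideanSpace ℂ ι), ‖f‖ ≤ 1 → ∀ x,
        ‖f x‖ ^ 2 ≤ ‖x‖ ^ 2 := fun f hf x =>
      pow_le_pow_left₀ (norm_nonneg _) ((f.le_opNorm x).trans
        (mul_le_of_le_one_left (norm_nonneg _) hf)) 2
    set c := a - (star l) b with hc
    have h1 : ‖b + l c‖ ^ 2 ≤ ‖b‖ ^ 2 + ‖a‖ ^ 2 := by
      have e1 := norm_add_sq (𝕜 := ℂ) b (l c)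
      have e2 := norm_add_sq (𝕜 := ℂ) ((star l) b) c
      have e3 : inner ℂ b (l c) = inner ℂ ((star l) b) c := by
        rw [ContinuousLinearMap.star_eq_adjoint, ContinuousLinearMap.adjoint_inner_left]
      have e4 : (star l) b + c = a := by rw [hc]; abel
      rw [e4] at e2
      rw [e1, e3, e2]
      nlinarith [hle l hl c, sq_nonneg ‖(star l) b‖]
    have h2 : ‖b‖ ^ 2 + ‖a‖ ^ 2 ≤ ‖ψ‖ ^ 2 := by
      have e1 := norm_sub_sq (𝕜 := ℂ) ψ (r b)
      have e3 : inner ℂ ψ (r b) = inner ℂ b b := by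
        rw [hb, ContinuousLinearMap.star_eq_adjoint, ContinuousLinearMap.adjoint_inner_left]
      rw [e3, inner_self_eq_norm_sq] at e1
      rw [ha, e1]
      nlinarith [hle r hr b]
    rw [happ]
    linarith
  have := key (Matrix.toEuclideanCLM (n := ι) (𝕜 := ℂ) l) (Matrix.toEuclideanCLM (n := ι) (𝕜 := ℂ) r)
    (by rwa [Matrix.l2_opNorm_toEuclideanCLM]) (by rwa [Matrix.l2_opNorm_toEuclideanCLM])
  rw [← map_star, ← map_star, ← map_mul, ← map_mul,
    ← map_one (Matrix.toEuclideanCLM (n := ι) (𝕜 := ℂ)), ← map_sub, ← map_sub, ← map_mul, ← map_mul,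
    ← map_add, Matrix.l2_opNorm_toEuclideanCLM] at this
  exact this

open scoped MatrixOrder in
/-- The trace norm of a Hermitian matrix is attained at its sign: `‖M‖₁ = Tr (S M)` with
`‖S‖ ≤ 1`. -/
lemma exists_traceNorm_eq (M : Matrix ι ι ℂ) (hM : M.IsHermitian) :
    ∃ S : Matrix ι ι ℂ, ‖S‖ ≤ 1 ∧ traceNorm M = (S * M).trace.re := by
  have hM' : IsSelfAdjoint M := hM
  have hfin : ∀ f : ℝ → ℝ, ContinuousOn f (spectrum ℝ M) := fun f =>
    (Matrix.finite_real_spectrum (A := M)).continuousOn f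
  refine ⟨cfc (fun x : ℝ => SignType.sign x : ℝ → ℝ) M, ?_, ?_⟩
  · refine norm_cfc_le zero_le_one fun x _ => ?_
    rcases lt_trichotomy x 0 with h | h | h <;> simp [h]
  · have h1 : CFC.sqrt (Mᴴ * M) = cfc (fun x : ℝ => (SignType.sign x : ℝ)) M * M := by
      have h2 : CFC.abs M = cfc (fun x : ℝ => ‖x‖) M := CFC.abs_eq_cfc_norm M hM'
      have h3 : cfc (fun x : ℝ => ‖x‖) M = cfc (fun x : ℝ => (SignType.sign x : ℝ) * x) M := by
        refine cfc_congr fun x _ => ?_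
        simp [sign_mul_self]
      rw [cfc_mul _ _ M (hfin _) (hfin _), cfc_id' ℝ M] at h3
      rw [← h3, ← h2]
      rfl
    rw [traceNorm, h1]

end OpNorm

/-! ### Decoding a relation into single pairs and linked pairs -/

section Decode

open scoped Classical

variable {n : ℕ}

lemma bits_add_self (x : Bits n) : x + x = 0 := by
  funext i
  exact CharTwo.add_self_eq_zero (x i)

lemma bits_add_add_cancel (x k : Bits n) : x + k + k = x := by
  rw [add_assoc, bits_add_self, add_zero]

lemma bits_add_eq_iff (x k y : Bits n) : x + k = y ↔ x = y + k :=
  ⟨fun h => by rw [← h, bits_add_add_cancel], fun h => by rw [h, bits_add_add_cancel]⟩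

/-- The effect of the outer keys `k₁, k₃` on a pair of query and answer. It is an involution. -/
def shift (k : Keys n) (p : Bits n × Bits n) : Bits n × Bits n := (p.1 + k.1, p.2 + k.2.2)

@[simp] lemma shift_shift (k : Keys n) (p : Bits n × Bits n) : shift k (shift k p) = p := by
  simp [shift, bits_add_add_cancel]

/-- `p` links to `q` if the answer of `p`, shifted by the middle key `k₂`, is the query of `q`: this
is the trace that one query to `F X^{k₂} F` leaves in the database. -/
def Link (k : Keys n) (p q : Bits n × Bits n) : Prop := p.2 + k.2.1 = q.1

/-- No element of `L` other than `p`, `q` is linked to `p` or `q`, and the only link between these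
two is `p → q`. -/
def Isolated (k : Keys n) (L : Finset (Bits n × Bits n)) (p q : Bits n × Bits n) : Prop :=
  ∀ r ∈ L, (Link k p r → r = q) ∧ (Link k r q → r = p) ∧ ¬Link k q r ∧ ¬Link k r p

/-- `p` has no link from or to an element of `L`. -/
def Lone (k : Keys n) (L : Finset (Bits n × Bits n)) (p : Bits n × Bits n) : Prop :=
  ∀ r ∈ L, ¬Link k p r ∧ ¬Link k r p

/-- The links in `L` form a matching. -/
def Good (k : Keys n) (L : Finset (Bits n × Bits n)) : Prop :=
  ∀ p ∈ L, ∀ q ∈ L, Link k p q → Isolated k L p q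

/-- The unlinked elements of `L`, with the outer keys removed. -/
def decOne (k : Keys n) (L : Finset (Bits n × Bits n)) : Finset (Bits n × Bits n) :=
  Finset.univ.filter fun c => shift k c ∈ L ∧ Lone k L (shift k c)

/-- The pairs of first and last entry of two linked elements `(x, z) → (z + k₂, y)` of `L`. -/
def decTwo (k : Keys n) (L : Finset (Bits n × Bits n)) : Finset (Bits n × Bits n) :=
  Finset.univ.filter fun c => ∃ z, (c.1, z) ∈ L ∧ (z + k.2.1, c.2) ∈ L

/-- With the keys `k`, the relation `L` decodes into the relation `A` of the first oracle and the
relation `B` of the second oracle. -/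
structure Dec (k : Keys n) (L A B : Finset (Bits n × Bits n)) : Prop where
  good : Good k L
  one : decOne k L = A
  two : decTwo k L = B

lemma mem_decOne {k : Keys n} {L : Finset (Bits n × Bits n)} {c : Bits n × Bits n} :
    c ∈ decOne k L ↔ shift k c ∈ L ∧ Lone k L (shift k c) := by simp [decOne]

lemma mem_decTwo {k : Keys n} {L : Finset (Bits n × Bits n)} {c : Bits n × Bits n} :
    c ∈ decTwo k L ↔ ∃ z, (c.1, z) ∈ L ∧ (z + k.2.1, c.2) ∈ L := by simp [decTwo]

lemma Good.mono {k : Keys n} {L L' : Finset (Bits n × Bits n)} (h : Good k L) (hs : L' ⊆ L) :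
    Good k L' := fun p hp q hq hl r hr => h p (hs hp) q (hs hq) hl r (hs hr)

lemma good_insert_lone {k : Keys n} {L : Finset (Bits n × Bits n)} {e : Bits n × Bits n}
    (he : Lone k (insert e L) e) : Good k (insert e L) ↔ Good k L := by
  refine ⟨fun h => h.mono (Finset.subset_insert _ _), fun h p hp q hq hl r hr => ?_⟩
  have hpe : p ≠ e := fun h => (he q hq).1 (h ▸ hl)
  have hqe : q ≠ e := fun h => (he p hp).2 (h ▸ hl)
  have hp' := Finset.mem_of_mem_insert_of_ne hp hpe
  have hq' := Finset.mem_of_mem_insert_of_ne hq hqe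
  by_cases hre : r = e
  · subst hre
    exact ⟨fun h => absurd h (he p hp).2, fun h => absurd h (he q hq).1, (he q hq).2, (he p hp).1⟩
  · exact h p hp' q hq' hl r (Finset.mem_of_mem_insert_of_ne hr hre)

lemma decOne_insert_lone {k : Keys n} {L : Finset (Bits n × Bits n)} {e : Bits n × Bits n}
    (he : Lone k (insert e L) e) : decOne k (insert e L) = insert (shift k e) (decOne k L) := by
  ext c
  rw [Finset.mem_insert, mem_decOne, mem_decOne]
  constructor
  · rintro ⟨h1, h2⟩
    by_cases hc : shift k c = e
    · left; rw [← hc, shift_shift]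
    · exact Or.inr ⟨Finset.mem_of_mem_insert_of_ne h1 hc,
        fun r hr => h2 r (Finset.mem_insert_of_mem hr)⟩
  · rintro (rfl | ⟨h1, h2⟩)
    · rw [shift_shift]; exact ⟨Finset.mem_insert_self _ _, he⟩
    · refine ⟨Finset.mem_insert_of_mem h1, fun r hr => ?_⟩
      rcases Finset.mem_insert.mp hr with rfl | hr
      · exact ⟨(he _ (Finset.mem_insert_of_mem h1)).2, (he _ (Finset.mem_insert_of_mem h1)).1⟩
      · exact h2 r hr

lemma decTwo_insert_lone {k : Keys n} {L : Finset (Bits n × Bits n)} {e : Bits n × Bits n}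
    (he : Lone k (insert e L) e) : decTwo k (insert e L) = decTwo k L := by
  ext c
  rw [mem_decTwo, mem_decTwo]
  constructor
  · rintro ⟨z, h1, h2⟩
    refine ⟨z, Finset.mem_of_mem_insert_of_ne h1 ?_, Finset.mem_of_mem_insert_of_ne h2 ?_⟩
    · rintro rfl; exact (he _ h2).1 rfl
    · rintro rfl; exact (he _ h1).2 rfl
  · rintro ⟨z, h1, h2⟩
    exact ⟨z, Finset.mem_insert_of_mem h1, Finset.mem_insert_of_mem h2⟩

section Pair

variable {k : Keys n} {L : Finset (Bits n × Bits n)} {p q : Bits n × Bits n}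

lemma good_insert_pair (hi : Isolated k (insert q (insert p L)) p q) :
    Good k (insert q (insert p L)) ↔ Good k L := by
  have hp : p ∈ insert q (insert p L) := by simp
  have hq : q ∈ insert q (insert p L) := by simp
  refine ⟨fun h => h.mono ((Finset.subset_insert _ _).trans (Finset.subset_insert _ _)),
    fun h a ha b hb hl => ?_⟩
  have haq : a ≠ q := fun h => (hi b hb).2.2.1 (h ▸ hl)
  have hbp : b ≠ p := fun h => (hi a ha).2.2.2 (h ▸ hl)
  by_cases hap : a = p
  · subst hap
    have := (hi b hb).1 hl
    subst this
    exact hi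
  have hbq : b ≠ q := fun h => hap ((hi a ha).2.1 (h ▸ hl))
  have ha' : a ∈ L := by simpa [haq, hap] using ha
  have hb' : b ∈ L := by simpa [hbq, hbp] using hb
  intro r hr
  by_cases hrq : r = q
  · subst hrq
    exact ⟨fun h => absurd ((hi a ha).2.1 h) hap, fun h => absurd h (hi b hb).2.2.1,
      fun h => hbp ((hi b hb).2.1 h), (hi a ha).2.2.1⟩
  by_cases hrp : r = p
  · subst hrp
    exact ⟨fun h => absurd h (hi a ha).2.2.2, fun h => absurd ((hi b hb).1 h) hbq,
      (hi b hb).2.2.2, fun h => haq ((hi a ha).1 h)⟩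
  exact h a ha' b hb' hl r (by simpa [hrq, hrp] using hr)

lemma decOne_insert_pair (hp : p ∉ L) (hq : q ∉ L) (hl : Link k p q)
    (hi : Isolated k (insert q (insert p L)) p q) :
    decOne k (insert q (insert p L)) = decOne k L := by
  have hp' : p ∈ insert q (insert p L) := by simp
  have hq' : q ∈ insert q (insert p L) := by simp
  ext c
  rw [mem_decOne, mem_decOne]
  constructor
  · rintro ⟨h1, h2⟩
    have hcq : shift k c ≠ q := fun h => (h2 p hp').2 (h ▸ hl)
    have hcp : shift k c ≠ p := fun h => (h2 q hq').1 (h ▸ hl)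
    exact ⟨by simpa [hcq, hcp] using h1, fun r hr => h2 r (by simp [hr])⟩
  · rintro ⟨h1, h2⟩
    have h1' : shift k c ∈ insert q (insert p L) := by simp [h1]
    have hcq : shift k c ≠ q := fun h => hq (h ▸ h1)
    have hcp : shift k c ≠ p := fun h => hp (h ▸ h1)
    refine ⟨h1', fun r hr => ?_⟩
    obtain ⟨i1, i2, i3, i4⟩ := hi _ h1'
    simp only [Finset.mem_insert] at hr
    rcases hr with rfl | rfl | hr
    · exact ⟨fun h => hcp (i2 h), i3⟩
    · exact ⟨i4, fun h => hcq (i1 h)⟩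
    · exact h2 r hr

lemma decTwo_insert_pair (hl : Link k p q) (hi : Isolated k (insert q (insert p L)) p q) :
    decTwo k (insert q (insert p L)) = insert (p.1, q.2) (decTwo k L) := by
  ext c
  rw [Finset.mem_insert, mem_decTwo, mem_decTwo]
  constructor
  · rintro ⟨z, h1, h2⟩
    have hcl : Link k (c.1, z) (z + k.2.1, c.2) := rfl
    by_cases hap : (c.1, z) = p
    · have hbq := (hi _ h2).1 (hap ▸ hcl)
      left
      rw [← hap, ← hbq]
    · right
      have hbq : (z + k.2.1, c.2) ≠ q := fun h => hap ((hi _ h1).2.1 (h ▸ hcl))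
      have haq : (c.1, z) ≠ q := fun h => (hi _ h2).2.2.1 (h ▸ hcl)
      have hbp : (z + k.2.1, c.2) ≠ p := fun h => (hi _ h1).2.2.2 (h ▸ hcl)
      exact ⟨z, by simpa [hap, haq] using h1, by simpa [hbq, hbp] using h2⟩
  · rintro (rfl | ⟨z, h1, h2⟩)
    · refine ⟨p.2, by simp, ?_⟩
      have : (p.2 + k.2.1, q.2) = q := Prod.ext hl rfl
      simp [this]
    · exact ⟨z, by simp [h1], by simp [h2]⟩

end Pair

/-- Every element of an encoding either comes from `A`, or is the first or the second half of a
linked pair coming from `B`; `z` holds the intermediate values of these pairs. -/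
def merge (k : Keys n) (A B : Finset (Bits n × Bits n)) (z : B → Bits n) :
    Finset (Bits n × Bits n) :=
  A.image (shift k) ∪ Finset.univ.image (fun c : B => (c.1.1, z c)) ∪
    Finset.univ.image (fun c : B => (z c + k.2.1, c.1.2))

lemma mem_merge {k : Keys n} {A B : Finset (Bits n × Bits n)} {z : B → Bits n}
    {r : Bits n × Bits n} : r ∈ merge k A B z ↔
      (∃ a ∈ A, r = shift k a) ∨ (∃ c : B, r = (c.1.1, z c)) ∨
        (∃ c : B, r = (z c + k.2.1, c.1.2)) := by
  simp [merge, eq_comm]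

lemma card_merge_le (k : Keys n) (A B : Finset (Bits n × Bits n)) (z : B → Bits n) :
    (merge k A B z).card ≤ A.card + 2 * B.card := by
  have h1 := Finset.card_image_le (s := A) (f := shift k)
  have h2 := Finset.card_image_le (s := (Finset.univ : Finset B)) (f := fun c => (c.1.1, z c))
  have h3 := Finset.card_image_le (s := (Finset.univ : Finset B))
    (f := fun c => (z c + k.2.1, c.1.2))
  rw [Finset.card_univ, Fintype.card_coe] at h2 h3
  have h4 := Finset.card_union_le (A.image (shift k))
    (Finset.univ.image (fun c : B => (c.1.1, z c)))
  have h5 := Finset.card_union_le (A.image (shift k) ∪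
    Finset.univ.image (fun c : B => (c.1.1, z c)))
    (Finset.univ.image (fun c : B => (z c + k.2.1, c.1.2)))
  unfold merge
  omega

/-- A relation is determined by what it decodes into, the keys and the intermediate values. -/
lemma Dec.exists_merge {k : Keys n} {L A B : Finset (Bits n × Bits n)} (h : Dec k L A B)
    (hL : IDistinct L ∨ DDistinct L) : ∃ z : B → Bits n, L = merge k A B z := by
  have h2 : ∀ c : B, ∃ z, (c.1.1, z) ∈ L ∧ (z + k.2.1, c.1.2) ∈ L := fun c =>
    mem_decTwo.mp (h.two ▸ c.2)
  choose z hz1 hz2 using h2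
  refine ⟨z, ?_⟩
  have pair : ∀ p ∈ L, ∀ q ∈ L, Link k p q → ∃ c : B, p = (c.1.1, z c) ∧
      q = (z c + k.2.1, c.1.2) := by
    intro p hp q hq hl
    have hc : (p.1, q.2) ∈ B := by
      rw [← h.two, mem_decTwo]
      refine ⟨p.2, hp, ?_⟩
      have : (p.2 + k.2.1, q.2) = q := Prod.ext hl rfl
      rwa [this]
    refine ⟨⟨_, hc⟩, ?_⟩
    have e1 := hz1 ⟨_, hc⟩
    have e2 := hz2 ⟨_, hc⟩
    rcases hL with hL | hL
    · have hq' := hL _ hq _ e2 rfl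
      have hzp : p.2 = z ⟨_, hc⟩ := by
        have h3 : p.2 + k.2.1 = z ⟨_, hc⟩ + k.2.1 := hl.trans (congrArg Prod.fst hq')
        exact add_right_cancel h3
      exact ⟨Prod.ext rfl hzp, hq'⟩
    · have hp' := hL _ hp _ e1 rfl
      exact ⟨hp', Prod.ext (hl.symm.trans (congrArg (fun a => a.2 + k.2.1) hp')) rfl⟩
  ext r
  rw [mem_merge]
  constructor
  · intro hr
    by_cases hlone : Lone k L r
    · left
      refine ⟨shift k r, ?_, (shift_shift k r).symm⟩
      rw [← h.one, mem_decOne, shift_shift]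
      exact ⟨hr, hlone⟩
    · right
      rw [Lone] at hlone
      push Not at hlone
      obtain ⟨s, hs, hsr⟩ := hlone
      by_cases hl : Link k r s
      · obtain ⟨c, hc, -⟩ := pair r hr s hs hl
        exact Or.inl ⟨c, hc⟩
      · obtain ⟨c, -, hc⟩ := pair s hs r hr (hsr hl)
        exact Or.inr ⟨c, hc⟩
  · rintro (⟨a, ha, rfl⟩ | ⟨c, rfl⟩ | ⟨c, rfl⟩)
    · rw [← h.one, mem_decOne] at ha
      exact ha.1
    · exact hz1 c
    · exact hz2 c

/-! ### Counting encodings -/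

section Rare

variable {Ω : Type*} [Fintype Ω]

/-- The event `E` has probability at most `m / N` under the uniform distribution on `Ω`. -/
def Rare (n : ℕ) (m : ℕ) (E : Ω → Prop) : Prop :=
  (Finset.univ.filter E).card * 2 ^ n ≤ m * Fintype.card Ω

lemma Rare.mono {m m' : ℕ} {E E' : Ω → Prop} (h : Rare n m E) (hE : ∀ ω, E' ω → E ω)
    (hm : m ≤ m') : Rare n m' E' := by
  have h1 : (Finset.univ.filter E').card ≤ (Finset.univ.filter E).card :=
    Finset.card_le_card (Finset.monotone_filter_right _ fun ω _ h => hE ω h)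
  exact (Nat.mul_le_mul_right _ h1).trans (h.trans (Nat.mul_le_mul_right _ hm))

lemma Rare.or {m m' : ℕ} {E E' : Ω → Prop} (h : Rare n m E) (h' : Rare n m' E') :
    Rare n (m + m') fun ω => E ω ∨ E' ω := by
  unfold Rare at *
  have := Finset.card_union_le (Finset.univ.filter E) (Finset.univ.filter E')
  refine (Nat.mul_le_mul_right _ ((Finset.card_le_card fun ω hω => ?_).trans this)).trans ?_
  · simpa using hω
  · rw [add_mul, add_mul]
    exact add_le_add h h'

lemma Rare.exists_mem {ι : Type*} {s : Finset ι} {m : ℕ} {E : ι → Ω → Prop}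
    (h : ∀ i ∈ s, Rare n m (E i)) : Rare n (s.card * m) fun ω => ∃ i ∈ s, E i ω := by
  induction s using Finset.induction_on with
  | empty => simp [Rare]
  | insert i s hi ih =>
    rw [Finset.card_insert_of_notMem hi]
    refine ((h i (by simp)).or (ih fun j hj => h j (by simp [hj]))).mono (fun ω hω => ?_)
      (by rw [add_mul, one_mul, add_comm])
    simpa using hω

lemma Rare.exists_coe {ι : Type*} {s : Finset ι} {m : ℕ} {E : s → Ω → Prop}
    (h : ∀ i, Rare n m (E i)) : Rare n (s.card * m) fun ω => ∃ i : s, E i ω := by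
  have := Rare.exists_mem (s := (Finset.univ : Finset s)) fun i _ => h i
  simpa using this

/-- An event that contains at most one point of every line `ω + ι (Bits n)` has probability at most
`1 / N`. -/
lemma rare_of_line [AddCommGroup Ω] {E : Ω → Prop} (ι : Bits n →+ Ω)
    (h : ∀ ω v, E ω → E (ω + ι v) → v = 0) : Rare n 1 E := by
  have hc : Fintype.card (Bits n) = 2 ^ n := by simp [Bits, ZMod.card]
  unfold Rare
  rw [one_mul, ← hc, ← Finset.card_univ (α := Bits n), ← Finset.card_product]
  refine Finset.card_le_card_of_injOn (t := Finset.univ) (fun w => w.1 + ι w.2)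
    (fun _ _ => Finset.mem_coe.mpr (Finset.mem_univ _)) ?_
  rintro ⟨ω, v⟩ h1 ⟨ω', v'⟩ h2 heq
  simp only [Finset.coe_product, Set.mem_prod, Finset.mem_coe, Finset.mem_filter,
    Finset.mem_univ, true_and, and_true] at h1 h2 heq
  have h3 : ω' = ω + ι (v - v') := by
    rw [map_sub, ← add_sub_assoc, heq, add_sub_cancel_right]
  have h4 := h ω (v - v') h1 (h3 ▸ h2)
  have h5 : v = v' := sub_eq_zero.mp h4
  subst h5
  simpa using heq

end Rare

end Decode

section Conflicts

open scoped Classical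

variable {n : ℕ} {A B B' : Finset (Bits n × Bits n)}

/-- The random choices behind an encoding: the keys, and the intermediate values of the pairs `B`
in the left database and of the pairs `B'` in the right database. -/
abbrev Choices (n : ℕ) (B B' : Finset (Bits n × Bits n)) : Type :=
  Keys n × (B → Bits n) × (B' → Bits n)

/-- Translation of the key `k₁`. -/
def moveOne : Bits n →+ Choices n B B' :=
  (AddMonoidHom.inl _ _).comp (AddMonoidHom.inl _ _)

/-- Translation of the key `k₂`. -/
def moveTwo : Bits n →+ Choices n B B' :=
  (AddMonoidHom.inl _ _).comp ((AddMonoidHom.inr _ _).comp (AddMonoidHom.inl _ _))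

/-- Translation of the key `k₃`. -/
def moveThree : Bits n →+ Choices n B B' :=
  (AddMonoidHom.inl _ _).comp ((AddMonoidHom.inr _ _).comp (AddMonoidHom.inr _ _))

/-- Translation of the intermediate value of `c`. -/
def moveMid (c : B) : Bits n →+ Choices n B B' :=
  (AddMonoidHom.inr _ _).comp ((AddMonoidHom.inl _ _).comp
    (AddMonoidHom.single (fun _ : B => Bits n) c))

lemma add_left_fixed {a b v : Bits n} (h : a = b) (h' : a + v = b) : v = 0 := by
  rw [h] at h'; simpa using h'

/-- Adding the element `e` to `L` would repeat an answer or create a link. -/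
def ConflictOne (k : Keys n) (L : Finset (Bits n × Bits n)) (e : Bits n × Bits n) : Prop :=
  e.2 ∈ im L ∨ ¬Lone k (insert e L) e

/-- Adding the linked pair `p → q` to `L` would repeat an answer, or create a link other than the
one from `p` to `q`. -/
def ConflictTwo (k : Keys n) (L : Finset (Bits n × Bits n)) (p q : Bits n × Bits n) : Prop :=
  p.2 ∈ im L ∨ q.2 ∈ im L ∨ p.2 = q.2 ∨ ¬Isolated k (insert q (insert p L)) p q

lemma mem_im {L : Finset (Bits n × Bits n)} {y : Bits n} : y ∈ im L ↔ ∃ x, (x, y) ∈ L := by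
  simp [im]

lemma ConflictOne.cases {k : Keys n} {z : B → Bits n} {x y : Bits n} (hy : y ∉ im A)
    (h : ConflictOne k (merge k A B z) (shift k (x, y))) :
    (∃ c : B, y + k.2.2 = z c) ∨ (∃ c : B, y + k.2.2 = c.1.2) ∨
    (y + k.2.2 + k.2.1 = x + k.1) ∨ (∃ a ∈ A, y + k.2.2 + k.2.1 = a.1 + k.1) ∨
    (∃ c : B, y + k.2.2 + k.2.1 = c.1.1) ∨ (∃ c : B, y + k.2.2 + k.2.1 = z c + k.2.1) ∨
    (∃ a ∈ A, a.2 + k.2.2 + k.2.1 = x + k.1) ∨ (∃ c : B, z c + k.2.1 = x + k.1) ∨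
    (∃ c : B, c.1.2 + k.2.1 = x + k.1) := by
  rcases h with h | h
  · obtain ⟨w, hw⟩ := mem_im.mp h
    rcases mem_merge.mp hw with ⟨a, ha, e⟩ | ⟨c, e⟩ | ⟨c, e⟩
    · exfalso
      have e2 : y + k.2.2 = a.2 + k.2.2 := congrArg Prod.snd e
      have e3 := add_right_cancel e2
      exact hy (mem_im.mpr ⟨a.1, by rw [e3]; exact ha⟩)
    · exact Or.inl ⟨c, congrArg Prod.snd e⟩
    · exact Or.inr (Or.inl ⟨c, congrArg Prod.snd e⟩)
  · rw [Lone] at h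
    push Not at h
    obtain ⟨r, hr, hl⟩ := h
    rw [← or_iff_not_imp_left] at hl
    rcases Finset.mem_insert.mp hr with rfl | hr
    · have : y + k.2.2 + k.2.1 = x + k.1 := by rcases hl with hl | hl <;> exact hl
      simp [this]
    · rcases mem_merge.mp hr with ⟨a, ha, rfl⟩ | ⟨c, rfl⟩ | ⟨c, rfl⟩ <;> rcases hl with hl | hl
      · have : ∃ a ∈ A, y + k.2.2 + k.2.1 = a.1 + k.1 := ⟨a, ha, hl⟩
        simp only [this, true_or, or_true]
      · have : ∃ a ∈ A, a.2 + k.2.2 + k.2.1 = x + k.1 := ⟨a, ha, hl⟩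
        simp only [this, true_or, or_true]
      · have : ∃ c : B, y + k.2.2 + k.2.1 = c.1.1 := ⟨c, hl⟩
        simp only [this, true_or, or_true]
      · have : ∃ c : B, z c + k.2.1 = x + k.1 := ⟨c, hl⟩
        simp only [this, true_or, or_true]
      · have : ∃ c : B, y + k.2.2 + k.2.1 = z c + k.2.1 := ⟨c, hl⟩
        simp only [this, true_or, or_true]
      · have : ∃ c : B, c.1.2 + k.2.1 = x + k.1 := ⟨c, hl⟩
        simp only [this, or_true]

/-- Each of the coincidences behind a conflict is an equation whose two sides change differently when
one of the keys is translated, so that it holds for at most one value of this key. -/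
lemma rare_conflictOne {x y : Bits n} (hy : y ∉ im A) :
    Rare n (6 * (A.card + B.card) + 1) fun ω : Choices n B B' =>
      ConflictOne ω.1 (merge ω.1 A B ω.2.1) (shift ω.1 (x, y)) := by
  refine Rare.mono (m := B.card * 1 + (B.card * 1 + (1 + (A.card * 1 + (B.card * 1 +
    (B.card * 1 + (A.card * 1 + (B.card * 1 + B.card * 1)))))))) ?_ (fun ω h => h.cases hy)
    (by omega)
  refine Rare.or (Rare.exists_coe fun c => rare_of_line moveThree ?_) <|
    Rare.or (Rare.exists_coe fun c => rare_of_line moveThree ?_) <|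
    Rare.or (rare_of_line moveThree ?_) <|
    Rare.or (Rare.exists_mem fun a _ => rare_of_line moveThree ?_) <|
    Rare.or (Rare.exists_coe fun c => rare_of_line moveThree ?_) <|
    Rare.or (Rare.exists_coe fun c => rare_of_line moveThree ?_) <|
    Rare.or (Rare.exists_mem fun a _ => rare_of_line moveThree ?_) <|
    Rare.or (Rare.exists_coe fun c => rare_of_line moveOne ?_) <|
    Rare.exists_coe fun c => rare_of_line moveOne ?_
  all_goals
    intro ω v h h'
    simp only [moveOne, moveThree, AddMonoidHom.comp_apply, AddMonoidHom.inl_apply,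
      AddMonoidHom.inr_apply, Prod.fst_add, Prod.snd_add, add_zero] at h'
    first
    | exact add_left_fixed h h'
    | refine add_left_fixed h (Eq.trans ?_ h'); abel
    | refine add_left_fixed h.symm (Eq.trans ?_ h'.symm); abel

lemma ConflictTwo.cases {k : Keys n} {z : B → Bits n} {x y u : Bits n} (hy : y ∉ im B)
    (h : ConflictTwo k (merge k A B z) (x, u) (u + k.2.1, y)) :
    (∃ a ∈ A, u = a.2 + k.2.2) ∨ (∃ c : B, u = z c) ∨ (∃ c : B, u = c.1.2) ∨
    (∃ a ∈ A, y = a.2 + k.2.2) ∨ (∃ c : B, y = z c) ∨ (u = y) ∨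
    (∃ a ∈ A, u + k.2.1 = a.1 + k.1) ∨ (∃ c : B, u + k.2.1 = c.1.1) ∨
    (∃ c : B, u + k.2.1 = z c + k.2.1) ∨
    (∃ a ∈ A, y + k.2.1 = a.1 + k.1) ∨ (∃ c : B, y + k.2.1 = c.1.1) ∨
    (∃ c : B, y + k.2.1 = z c + k.2.1) ∨
    (∃ a ∈ A, a.2 + k.2.2 + k.2.1 = x) ∨ (∃ c : B, z c + k.2.1 = x) ∨
    (∃ c : B, c.1.2 + k.2.1 = x) ∨ (u + k.2.1 = x) ∨ (y + k.2.1 = x) := by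
  have fresh : u ∈ im (merge k A B z) → (∃ a ∈ A, u = a.2 + k.2.2) ∨ (∃ c : B, u = z c) ∨
      (∃ c : B, u = c.1.2) := by
    intro h
    obtain ⟨w, hw⟩ := mem_im.mp h
    rcases mem_merge.mp hw with ⟨a, ha, e⟩ | ⟨c, e⟩ | ⟨c, e⟩
    · exact Or.inl ⟨a, ha, congrArg Prod.snd e⟩
    · exact Or.inr (Or.inl ⟨c, congrArg Prod.snd e⟩)
    · exact Or.inr (Or.inr ⟨c, congrArg Prod.snd e⟩)
  by_cases hfr : u ∈ im (merge k A B z)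
  · rcases fresh hfr with h | h | h <;> simp only [h, true_or, or_true]
  rcases h with h | h | h | h
  · exact absurd h hfr
  · obtain ⟨w, hw⟩ := mem_im.mp h
    rcases mem_merge.mp hw with ⟨a, ha, e⟩ | ⟨c, e⟩ | ⟨c, e⟩
    · have : ∃ a ∈ A, y = a.2 + k.2.2 := ⟨a, ha, congrArg Prod.snd e⟩
      simp only [this, true_or, or_true]
    · have : ∃ c : B, y = z c := ⟨c, congrArg Prod.snd e⟩
      simp only [this, true_or, or_true]
    · exfalso
      have e2 : y = c.1.2 := congrArg Prod.snd e
      exact hy (mem_im.mpr ⟨c.1.1, by rw [e2]; exact c.2⟩)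
  · have : u = y := h
    simp only [this, true_or, or_true]
  · by_cases huy : u = y
    · simp only [huy, true_or, or_true]
    by_cases hux : u + k.2.1 = x
    · simp only [hux, true_or, or_true]
    by_cases hyx : y + k.2.1 = x
    · simp only [hyx, or_true]
    rw [Isolated] at h
    push Not at h
    obtain ⟨r, hr, hl⟩ := h
    simp only [Finset.mem_insert] at hr
    simp only [Link] at hl
    have hl' : (u + k.2.1 = r.1 ∧ r ≠ (u + k.2.1, y)) ∨
        (r.2 + k.2.1 = u + k.2.1 ∧ r ≠ (x, u)) ∨ y + k.2.1 = r.1 ∨ r.2 + k.2.1 = x := by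
      by_contra hcon
      push Not at hcon
      exact hcon.2.2.2 (hl hcon.1 hcon.2.1 hcon.2.2.1)
    rcases hr with rfl | rfl | hr
    · exfalso
      rcases hl' with hl | hl | hl | hl
      · exact hl.2 rfl
      · exact huy (add_right_cancel hl.1).symm
      · exact huy (add_right_cancel hl).symm
      · exact hyx hl
    · exfalso
      rcases hl' with hl | hl | hl | hl
      · exact hux hl.1
      · exact hl.2 rfl
      · exact hyx hl
      · exact hux hl
    · rcases hl' with hl | hl | hl | hl
      · have hl := hl.1
        rcases mem_merge.mp hr with ⟨a, ha, rfl⟩ | ⟨c, rfl⟩ | ⟨c, rfl⟩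
        · have : ∃ a ∈ A, u + k.2.1 = a.1 + k.1 := ⟨a, ha, hl⟩
          simp only [this, true_or, or_true]
        · have : ∃ c : B, u + k.2.1 = c.1.1 := ⟨c, hl⟩
          simp only [this, true_or, or_true]
        · have : ∃ c : B, u + k.2.1 = z c + k.2.1 := ⟨c, hl⟩
          simp only [this, true_or, or_true]
      · exfalso
        have hl := add_right_cancel hl.1
        exact hfr (mem_im.mpr ⟨r.1, by rw [← hl]; exact hr⟩)
      · rcases mem_merge.mp hr with ⟨a, ha, rfl⟩ | ⟨c, rfl⟩ | ⟨c, rfl⟩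
        · have : ∃ a ∈ A, y + k.2.1 = a.1 + k.1 := ⟨a, ha, hl⟩
          simp only [this, true_or, or_true]
        · have : ∃ c : B, y + k.2.1 = c.1.1 := ⟨c, hl⟩
          simp only [this, true_or, or_true]
        · have : ∃ c : B, y + k.2.1 = z c + k.2.1 := ⟨c, hl⟩
          simp only [this, true_or, or_true]
      · rcases mem_merge.mp hr with ⟨a, ha, rfl⟩ | ⟨c, rfl⟩ | ⟨c, rfl⟩
        · have : ∃ a ∈ A, a.2 + k.2.2 + k.2.1 = x := ⟨a, ha, hl⟩
          simp only [this, true_or, or_true]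
        · have : ∃ c : B, z c + k.2.1 = x := ⟨c, hl⟩
          simp only [this, true_or, or_true]
        · have : ∃ c : B, c.1.2 + k.2.1 = x := ⟨c, hl⟩
          simp only [this, true_or, or_true]

lemma rare_conflictTwo {x y : Bits n} (hy : y ∉ im B) :
    Rare n (9 * (A.card + B.card) + 3) fun ω : Bits n × Choices n B B' =>
      ConflictTwo ω.2.1 (merge ω.2.1 A B ω.2.2.1) (x, ω.1) (ω.1 + ω.2.1.2.1, y) := by
  -- translations of the fresh intermediate value and of the other choices; every coincidence
  -- behind a conflict is destroyed by one of them
  let m₀ : Bits n →+ Bits n × Choices n B B' := AddMonoidHom.inl _ _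
  let m₁ : Bits n →+ Bits n × Choices n B B' := (AddMonoidHom.inr _ _).comp moveOne
  let m₂ : Bits n →+ Bits n × Choices n B B' := (AddMonoidHom.inr _ _).comp moveTwo
  let m₃ : Bits n →+ Bits n × Choices n B B' := (AddMonoidHom.inr _ _).comp moveThree
  let mz : B → Bits n →+ Bits n × Choices n B B' := fun c => (AddMonoidHom.inr _ _).comp (moveMid c)
  refine Rare.mono (m := A.card * 1 + (B.card * 1 + (B.card * 1 + (A.card * 1 + (B.card * 1 + (1 +
    (A.card * 1 + (B.card * 1 + (B.card * 1 + (A.card * 1 + (B.card * 1 + (B.card * 1 +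
    (A.card * 1 + (B.card * 1 + (B.card * 1 + (1 + 1)))))))))))))))) ?_ (fun ω h => h.cases hy)
    (by omega)
  refine Rare.or (Rare.exists_mem fun a _ => rare_of_line m₀ ?_) <|
    Rare.or (Rare.exists_coe fun c => rare_of_line m₀ ?_) <|
    Rare.or (Rare.exists_coe fun c => rare_of_line m₀ ?_) <|
    Rare.or (Rare.exists_mem fun a _ => rare_of_line m₃ ?_) <|
    Rare.or (Rare.exists_coe fun c => rare_of_line (mz c) ?_) <|
    Rare.or (rare_of_line m₀ ?_) <|
    Rare.or (Rare.exists_mem fun a _ => rare_of_line m₀ ?_) <|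
    Rare.or (Rare.exists_coe fun c => rare_of_line m₀ ?_) <|
    Rare.or (Rare.exists_coe fun c => rare_of_line m₀ ?_) <|
    Rare.or (Rare.exists_mem fun a _ => rare_of_line m₁ ?_) <|
    Rare.or (Rare.exists_coe fun c => rare_of_line m₂ ?_) <|
    Rare.or (Rare.exists_coe fun c => rare_of_line (mz c) ?_) <|
    Rare.or (Rare.exists_mem fun a _ => rare_of_line m₃ ?_) <|
    Rare.or (Rare.exists_coe fun c => rare_of_line m₂ ?_) <|
    Rare.or (Rare.exists_coe fun c => rare_of_line m₂ ?_) <|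
    Rare.or (rare_of_line m₀ ?_) (rare_of_line m₂ ?_)
  all_goals
    intro ω v h h'
    simp only [m₀, m₁, m₂, m₃, mz, moveOne, moveTwo, moveThree, moveMid, AddMonoidHom.comp_apply,
      AddMonoidHom.inl_apply, AddMonoidHom.inr_apply, AddMonoidHom.single_apply, Prod.fst_add,
      Prod.snd_add, add_zero, Pi.add_apply, Pi.single_eq_same] at h'
    first
    | exact add_left_fixed h h'
    | refine add_left_fixed h (Eq.trans ?_ h'); abel
    | refine add_left_fixed h.symm (Eq.trans ?_ h'.symm); abel

/-- The register `A`, shifted by `k₃`, rarely holds an answer recorded in a linked pair. -/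
lemma rare_hit_linked (y : Bits n) :
    Rare n (2 * B.card) fun ω : Choices n B B' =>
      (∃ c : B, y + ω.1.2.2 = ω.2.1 c) ∨ ∃ c : B, y + ω.1.2.2 = c.1.2 := by
  refine Rare.mono (m := B.card * 1 + B.card * 1) ?_ (fun ω h => h) (by omega)
  refine Rare.or (Rare.exists_coe fun c => rare_of_line moveThree ?_) <|
    Rare.exists_coe fun c => rare_of_line moveThree ?_
  all_goals
    intro ω v h h'
    simp only [moveThree, AddMonoidHom.comp_apply, AddMonoidHom.inl_apply,
      AddMonoidHom.inr_apply, Prod.fst_add, Prod.snd_add, add_zero] at h'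
    exact add_left_fixed h (Eq.trans (by abel) h')

/-- The register `A` rarely holds an answer recorded in an unlinked element or in the first half of
a linked pair. -/
lemma rare_hit_unlinked (y : Bits n) :
    Rare n (A.card + B.card) fun ω : Choices n B B' =>
      (∃ a ∈ A, y = a.2 + ω.1.2.2) ∨ ∃ c : B, y = ω.2.1 c := by
  refine Rare.mono (m := A.card * 1 + B.card * 1) ?_ (fun ω h => h) (by omega)
  refine Rare.or (Rare.exists_mem fun a _ => rare_of_line moveThree ?_) <|
    Rare.exists_coe fun c => rare_of_line (moveMid c) ?_
  all_goals
    intro ω v h h'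
    simp only [moveThree, moveMid, AddMonoidHom.comp_apply, AddMonoidHom.inl_apply,
      AddMonoidHom.inr_apply, AddMonoidHom.single_apply, Prod.fst_add, Prod.snd_add,
      Pi.add_apply, Pi.single_eq_same] at h'
    first
    | exact add_left_fixed h.symm h'.symm
    | exact add_left_fixed h.symm (Eq.trans (by abel) h'.symm)

end Conflicts

/-! ### Matrices given by relations between basis labels -/

section Ind

open scoped Classical Matrix.Norms.L2Operator

variable {ι κ μ : Type*} [Fintype ι] [Fintype κ] [Fintype μ] [DecidableEq ι] [DecidableEq κ]
  [DecidableEq μ]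

/-- The matrix whose column `j` has the entry `c j` in the rows related to `j`, and `0` in the other
rows. -/
def ind (P : ι → κ → Prop) (c : κ → ℝ) : Matrix ι κ ℂ :=
  Matrix.of fun i j => if P i j then (c j : ℂ) else 0

lemma ind_congr {P Q : ι → κ → Prop} {c c' : κ → ℝ} (h : ∀ i j, P i j ↔ Q i j)
    (hc : ∀ i j, P i j → c j = c' j) : ind P c = ind Q c' := by
  ext i j
  by_cases hP : P i j
  · simp [ind, hP, (h i j).mp hP, hc i j hP]
  · have hQ : ¬Q i j := fun hQ => hP ((h i j).mpr hQ)
    simp [ind, hP, hQ]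

lemma conjTranspose_ind (P : ι → κ → Prop) (c : ℝ) :
    (ind P fun _ => c)ᴴ = ind (fun j i => P i j) fun _ => c := by
  ext j i
  by_cases hP : P i j <;> simp [ind, hP]

lemma ind_mul_ind {P : ι → κ → Prop} {Q : κ → μ → Prop} {c : κ → ℝ} {c' c'' : μ → ℝ}
    (hu : ∀ i l j j', P i j → Q j l → P i j' → Q j' l → j = j')
    (hc : ∀ i j l, P i j → Q j l → c j * c' l = c'' l) :
    ind P c * ind Q c' = ind (fun i l => ∃ j, P i j ∧ Q j l) c'' := by
  ext i l
  rw [Matrix.mul_apply]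
  by_cases h : ∃ j, P i j ∧ Q j l
  · obtain ⟨j, hP, hQ⟩ := h
    rw [Finset.sum_eq_single j]
    · have h : ∃ j, P i j ∧ Q j l := ⟨j, hP, hQ⟩
      simp [ind, hP, hQ, h, ← hc i j l hP hQ]
    · intro j' _ hj'
      by_cases hP' : P i j'
      · by_cases hQ' : Q j' l
        · exact absurd (hu i l j' j hP' hQ' hP hQ) hj'
        · simp [ind, hQ']
      · simp [ind, hP']
    · simp
  · rw [Finset.sum_eq_zero]
    · simp [ind, h]
    · intro j _
      by_cases hP' : P i j
      · have hQ' : ¬Q j l := fun hQ => h ⟨j, hP', hQ⟩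
        simp [ind, hQ']
      · simp [ind, hP']

/-- The number of elements satisfying `S`, as a real number. -/
def count {σ : Type*} [Fintype σ] (S : σ → Prop) : ℝ := ((Finset.univ.filter S).card : ℝ)

lemma count_of_forall_not {σ : Type*} [Fintype σ] {S : σ → Prop} (h : ∀ i, ¬S i) :
    count S = 0 := by
  rw [count, Finset.filter_false_of_mem fun i _ => h i]
  simp

lemma count_le_of_rare {σ Ω : Type*} [Fintype σ] [Fintype Ω] {n m : ℕ} {S : σ → Prop}
    {E : Ω → Prop} (hE : Rare n m E) (f : Ω → σ → Prop) (hcov : ∀ s, S s → ∃ ω, E ω ∧ f ω s)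
    (hf : ∀ ω s s', f ω s → f ω s' → s = s') :
    count S ≤ m * Fintype.card Ω / 2 ^ n := by
  rw [count, le_div_iff₀ (by positivity)]
  have h1 : (Finset.univ.filter S).card ≤ (Finset.univ.filter E).card := by
    rcases isEmpty_or_nonempty Ω with hΩ | hΩ
    · rw [Finset.filter_false_of_mem fun s _ hs => hΩ.elim (hcov s hs).choose]
      exact Nat.zero_le _
    choose! g hg using hcov
    refine Finset.card_le_card_of_injOn g (fun s hs => ?_) ?_
    · simp only [Finset.coe_filter, Finset.mem_univ, true_and, Set.mem_ofPred_eq] at hs ⊢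
      exact (hg s hs).1
    · intro s hs s' hs' h
      simp only [Finset.coe_filter, Finset.mem_univ, true_and, Set.mem_ofPred_eq] at hs hs'
      exact hf (g s) s s' (hg s hs).2 (h ▸ (hg s' hs').2)
  exact_mod_cast (Nat.mul_le_mul_right _ h1).trans hE

/-- The bound of `opNorm_le_of_sparse` for a matrix given by a relation: rows are related to at most
`r` columns, and `K` bounds the squared norm of every column. -/
lemma opNorm_ind_le {P : ι → κ → Prop} {c : κ → ℝ} {r K : ℝ} (hr0 : 0 ≤ r) (hK0 : 0 ≤ K)
    (hr : ∀ i, ((Finset.univ.filter fun j => P i j).card : ℝ) ≤ r)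
    (hK : ∀ j, count (fun i => P i j) * c j ^ 2 ≤ K) :
    ‖ind P c‖ ≤ √(r * K) := by
  refine opNorm_le_of_sparse _ hr0 hK0 (fun i => le_trans ?_ (hr i)) fun j => le_trans ?_ (hK j)
  · refine Nat.cast_le.mpr (Finset.card_le_card fun j hj => ?_)
    by_contra hP
    simp only [Finset.mem_filter, Finset.mem_univ, true_and] at hj hP
    exact hj (by simp [ind, hP])
  · rw [count, ← nsmul_eq_mul, ← Finset.sum_const, Finset.sum_filter]
    refine Finset.sum_le_sum fun i _ => ?_
    by_cases hP : P i j <;> simp [ind, hP]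

/-- The projection onto the span of the basis vectors whose labels satisfy `p`. -/
def proj (p : κ → Prop) : Matrix κ κ ℂ := Matrix.diagonal fun j => if p j then 1 else 0

/-- The columns related to a row are told apart by `key`, so that there are at most `|β|` of them; in
every column it suffices to count the rows in which the two matrices differ. -/
lemma opNorm_ind_sub_ind_le {β : Type*} [Fintype β] (key : κ → β) (p : κ → Prop)
    {P Q : ι → κ → Prop} {c : κ → ℝ} {K : ℝ} (hK0 : 0 ≤ K)
    (hP : ∀ i j j', P i j → P i j' → key j = key j' → j = j')
    (hQ : ∀ i j j', Q i j → Q i j' → key j = key j' → j = j')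
    (hK : ∀ j, p j → (count (fun i => P i j ∧ ¬Q i j) + count fun i => Q i j ∧ ¬P i j) *
      c j ^ 2 ≤ K) :
    ‖(ind P c - ind Q c) * proj p‖ ≤ √(2 * Fintype.card β * K) := by
  refine opNorm_le_of_sparse _ (by positivity) hK0 (fun i => ?_) fun j => ?_
  · have hone : ∀ R : ι → κ → Prop, (∀ i j j', R i j → R i j' → key j = key j' → j = j') →
        (Finset.univ.filter fun j => R i j).card ≤ Fintype.card β := fun R hR => by
      rw [← Finset.card_univ]
      refine Finset.card_le_card_of_injOn key (fun _ _ => Finset.mem_coe.mpr (Finset.mem_univ _)) ?_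
      intro j hj j' hj' h
      simp only [Finset.coe_filter, Finset.mem_univ, true_and, Set.mem_ofPred_eq] at hj hj'
      exact hR i j j' hj hj' h
    have hsub : (Finset.univ.filter fun j => ((ind P c - ind Q c) * proj p) i j ≠ 0) ⊆
        (Finset.univ.filter fun j => P i j) ∪ Finset.univ.filter fun j => Q i j := by
      intro j hj
      by_contra hn
      simp only [Finset.mem_union, Finset.mem_filter, Finset.mem_univ, true_and, not_or] at hj hn
      exact hj (by simp [proj, ind, hn.1, hn.2])
    have := (Finset.card_le_card hsub).trans ((Finset.card_union_le _ _).trans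
      (add_le_add (hone P hP) (hone Q hQ)))
    rw [two_mul]
    exact_mod_cast this
  · by_cases hp : p j
    · refine le_trans ?_ (hK j hp)
      rw [count, count, add_mul, ← nsmul_eq_mul, ← nsmul_eq_mul, ← Finset.sum_const,
        ← Finset.sum_const, Finset.sum_filter, Finset.sum_filter, ← Finset.sum_add_distrib]
      refine Finset.sum_le_sum fun i _ => ?_
      by_cases h1 : P i j <;> by_cases h2 : Q i j <;> simp [proj, ind, hp, h1, h2]
    · rw [Finset.sum_eq_zero]
      · exact hK0
      · intro i _
        simp [proj, hp]

lemma Rare.prod {Γ Ω : Type*} [Fintype Γ] [Fintype Ω] {n m : ℕ} {E : Γ → Ω → Prop}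
    (h : ∀ g, Rare n m (E g)) : Rare n m fun ω : Γ × Ω => E ω.1 ω.2 := by
  unfold Rare at *
  have h1 : (Finset.univ.filter fun ω : Γ × Ω => E ω.1 ω.2).card =
      ∑ g, (Finset.univ.filter (E g)).card := by
    simp only [Finset.card_filter, Fintype.sum_prod_type]
  rw [h1, Finset.sum_mul, Fintype.card_prod, ← mul_assoc, mul_comm m, mul_assoc,
    ← Finset.card_univ (α := Γ), ← smul_eq_mul, ← Finset.sum_const]
  exact Finset.sum_le_sum fun g _ => h g

end Ind

/-! ### Adding a record to a database and to its decoding -/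

section Records

open scoped Classical

variable {n : ℕ}

/-- Basis labels of the purifying registers of the two independent oracles. -/
abbrev Src (n : ℕ) : Type := Database n × Database n

/-- Basis labels of the purifying registers of the single keyed oracle. -/
abbrev Tgt (n : ℕ) : Type := Database n × Keys n

/-- The basis vector `i` occurs in the image of the basis vector `j` under `F^L`. -/
def FLRel (i j : Bits n × Database n) : Prop :=
  j.2.1.1.card + j.2.2.1.card < 2 ^ n ∧ i.1 ∉ im j.2.1.1 ∧
    i.2.1.1 = insert (j.1, i.1) j.2.1.1 ∧ i.2.2 = j.2.2

/-- The relation `FLRel` for the first of two independent oracles. -/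
def FLRelOne (i j : Bits n × Src n) : Prop :=
  FLRel (i.1, i.2.1) (j.1, j.2.1) ∧ i.2.2 = j.2.2

/-- The relation `FLRel` for the second of two independent oracles. -/
def FLRelTwo (i j : Bits n × Src n) : Prop :=
  FLRel (i.1, i.2.2) (j.1, j.2.2) ∧ i.2.1 = j.2.1

/-- With the keys `k`, the database `D` of the single oracle decodes into the two databases `d`. -/
def DecD (k : Keys n) (D : Database n) (d : Src n) : Prop :=
  Dec k D.1.1 d.1.1.1 d.2.1.1 ∧ Dec k D.2.1 d.1.2.1 d.2.2.1

/-- The number of records in the databases of the two independent oracles. -/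
def size (d : Src n) : ℕ :=
  d.1.1.1.card + d.1.2.1.card + (d.2.1.1.card + d.2.2.1.card)

lemma DecD.unique {k : Keys n} {D : Database n} {d d' : Src n} (h : DecD k D d)
    (h' : DecD k D d') : d = d' := by
  refine Prod.ext (Prod.ext (Subtype.ext ?_) (Subtype.ext ?_))
    (Prod.ext (Subtype.ext ?_) (Subtype.ext ?_))
  · rw [← h.1.one, h'.1.one]
  · rw [← h.2.one, h'.2.one]
  · rw [← h.1.two, h'.1.two]
  · rw [← h.2.two, h'.2.two]

lemma DecD.exists_choices {k : Keys n} {D : Database n} {d : Src n} (h : DecD k D d) :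
    ∃ (z : d.2.1.1 → Bits n) (w : d.2.2.1 → Bits n),
      D.1.1 = merge k d.1.1.1 d.2.1.1 z ∧ D.2.1 = merge k d.1.2.1 d.2.2.1 w := by
  obtain ⟨z, hz⟩ := h.1.exists_merge (Or.inl D.1.2)
  obtain ⟨w, hw⟩ := h.2.exists_merge (Or.inr D.2.2)
  exact ⟨z, w, hz, hw⟩

lemma DecD.card_le {k : Keys n} {D : Database n} {d : Src n} (h : DecD k D d) :
    D.1.1.card + D.2.1.card ≤ 2 * size d := by
  obtain ⟨z, w, hz, hw⟩ := h.exists_choices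
  have h1 := card_merge_le k d.1.1.1 d.2.1.1 z
  have h2 := card_merge_le k d.1.2.1 d.2.2.1 w
  rw [← hz] at h1
  rw [← hw] at h2
  unfold size
  omega

section FLRel

variable {x y : Bits n} {D D' : Database n}

lemma FLRel.notMem (h : FLRel (y, D) (x, D')) : (x, y) ∉ D'.1.1 :=
  fun hm => h.2.1 (mem_im.mpr ⟨x, hm⟩)

lemma FLRel.mem (h : FLRel (y, D) (x, D')) : (x, y) ∈ D.1.1 := by
  have := h.2.2.1
  simp only at this
  simp [this]

lemma FLRel.card_eq (h : FLRel (y, D) (x, D')) : D.1.1.card = D'.1.1.card + 1 := by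
  rw [← Finset.card_insert_of_notMem h.notMem]
  exact congrArg _ h.2.2.1

/-- An `I`-distinct relation has at most one pair with a given answer, so the query that leads to a
basis vector is determined by this vector. -/
lemma FLRel.left_unique {i j j' : Bits n × Database n} (h : FLRel i j) (h' : FLRel i j') :
    j = j' := by
  obtain ⟨y, D⟩ := i
  obtain ⟨x, E⟩ := j
  obtain ⟨x', E'⟩ := j'
  have hx : (x, y) = (x', y) := D.1.2 _ h.mem _ h'.mem rfl
  have hx : x = x' := congrArg Prod.fst hx
  subst hx
  have h1 : E.1.1 = E'.1.1 := by
    rw [← Finset.erase_insert h.notMem, ← Finset.erase_insert h'.notMem]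
    exact congrArg (fun s => Finset.erase s (x, y)) (h.2.2.1.symm.trans h'.2.2.1)
  exact Prod.ext rfl (Prod.ext (Subtype.ext h1) (h.2.2.2.symm.trans h'.2.2.2))

lemma FLRel.right_unique {D₁ D₂ : Database n} {j : Bits n × Database n} (h : FLRel (y, D₁) j)
    (h' : FLRel (y, D₂) j) : D₁ = D₂ :=
  Prod.ext (Subtype.ext (h.2.2.1.trans h'.2.2.1.symm)) (h.2.2.2.trans h'.2.2.2.symm)

lemma exists_FLRel_of_notMem (x : Bits n) (hc : D'.1.1.card + D'.2.1.card < 2 ^ n)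
    (hy : y ∉ im D'.1.1) : ∃ D, FLRel (y, D) (x, D') := by
  have hI : IDistinct (insert (x, y) D'.1.1) := by
    intro p hp q hq hpq
    rcases Finset.mem_insert.mp hp with rfl | hp <;> rcases Finset.mem_insert.mp hq with rfl | hq
    · rfl
    · exact absurd (mem_im.mpr ⟨q.1, by
        have : (q.1, y) = q := Prod.ext rfl hpq
        rwa [this]⟩) hy
    · exact absurd (mem_im.mpr ⟨p.1, by
        have : (p.1, y) = p := Prod.ext rfl hpq.symm
        rwa [this]⟩) hy
    · exact D'.1.2 p hp q hq hpq
  exact ⟨(⟨_, hI⟩, D'.2), hc, hy, rfl, rfl⟩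

lemma exists_FLRel_of_mem (hc : D.1.1.card + D.2.1.card ≤ 2 ^ n) (h : (x, y) ∈ D.1.1) :
    ∃ D', FLRel (y, D) (x, D') := by
  have hI : IDistinct (D.1.1.erase (x, y)) := fun p hp q hq hpq =>
    D.1.2 p (Finset.mem_of_mem_erase hp) q (Finset.mem_of_mem_erase hq) hpq
  refine ⟨(⟨_, hI⟩, D.2), ?_, ?_, (Finset.insert_erase h).symm, rfl⟩
  · have := Finset.card_erase_add_one h
    simp only
    omega
  · intro hy
    obtain ⟨x', hx'⟩ := mem_im.mp hy
    exact Finset.ne_of_mem_erase hx' (D.1.2 _ (Finset.mem_of_mem_erase hx') _ h rfl)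

end FLRel

lemma eq_of_insert_eq_insert {α : Type*} [DecidableEq α] {a : α} {s t : Finset α}
    (h : insert a s = insert a t) (hs : a ∉ s) (ht : a ∉ t) : s = t := by
  rw [← Finset.erase_insert hs, ← Finset.erase_insert ht, h]

variable {k : Keys n} {x y z : Bits n} {D M D' : Database n} {d d' : Src n}

/-- Decoding commutes with recording an unlinked element, which belongs to the first oracle. -/
lemma decD_iff_of_lone (hD : FLRel (y + k.2.2, D) (x + k.1, D')) (hd : FLRelOne (y, d) (x, d'))
    (he : Lone k D.1.1 (shift k (x, y))) : DecD k D d ↔ DecD k D' d' := by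
  obtain ⟨-, -, hD1, hD2⟩ := id hD
  obtain ⟨⟨-, -, hd1, hd2⟩, hd3⟩ := id hd
  simp only at hD1 hD2 hd1 hd2 hd3
  change D.1.1 = insert (shift k (x, y)) D'.1.1 at hD1
  have hn : shift k (x, y) ∉ D'.1.1 := hD.notMem
  have hn' : (x, y) ∉ d'.1.1.1 := hd.1.notMem
  rw [hD1] at he
  have h1 := decOne_insert_lone he
  rw [shift_shift] at h1
  have h2 := decTwo_insert_lone he
  have h3 := good_insert_lone he
  unfold DecD
  rw [hD1, hD2, hd1, hd2, hd3]
  refine and_congr_left fun _ => ⟨fun h => ⟨h3.mp h.good, ?_, h2 ▸ h.two⟩,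
    fun h => ⟨h3.mpr h.good, by rw [h1, h.one], h2.trans h.two⟩⟩
  refine eq_of_insert_eq_insert (h1.symm.trans h.one) (fun hm => hn ?_) hn'
  exact (mem_decOne.mp hm).1

/-- Decoding commutes with recording a linked pair, which belongs to the second oracle. -/
lemma decD_iff_of_isolated (hM : FLRel (z, M) (x, D')) (hD : FLRel (y, D) (z + k.2.1, M))
    (hd : FLRelTwo (y, d) (x, d')) (hi : Isolated k D.1.1 (x, z) (z + k.2.1, y)) :
    DecD k D d ↔ DecD k D' d' := by
  obtain ⟨-, -, hM1, hM2⟩ := id hM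
  obtain ⟨-, hyM, hD1, hD2⟩ := id hD
  obtain ⟨⟨-, -, hd1, hd2⟩, hd3⟩ := id hd
  simp only at hM1 hM2 hD1 hD2 hd1 hd2 hd3 hyM
  have hyD' : y ∉ im D'.1.1 := fun h => by
    obtain ⟨w, hw⟩ := mem_im.mp h
    exact hyM (mem_im.mpr ⟨w, by rw [hM1]; exact Finset.mem_insert_of_mem hw⟩)
  have hp : (x, z) ∉ D'.1.1 := hM.notMem
  have hq : (z + k.2.1, y) ∉ D'.1.1 := fun h => hyD' (mem_im.mpr ⟨_, h⟩)
  have hn' : (x, y) ∉ d'.2.1.1 := hd.1.notMem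
  rw [hD1, hM1] at hi
  have hl : Link k (x, z) (z + k.2.1, y) := rfl
  have h1 := decOne_insert_pair hp hq hl hi
  have h2 := decTwo_insert_pair hl hi
  have h3 := good_insert_pair hi
  unfold DecD
  rw [hD1, hM1, hD2, hM2, hd1, hd2, hd3]
  refine and_congr_left fun _ => ⟨fun h => ⟨h3.mp h.good, h1 ▸ h.one, ?_⟩,
    fun h => ⟨h3.mpr h.good, h1.trans h.one, by rw [h2, h.two]⟩⟩
  refine eq_of_insert_eq_insert (h2.symm.trans h.two) (fun hm => ?_) hn'
  obtain ⟨w, -, hw⟩ := mem_decTwo.mp hm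
  exact hyD' (mem_im.mpr ⟨_, hw⟩)

lemma exists_decD_erase_one (hD : FLRel (y + k.2.2, D) (x + k.1, D'))
    (he : Lone k D.1.1 (shift k (x, y))) (hdec : DecD k D d) (hc : size d ≤ 2 ^ n) :
    ∃ d', DecD k D' d' ∧ FLRelOne (y, d) (x, d') := by
  have hm : (x, y) ∈ d.1.1.1 := by
    rw [← hdec.1.one, mem_decOne]
    exact ⟨hD.mem, he⟩
  obtain ⟨e, he'⟩ := exists_FLRel_of_mem (D := d.1) (by unfold size at hc; omega) hm
  have hd : FLRelOne (y, d) (x, (e, d.2)) := ⟨he', rfl⟩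
  exact ⟨_, (decD_iff_of_lone hD hd he).mp hdec, hd⟩

lemma exists_decD_insert_one (hD : FLRel (y + k.2.2, D) (x + k.1, D'))
    (he : Lone k D.1.1 (shift k (x, y))) (hdec : DecD k D' d') (hc : size d' < 2 ^ n) :
    ∃ d, DecD k D d ∧ FLRelOne (y, d) (x, d') := by
  have hy : y ∉ im d'.1.1.1 := by
    intro h
    obtain ⟨w, hw⟩ := mem_im.mp h
    rw [← hdec.1.one, mem_decOne] at hw
    exact hD.2.1 (mem_im.mpr ⟨_, hw.1⟩)
  obtain ⟨e, he'⟩ := exists_FLRel_of_notMem (D' := d'.1) x (by unfold size at hc; omega) hy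
  have hd : FLRelOne (y, (e, d'.2)) (x, d') := ⟨he', rfl⟩
  exact ⟨_, (decD_iff_of_lone hD hd he).mpr hdec, hd⟩

lemma exists_FLRel_erase_one (hd : FLRelOne (y, d) (x, d')) (hdec : DecD k D d)
    (hc : 2 * size d ≤ 2 ^ n) :
    ∃ D', FLRel (y + k.2.2, D) (x + k.1, D') ∧ DecD k D' d' := by
  have hm : (x, y) ∈ d.1.1.1 := hd.1.mem
  rw [← hdec.1.one, mem_decOne] at hm
  obtain ⟨D', hD⟩ := exists_FLRel_of_mem (D := D) (hdec.card_le.trans hc) hm.1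
  exact ⟨D', hD, (decD_iff_of_lone hD hd hm.2).mp hdec⟩

lemma exists_FLRel_insert_one (hd : FLRelOne (y, d) (x, d')) (hdec : DecD k D' d')
    (hc : 2 * size d' < 2 ^ n) (hconf : ¬ConflictOne k D'.1.1 (shift k (x, y))) :
    ∃ D, FLRel (y + k.2.2, D) (x + k.1, D') ∧ DecD k D d := by
  rw [ConflictOne, not_or, not_not] at hconf
  obtain ⟨D, hD⟩ := exists_FLRel_of_notMem (D' := D') (x + k.1)
    (hdec.card_le.trans_lt hc) hconf.1
  have he : Lone k D.1.1 (shift k (x, y)) := by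
    have h1 : D.1.1 = insert (shift k (x, y)) D'.1.1 := hD.2.2.1
    rw [h1]
    exact hconf.2
  exact ⟨D, hD, (decD_iff_of_lone hD hd he).mpr hdec⟩

lemma FLRel.insert_pair_eq (hM : FLRel (z, M) (x, D')) (hD : FLRel (y, D) (z + k.2.1, M)) :
    D.1.1 = insert (z + k.2.1, y) (insert (x, z) D'.1.1) := by
  have h1 : D.1.1 = insert (z + k.2.1, y) M.1.1 := hD.2.2.1
  have h2 : M.1.1 = insert (x, z) D'.1.1 := hM.2.2.1
  rw [h1, h2]

lemma exists_FLRel_of_link (hg : Good k D.1.1) (hD : FLRel (y, D) (z + k.2.1, M))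
    (hp : (x, z) ∈ D.1.1) (hcD : D.1.1.card + D.2.1.card ≤ 2 ^ n) :
    ∃ D', FLRel (z, M) (x, D') := by
  have hi := hg _ hp _ hD.mem rfl
  have hpM : (x, z) ∈ M.1.1 := by
    have h1 : D.1.1 = insert (z + k.2.1, y) M.1.1 := hD.2.2.1
    rw [h1] at hp
    refine Finset.mem_of_mem_insert_of_ne hp fun h => ?_
    -- an element cannot be linked to itself
    have hl : Link k (x, z) (z + k.2.1, y) := rfl
    rw [h] at hl
    exact (hi _ hD.mem).2.2.1 hl
  refine exists_FLRel_of_mem ?_ hpM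
  have h3 := hD.card_eq
  have h4 : D.2 = M.2 := hD.2.2.2
  rw [← h4]
  omega

lemma exists_decD_erase_two (hM : FLRel (z, M) (x, D')) (hD : FLRel (y, D) (z + k.2.1, M))
    (hdec : DecD k D d) (hc : size d ≤ 2 ^ n) :
    ∃ d', DecD k D' d' ∧ FLRelTwo (y, d) (x, d') := by
  have hp : (x, z) ∈ D.1.1 := by rw [hM.insert_pair_eq hD]; simp
  have hq : (z + k.2.1, y) ∈ D.1.1 := hD.mem
  have hm : (x, y) ∈ d.2.1.1 := by
    rw [← hdec.1.two, mem_decTwo]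
    exact ⟨z, hp, hq⟩
  obtain ⟨e, he'⟩ := exists_FLRel_of_mem (D := d.2) (by unfold size at hc; omega) hm
  have hd : FLRelTwo (y, d) (x, (d.1, e)) := ⟨he', rfl⟩
  exact ⟨_, (decD_iff_of_isolated hM hD hd (hdec.1.good _ hp _ hq rfl)).mp hdec, hd⟩

lemma exists_decD_insert_two (hM : FLRel (z, M) (x, D')) (hD : FLRel (y, D) (z + k.2.1, M))
    (hi : Isolated k D.1.1 (x, z) (z + k.2.1, y)) (hdec : DecD k D' d') (hc : size d' < 2 ^ n) :
    ∃ d, DecD k D d ∧ FLRelTwo (y, d) (x, d') := by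
  have hy : y ∉ im d'.2.1.1 := by
    intro h
    obtain ⟨w, hw⟩ := mem_im.mp h
    rw [← hdec.1.two, mem_decTwo] at hw
    obtain ⟨u, -, hu⟩ := hw
    have hM1 : M.1.1 = insert (x, z) D'.1.1 := hM.2.2.1
    exact hD.2.1 (mem_im.mpr ⟨_, by rw [hM1]; exact Finset.mem_insert_of_mem hu⟩)
  obtain ⟨e, he'⟩ := exists_FLRel_of_notMem (D' := d'.2) x (by unfold size at hc; omega) hy
  have hd : FLRelTwo (y, (d'.1, e)) (x, d') := ⟨he', rfl⟩
  exact ⟨_, (decD_iff_of_isolated hM hD hd hi).mpr hdec, hd⟩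

lemma exists_FLRel_erase_two (hd : FLRelTwo (y, d) (x, d')) (hdec : DecD k D d)
    (hc : 2 * size d ≤ 2 ^ n) :
    ∃ z M D', FLRel (z, M) (x, D') ∧ FLRel (y, D) (z + k.2.1, M) ∧ DecD k D' d' := by
  have hm : (x, y) ∈ d.2.1.1 := hd.1.mem
  rw [← hdec.1.two, mem_decTwo] at hm
  obtain ⟨z, hp, hq⟩ := hm
  have hi := hdec.1.good _ hp _ hq rfl
  have hcD := hdec.card_le.trans hc
  obtain ⟨M, hD⟩ := exists_FLRel_of_mem (D := D) hcD hq
  obtain ⟨D', hM⟩ := exists_FLRel_of_link hdec.1.good hD hp hcD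
  exact ⟨z, M, D', hM, hD, (decD_iff_of_isolated hM hD hd hi).mp hdec⟩

lemma exists_FLRel_insert_two (hM : FLRel (z, M) (x, D')) (hd : FLRelTwo (y, d) (x, d'))
    (hdec : DecD k D' d') (hc : 2 * size d' + 1 < 2 ^ n)
    (hconf : ¬ConflictTwo k D'.1.1 (x, z) (z + k.2.1, y)) :
    ∃ D, FLRel (y, D) (z + k.2.1, M) ∧ DecD k D d := by
  rw [ConflictTwo, not_or, not_or, not_or, not_not] at hconf
  obtain ⟨-, hy, hzy, hi⟩ := hconf
  have hM1 : M.1.1 = insert (x, z) D'.1.1 := hM.2.2.1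
  have hM2 : M.2 = D'.2 := hM.2.2.2
  have hyM : y ∉ im M.1.1 := by
    intro h
    obtain ⟨w, hw⟩ := mem_im.mp h
    rw [hM1] at hw
    rcases Finset.mem_insert.mp hw with h | h
    · exact hzy (congrArg Prod.snd h).symm
    · exact hy (mem_im.mpr ⟨w, h⟩)
  have hcM : M.1.1.card + M.2.1.card < 2 ^ n := by
    rw [hM.card_eq, hM2]
    have := hdec.card_le
    omega
  obtain ⟨D, hD⟩ := exists_FLRel_of_notMem (D' := M) (z + k.2.1) hcM hyM
  refine ⟨D, hD, (decD_iff_of_isolated hM hD hd ?_).mpr hdec⟩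
  rw [hM.insert_pair_eq hD]
  exact hi

end Records

/-! ### The encoding intertwines the two experiments -/

section Operators

open scoped Classical Matrix.Norms.L2Operator

variable {n : ℕ}

/-- The amplitude `1/√N`. -/
def amp (n : ℕ) : ℝ := 1 / √(2 ^ n : ℝ)

lemma amp_sq (n : ℕ) : amp n ^ 2 = 1 / 2 ^ n := by
  rw [amp, div_pow, one_pow, Real.sq_sqrt (by positivity)]

lemma FL_eq_ind (n : ℕ) : FL n = ind FLRel fun _ => amp n := by
  ext ⟨y, L', R'⟩ ⟨x, L, R⟩
  simp only [FL, ind, FLRel, Matrix.of_apply, amp, Finset.insert_eq, Finset.union_comm]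

/-- The relation `FLRel` on the labels of the keyed experiment. -/
def FLRelKeyed (i j : Bits n × Tgt n) : Prop :=
  FLRel (i.1, i.2.1) (j.1, j.2.1) ∧ i.2.2 = j.2.2

/-- An operator on the registers `A, S₁, T₁`. -/
def onOne (O : Matrix (Bits n × Database n) (Bits n × Database n) ℂ) :
    Matrix (Bits n × Src n) (Bits n × Src n) ℂ :=
  Matrix.of fun (a, d₁, d₂) (a', d₁', d₂') => if d₂ = d₂' then O (a, d₁) (a', d₁') else 0

/-- An operator on the registers `A, S₂, T₂`. -/
def onTwo (O : Matrix (Bits n × Database n) (Bits n × Database n) ℂ) :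
    Matrix (Bits n × Src n) (Bits n × Src n) ℂ :=
  Matrix.of fun (a, d₁, d₂) (a', d₁', d₂') => if d₁ = d₁' then O (a, d₂) (a', d₂') else 0

/-- `X` controlled by a key. -/
def keyX (f : Keys n → Bits n) : Matrix (Bits n × Tgt n) (Bits n × Tgt n) ℂ :=
  controlled fun k => X (D := Database n) (f k)

/-- `F^L` on the registers of the keyed experiment. -/
def FLk (n : ℕ) : Matrix (Bits n × Tgt n) (Bits n × Tgt n) ℂ := controlled fun _ => FL n

/-- `F^R` on the registers of the keyed experiment. -/
def FRk (n : ℕ) : Matrix (Bits n × Tgt n) (Bits n × Tgt n) ℂ := controlled fun _ => FR n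

/-- `X^{k₁}`. -/
def keyOne (n : ℕ) : Matrix (Bits n × Tgt n) (Bits n × Tgt n) ℂ := keyX fun k => k.1

/-- `X^{k₂}`. -/
def keyTwo (n : ℕ) : Matrix (Bits n × Tgt n) (Bits n × Tgt n) ℂ := keyX fun k => k.2.1

/-- `X^{k₃}`. -/
def keyThree (n : ℕ) : Matrix (Bits n × Tgt n) (Bits n × Tgt n) ℂ := keyX fun k => k.2.2

lemma onOne_FL : onOne (FL n) = ind FLRelOne fun _ => amp n := by
  ext ⟨y, d, e⟩ ⟨x, d', e'⟩
  rw [FL_eq_ind]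
  simp only [onOne, ind, FLRelOne, Matrix.of_apply, ← ite_and, and_comm]

lemma onTwo_FL : onTwo (FL n) = ind FLRelTwo fun _ => amp n := by
  ext ⟨y, d, e⟩ ⟨x, d', e'⟩
  rw [FL_eq_ind]
  simp only [onTwo, ind, FLRelTwo, Matrix.of_apply, ← ite_and, and_comm]

lemma FLk_eq_ind : FLk n = ind FLRelKeyed fun _ => amp n := by
  ext ⟨y, d, e⟩ ⟨x, d', e'⟩
  rw [FLk, FL_eq_ind]
  simp only [controlled, ind, FLRelKeyed, Matrix.of_apply, ← ite_and, and_comm]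

lemma keyX_mul_ind {μ : Type*} [Fintype μ] [DecidableEq μ] (f : Keys n → Bits n)
    (Q : Bits n × Tgt n → μ → Prop) (c : μ → ℝ) :
    keyX f * ind Q c = ind (fun i j => Q (i.1 + f i.2.2, i.2) j) c := by
  ext ⟨a, D, k⟩ j
  rw [Matrix.mul_apply, Finset.sum_eq_single (a + f k, D, k)]
  · simp [keyX, controlled, X, ind, bits_add_add_cancel]
  · rintro ⟨a', D', k'⟩ - h
    have : keyX f (a, D, k) (a', D', k') = 0 := by
      simp only [keyX, controlled, X, Matrix.of_apply, ite_eq_right_iff, Prod.mk.injEq, and_imp]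
      rintro rfl rfl rfl
      simp [bits_add_add_cancel] at h
    rw [this, zero_mul]
  · simp

lemma conjTranspose_keyX (f : Keys n → Bits n) : (keyX f)ᴴ = keyX f := by
  ext ⟨a, D, k⟩ ⟨a', D', k'⟩
  by_cases hk : k = k'
  · subst hk
    by_cases hD : D = D'
    · subst hD
      have h : a' = a + f k ↔ a = a' + f k := by
        rw [eq_comm, bits_add_eq_iff]
      simp [keyX, controlled, X, h]
    · simp [keyX, controlled, X, hD, Ne.symm hD]
  · simp [keyX, controlled, hk, Ne.symm hk]

/-- The exponent of `N` in the number of choices behind the encodings of `d`: three keys, and an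
intermediate value for every record of the second oracle. -/
def choiceExp (d : Src n) : ℕ := 3 + d.2.1.1.card + d.2.2.1.card

lemma card_bits (n : ℕ) : Fintype.card (Bits n) = 2 ^ n := by simp [Bits, ZMod.card]

lemma card_choices (B B' : Finset (Bits n × Bits n)) :
    Fintype.card (Choices n B B') = (2 ^ n) ^ (3 + B.card + B'.card) := by
  rw [Fintype.card_prod, Fintype.card_prod, Fintype.card_prod, Fintype.card_prod,
    Fintype.card_fun (α := B), Fintype.card_fun (α := B'), card_bits, Fintype.card_coe,
    Fintype.card_coe]
  ring

/-- The amplitude of every encoding of `d`. All choices are counted, including those whose merge does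
not decode into `d`; hence the encoding map is a contraction and only nearly an isometry. -/
def wt (d : Src n) : ℝ := 1 / √((2 ^ n : ℝ) ^ choiceExp d)

lemma wt_sq (d : Src n) : wt d ^ 2 = 1 / (2 ^ n) ^ choiceExp d := by
  rw [wt, div_pow, one_pow, Real.sq_sqrt (by positivity)]

/-- A database `D` with keys `k` is an encoding of `d`. -/
def EncRel (i : Bits n × Tgt n) (j : Bits n × Src n) : Prop :=
  i.1 = j.1 ∧ DecD i.2.2 i.2.1 j.2

/-- The encoding map: `|d⟩` goes to the uniform superposition of the databases and keys that decode
into `d`. -/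
def enc (n : ℕ) : Matrix (Bits n × Tgt n) (Bits n × Src n) ℂ := ind EncRel fun j => wt j.2

/-- The projection onto the databases with at most `s` records. -/
def sizeProj (n s : ℕ) : Matrix (Bits n × Src n) (Bits n × Src n) ℂ := proj fun j => size j.2 ≤ s

lemma wt_of_FLRelOne {i j : Bits n × Src n} (h : FLRelOne i j) : wt i.2 = wt j.2 := by
  unfold wt choiceExp
  rw [h.2]

lemma wt_of_FLRelTwo {i j : Bits n × Src n} (h : FLRelTwo i j) : wt i.2 = amp n * wt j.2 := by
  have h1 : i.2.2.1.1.card = j.2.2.1.1.card + 1 := h.1.card_eq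
  have h2 : i.2.2.2 = j.2.2.2 := h.1.2.2.2
  have h3 : choiceExp i.2 = choiceExp j.2 + 1 := by
    unfold choiceExp
    rw [h1, h2]
    ring
  rw [wt, wt, amp, h3, pow_succ, Real.sqrt_mul (by positivity), one_div_mul_one_div, mul_comm]

/-- The encoding map is a contraction. -/
lemma opNorm_enc_le (n : ℕ) : ‖enc n‖ ≤ 1 := by
  have h := opNorm_ind_le (P := EncRel (n := n)) (c := fun j => wt j.2) zero_le_one zero_le_one
    (fun i => ?_) (fun j => ?_)
  · simpa [enc] using h
  · norm_cast
    refine Finset.card_le_one.mpr fun j hj j' hj' => ?_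
    simp only [Finset.mem_filter, Finset.mem_univ, true_and] at hj hj'
    exact Prod.ext (hj.1.symm.trans hj'.1) (hj.2.unique hj'.2)
  · rw [wt_sq, mul_one_div, div_le_one (by positivity)]
    have hle := count_le_of_rare (n := n) (m := 2 ^ n) (S := fun i => EncRel i j)
      (E := fun _ : Choices n j.2.2.1.1 j.2.2.2.1 => True)
      (by unfold Rare; rw [mul_comm]; exact Nat.mul_le_mul_left _ (Finset.card_le_univ _))
      (fun ω i => i.1 = j.1 ∧ i.2.2 = ω.1 ∧ i.2.1.1.1 = merge ω.1 j.2.1.1.1 j.2.2.1.1 ω.2.1 ∧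
        i.2.1.2.1 = merge ω.1 j.2.1.2.1 j.2.2.2.1 ω.2.2) ?_ ?_
    · rw [card_choices] at hle
      refine hle.trans (le_of_eq ?_)
      unfold choiceExp
      push_cast
      field_simp
    · rintro i ⟨h1, h2⟩
      obtain ⟨z, w, hz, hw⟩ := h2.exists_choices
      exact ⟨(i.2.2, z, w), trivial, h1, rfl, hz, hw⟩
    · rintro ω i i' ⟨h1, h2, h3, h4⟩ ⟨h1', h2', h3', h4'⟩
      exact Prod.ext (h1.trans h1'.symm) (Prod.ext (Prod.ext (Subtype.ext (h3.trans h3'.symm))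
        (Subtype.ext (h4.trans h4'.symm))) (h2.trans h2'.symm))

/-- The error of one elementary operation on databases with at most `s` records. The
numerators that occur are at most `20 s + 6`. -/
def err (n s : ℕ) : ℝ := √(24 * (s + 1) / 2 ^ n)

end Operators

section Intertwine

open scoped Classical Matrix.Norms.L2Operator

variable {n s : ℕ}

lemma FLRelOne.left_unique {i j j' : Bits n × Src n} (h : FLRelOne i j) (h' : FLRelOne i j') :
    j = j' := by
  have h1 := h.1.left_unique h'.1
  obtain ⟨x, d, e⟩ := j
  obtain ⟨x', d', e'⟩ := j'
  simp only [Prod.mk.injEq] at h1 ⊢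
  exact ⟨h1.1, h1.2, h.2.symm.trans h'.2⟩

lemma FLRelTwo.left_unique {i j j' : Bits n × Src n} (h : FLRelTwo i j) (h' : FLRelTwo i j') :
    j = j' := by
  have h1 := h.1.left_unique h'.1
  obtain ⟨x, d, e⟩ := j
  obtain ⟨x', d', e'⟩ := j'
  simp only [Prod.mk.injEq] at h1 ⊢
  exact ⟨h1.1, h.2.symm.trans h'.2, h1.2⟩

lemma FLRelKeyed.left_unique {i j j' : Bits n × Tgt n} (h : FLRelKeyed i j)
    (h' : FLRelKeyed i j') : j = j' := by
  have h1 := h.1.left_unique h'.1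
  obtain ⟨x, d, e⟩ := j
  obtain ⟨x', d', e'⟩ := j'
  simp only [Prod.mk.injEq] at h1 ⊢
  exact ⟨h1.1, h1.2, h.2.symm.trans h'.2⟩

lemma FLRelOne.right_unique {y : Bits n} {d₁ d₂ : Src n} {j : Bits n × Src n}
    (h : FLRelOne (y, d₁) j) (h' : FLRelOne (y, d₂) j) : d₁ = d₂ :=
  Prod.ext (h.1.right_unique h'.1) (h.2.trans h'.2.symm)

lemma FLRelTwo.right_unique {y : Bits n} {d₁ d₂ : Src n} {j : Bits n × Src n}
    (h : FLRelTwo (y, d₁) j) (h' : FLRelTwo (y, d₂) j) : d₁ = d₂ :=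
  Prod.ext (h.2.trans h'.2.symm) (h.1.right_unique h'.1)

lemma FLRelOne.size_eq {i j : Bits n × Src n} (h : FLRelOne i j) : size i.2 = size j.2 + 1 := by
  have h1 : i.2.1.1.1.card = j.2.1.1.1.card + 1 := h.1.card_eq
  have h2 : i.2.1.2 = j.2.1.2 := h.1.2.2.2
  unfold size
  rw [h1, h2, h.2]
  ring

lemma FLRelTwo.size_eq {i j : Bits n × Src n} (h : FLRelTwo i j) : size i.2 = size j.2 + 1 := by
  have h1 : i.2.2.1.1.card = j.2.2.1.1.card + 1 := h.1.card_eq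
  have h2 : i.2.2.2 = j.2.2.2 := h.1.2.2.2
  unfold size
  rw [h1, h2, h.2]
  ring

/-- The operator norm bound used for all intertwining relations: the matrices `ind P c`, `ind Q c`
have few entries per row, and every column contains few rows that belong to one of them only. -/
lemma opNorm_sub_mul_sizeProj_le {β : Type*} [Fintype β] (key : Bits n × Src n → β)
    {P Q : Bits n × Tgt n → Bits n × Src n → Prop} {c : Bits n × Src n → ℝ} (K K' : ℝ)
    (hK0 : 0 ≤ K) (hK0' : 0 ≤ K') (hKs : 2 * Fintype.card β * (K + K') ≤ 24 * (s + 1) / 2 ^ n)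
    (hP : ∀ i j j', P i j → P i j' → key j = key j' → j = j')
    (hQ : ∀ i j j', Q i j → Q i j' → key j = key j' → j = j')
    (hPQ : ∀ x d, size d ≤ s →
      count (fun i => P i (x, d) ∧ ¬Q i (x, d)) * c (x, d) ^ 2 ≤ K)
    (hQP : ∀ x d, size d ≤ s →
      count (fun i => Q i (x, d) ∧ ¬P i (x, d)) * c (x, d) ^ 2 ≤ K') :
    ‖(ind P c - ind Q c) * sizeProj n s‖ ≤ err n s := by
  refine le_trans ?_ (Real.sqrt_le_sqrt hKs)
  refine opNorm_ind_sub_ind_le key _ (add_nonneg hK0 hK0') hP hQ fun j hj => ?_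
  rw [add_mul]
  exact add_le_add (hPQ j.1 j.2 hj) (hQP j.1 j.2 hj)

lemma keyed_one_FL_mul_enc : keyThree n * (FLk n * (keyOne n * enc n)) =
    ind (fun i j => ∃ D', FLRel (i.1 + i.2.2.2.2, i.2.1) (j.1 + i.2.2.1, D') ∧ DecD i.2.2 D' j.2)
      fun j => amp n * wt j.2 := by
  rw [enc, keyThree, keyOne, keyX_mul_ind, FLk_eq_ind, ind_mul_ind (c'' := fun j => amp n * wt j.2),
    keyX_mul_ind]
  rotate_left
  · exact fun i l j j' h _ h' _ => h.left_unique h'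
  · exact fun _ _ _ _ _ => rfl
  refine ind_congr (fun i j => ⟨?_, ?_⟩) fun _ _ _ => rfl
  · rintro ⟨⟨m, D', k⟩, ⟨h1, h2⟩, h3, h4⟩
    simp only at h2 h3 h4 h1
    subst h2
    refine ⟨D', ?_, h4⟩
    rw [← h3, bits_add_add_cancel]
    exact h1
  · rintro ⟨D', h1, h2⟩
    exact ⟨(j.1 + i.2.2.1, D', i.2.2), ⟨h1, rfl⟩, bits_add_add_cancel _ _, h2⟩

lemma enc_mul_onOne_FL : enc n * onOne (FL n) = ind (fun i j => ∃ d', DecD i.2.2 i.2.1 d' ∧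
    FLRelOne (i.1, d') j) fun j => amp n * wt j.2 := by
  rw [enc, onOne_FL, ind_mul_ind (c'' := fun j => amp n * wt j.2)]
  · refine ind_congr (fun i j => ⟨?_, ?_⟩) fun _ _ _ => rfl
    · rintro ⟨⟨m, d'⟩, ⟨h1, h2⟩, h3⟩
      simp only at h1 h2
      subst h1
      exact ⟨d', h2, h3⟩
    · rintro ⟨d', h1, h2⟩
      exact ⟨(i.1, d'), ⟨rfl, h1⟩, h2⟩
  · rintro i l j j' ⟨h1, h2⟩ _ ⟨h1', h2'⟩ _
    exact Prod.ext (h1.symm.trans h1') (h2.unique h2')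
  · intro i j l _ h
    rw [wt_of_FLRelOne h, mul_comm]

/-- Forward queries to `X^{k₃} F X^{k₁}` simulate forward queries to the first oracle. -/
lemma opNorm_forward_one (hs : 2 * s + 2 < 2 ^ n) :
    ‖(keyThree n * (FLk n * (keyOne n * enc n)) - enc n * onOne (FL n)) * sizeProj n s‖ ≤
      err n s := by
  rw [keyed_one_FL_mul_enc, enc_mul_onOne_FL]
  refine opNorm_sub_mul_sizeProj_le (fun _ => ()) ((6 * s + 1) / 2 ^ n) 0 (by positivity) le_rfl
    ?_ ?_ ?_ ?_ ?_
  · rw [Fintype.card_unit, add_zero, ← mul_div_assoc]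
    refine div_le_div_of_nonneg_right ?_ (by positivity)
    push_cast
    linarith [Nat.cast_nonneg (α := ℝ) s]
  · rintro i ⟨x, d⟩ ⟨x', d'⟩ ⟨D, h1, h2⟩ ⟨D', h1', h2'⟩ -
    have h := h1.left_unique h1'
    simp only [Prod.mk.injEq, add_left_inj] at h
    obtain ⟨rfl, rfl⟩ := h
    exact Prod.ext rfl (h2.unique h2')
  · rintro i ⟨x, d⟩ ⟨x', d'⟩ ⟨D, h1, h2⟩ ⟨D', h1', h2'⟩ -
    rw [h1.unique h1'] at h2
    exact h2.left_unique h2'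
  · intro x d hd
    refine (mul_le_mul_of_nonneg_right (count_le_of_rare (n := n) (m := 6 * s + 1)
      (E := fun ω : Bits n × Choices n d.2.1.1 d.2.2.1 => ω.1 ∉ im d.1.1.1 ∧
        ConflictOne ω.2.1 (merge ω.2.1 d.1.1.1 d.2.1.1 ω.2.2.1) (shift ω.2.1 (x, ω.1)))
      (Rare.prod (E := fun v (ω : Choices n d.2.1.1 d.2.2.1) => v ∉ im d.1.1.1 ∧
        ConflictOne ω.1 (merge ω.1 d.1.1.1 d.2.1.1 ω.2.1) (shift ω.1 (x, v))) fun v => ?_)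
      (fun ω i => i.1 = ω.1 ∧ i.2.2 = ω.2.1 ∧
        i.2.1.1.1 = insert (shift ω.2.1 (x, ω.1)) (merge ω.2.1 d.1.1.1 d.2.1.1 ω.2.2.1) ∧
        i.2.1.2.1 = merge ω.2.1 d.1.2.1 d.2.2.1 ω.2.2.2) ?_ ?_) (sq_nonneg _)).trans (le_of_eq ?_)
    · by_cases hv : v ∈ im d.1.1.1
      · simp [hv, Rare]
      · refine (rare_conflictOne hv).mono (fun ω h => h.2) ?_
        unfold size at hd
        omega
    · rintro ⟨v, D, k⟩ ⟨⟨D', h1, h2⟩, h3⟩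
      obtain ⟨z, w, hz, hw⟩ := h2.exists_choices
      simp only at h1 h2 h3 hz hw
      have hD1 : D.1.1 = insert (shift k (x, v)) D'.1.1 := h1.2.2.1
      refine ⟨(v, k, z, w), ⟨?_, ?_⟩, rfl, rfl, ?_, ?_⟩
      · intro hv
        obtain ⟨u, hu⟩ := mem_im.mp hv
        rw [← h2.1.one, mem_decOne] at hu
        exact h1.2.1 (mem_im.mpr ⟨_, hu.1⟩)
      · simp only
        rw [← hz]
        by_contra hconf
        rw [ConflictOne, not_or, not_not, ← hD1] at hconf
        exact h3 (exists_decD_insert_one h1 hconf.2 h2 (by omega))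
      · simp only
        rw [← hz, ← hD1]
      · simp only
        rw [← hw, show D.2 = D'.2 from h1.2.2.2]
    · rintro ⟨v, ω⟩ ⟨v₁, D₁, k₁⟩ ⟨v₂, D₂, k₂⟩ ⟨h1, h2, h3, h4⟩ ⟨h1', h2', h3', h4'⟩
      simp only at *
      subst h1 h2 h1' h2'
      rw [show D₁ = D₂ from Prod.ext (Subtype.ext (h3.trans h3'.symm))
        (Subtype.ext (h4.trans h4'.symm))]
    · rw [mul_pow, amp_sq, wt_sq, Fintype.card_prod, card_choices, card_bits]
      unfold choiceExp
      push_cast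
      field_simp
  · intro x d hd
    rw [count_of_forall_not fun i hi => ?_, zero_mul]
    obtain ⟨⟨d', h1, h2⟩, h3⟩ := hi
    have hsz := h2.size_eq
    simp only at hsz
    exact h3 (exists_FLRel_erase_one h2 h1 (by omega))

end Intertwine

section Intertwine

open scoped Classical Matrix.Norms.L2Operator

variable {n s : ℕ}

lemma insert_inj_of_notMem_im {a b y : Bits n} {S S' : Finset (Bits n × Bits n)}
    (h : insert (a, y) S = insert (b, y) S') (hS : y ∉ im S) (hS' : y ∉ im S') :
    a = b ∧ S = S' := by
  have h1 : (a, y) ∈ insert (b, y) S' := h ▸ Finset.mem_insert_self _ _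
  have hab : a = b := by
    rcases Finset.mem_insert.mp h1 with h2 | h2
    · exact congrArg Prod.fst h2
    · exact absurd (mem_im.mpr ⟨_, h2⟩) hS'
  subst hab
  exact ⟨rfl, eq_of_insert_eq_insert h (fun hm => hS (mem_im.mpr ⟨_, hm⟩))
    fun hm => hS' (mem_im.mpr ⟨_, hm⟩)⟩

lemma keyed_one_FL_adjoint_mul_enc : keyOne n * ((FLk n)ᴴ * (keyThree n * enc n)) =
    ind (fun i j => ∃ D, FLRel (j.1 + i.2.2.2.2, D) (i.1 + i.2.2.1, i.2.1) ∧ DecD i.2.2 D j.2)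
      fun j => amp n * wt j.2 := by
  rw [enc, keyThree, keyOne, keyX_mul_ind, FLk_eq_ind, conjTranspose_ind,
    ind_mul_ind (c'' := fun j => amp n * wt j.2), keyX_mul_ind]
  · refine ind_congr (fun i j => ⟨?_, ?_⟩) fun _ _ _ => rfl
    · rintro ⟨⟨m, D', k⟩, ⟨h1, h2⟩, h3, h4⟩
      simp only at h2 h3 h4 h1
      subst h2
      refine ⟨D', ?_, h4⟩
      rw [← h3, bits_add_add_cancel]
      exact h1
    · rintro ⟨D', h1, h2⟩
      exact ⟨(j.1 + i.2.2.2.2, D', i.2.2), ⟨h1, rfl⟩, bits_add_add_cancel _ _, h2⟩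
  · rintro i l ⟨m, D, k⟩ ⟨m', D', k'⟩ ⟨h1, h2⟩ ⟨h3, h4⟩ ⟨h1', h2'⟩ ⟨h3', h4'⟩
    simp only at *
    subst h2 h2'
    have hm : m = m' := add_right_cancel (h3.trans h3'.symm)
    subst hm
    rw [h1.right_unique h1']
  · exact fun _ _ _ _ _ => rfl

lemma enc_mul_onOne_FL_adjoint : enc n * (onOne (FL n))ᴴ = ind (fun i j => ∃ d',
    DecD i.2.2 i.2.1 d' ∧ FLRelOne j (i.1, d')) fun j => amp n * wt j.2 := by
  rw [enc, onOne_FL, conjTranspose_ind, ind_mul_ind (c'' := fun j => amp n * wt j.2)]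
  · refine ind_congr (fun i j => ⟨?_, ?_⟩) fun _ _ _ => rfl
    · rintro ⟨⟨m, d'⟩, ⟨h1, h2⟩, h3⟩
      simp only at h1 h2
      subst h1
      exact ⟨d', h2, h3⟩
    · rintro ⟨d', h1, h2⟩
      exact ⟨(i.1, d'), ⟨rfl, h1⟩, h2⟩
  · rintro i l j j' ⟨h1, h2⟩ _ ⟨h1', h2'⟩ _
    exact Prod.ext (h1.symm.trans h1') (h2.unique h2')
  · intro i j l _ h
    rw [wt_of_FLRelOne h, mul_comm]

/-- Undoing forward queries to `X^{k₃} F X^{k₁}` simulates undoing forward queries to the first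
oracle. -/
lemma opNorm_backward_one (hs : 2 * s + 2 < 2 ^ n) :
    ‖(keyOne n * ((FLk n)ᴴ * (keyThree n * enc n)) - enc n * (onOne (FL n))ᴴ) * sizeProj n s‖ ≤
      err n s := by
  rw [keyed_one_FL_adjoint_mul_enc, enc_mul_onOne_FL_adjoint]
  refine opNorm_sub_mul_sizeProj_le Prod.fst (2 * s / (2 ^ n) ^ 2) ((6 * s + 1) / (2 ^ n) ^ 2)
    (by positivity) (by positivity) ?_ ?_ ?_ ?_ ?_
  · rw [card_bits, ← add_div]
    push_cast
    rw [← mul_div_assoc, div_le_div_iff₀ (by positivity) (by positivity)]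
    have h1 : (0 : ℝ) < 2 ^ n := by positivity
    have h2 : (0 : ℝ) ≤ s := Nat.cast_nonneg s
    nlinarith [mul_pos h1 h1, mul_nonneg h2 (mul_pos h1 h1).le]
  · rintro i ⟨y, d⟩ ⟨y', d'⟩ ⟨D, h1, h2⟩ ⟨D', h1', h2'⟩ h
    simp only at h h1 h2 h1' h2'
    subst h
    rw [h1.right_unique h1'] at h2
    rw [h2.unique h2']
  · rintro i ⟨y, d⟩ ⟨y', d'⟩ ⟨e, h1, h2⟩ ⟨e', h1', h2'⟩ h
    simp only at h
    subst h
    rw [h1.unique h1'] at h2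
    rw [h2.right_unique h2']
  · intro y d hd
    refine (mul_le_mul_of_nonneg_right (count_le_of_rare (n := n) (m := 2 * s)
      (E := fun ω : Choices n d.2.1.1 d.2.2.1 =>
        (∃ c : d.2.1.1, y + ω.1.2.2 = ω.2.1 c) ∨ ∃ c : d.2.1.1, y + ω.1.2.2 = c.1.2)
      ((rare_hit_linked y).mono (fun ω h => h) ?_)
      (fun ω i => i.2.2 = ω.1 ∧ y + ω.1.2.2 ∉ im i.2.1.1.1 ∧
        insert (i.1 + ω.1.1, y + ω.1.2.2) i.2.1.1.1 = merge ω.1 d.1.1.1 d.2.1.1 ω.2.1 ∧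
        i.2.1.2.1 = merge ω.1 d.1.2.1 d.2.2.1 ω.2.2) ?_ ?_) (sq_nonneg _)).trans (le_of_eq ?_)
    · unfold size at hd
      omega
    · rintro ⟨x, D', k⟩ ⟨⟨D, h1, h2⟩, h3⟩
      obtain ⟨z, w, hz, hw⟩ := h2.exists_choices
      simp only at h1 h2 h3 hz hw
      have hD1 : D.1.1 = insert (x + k.1, y + k.2.2) D'.1.1 := h1.2.2.1
      refine ⟨(k, z, w), ?_, rfl, h1.2.1, ?_, ?_⟩
      · have hmem := h1.mem
        rw [hz] at hmem
        rcases mem_merge.mp hmem with ⟨a, ha, e⟩ | ⟨c, e⟩ | ⟨c, e⟩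
        · exfalso
          rw [← h2.1.one, mem_decOne, ← e] at ha
          exact h3 (exists_decD_erase_one h1 ha.2 h2 (by omega))
        · exact Or.inl ⟨c, congrArg Prod.snd e⟩
        · exact Or.inr ⟨c, congrArg Prod.snd e⟩
      · simp only
        rw [← hz, ← hD1]
      · simp only
        rw [← hw, show D.2 = D'.2 from h1.2.2.2]
    · rintro ω ⟨x₁, D₁, k₁⟩ ⟨x₂, D₂, k₂⟩ ⟨h1, h2, h3, h4⟩ ⟨h1', h2', h3', h4'⟩
      simp only at *
      subst h1 h1'
      obtain ⟨hx, hD⟩ := insert_inj_of_notMem_im (h3.trans h3'.symm) h2 h2'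
      rw [add_right_cancel hx, show D₁ = D₂ from Prod.ext (Subtype.ext hD)
        (Subtype.ext (h4.trans h4'.symm))]
    · rw [mul_pow, amp_sq, wt_sq, card_choices]
      unfold choiceExp
      push_cast
      field_simp
  · intro y d hd
    -- the record `(x₀, y)` that is removed, if there is one
    by_cases hx : ∃ x₀ e, FLRelOne (y, d) (x₀, e)
    · obtain ⟨x₀, e, he⟩ := hx
      have hsz := he.size_eq
      simp only at hsz
      refine (mul_le_mul_of_nonneg_right (count_le_of_rare (n := n) (m := 6 * s + 1)
        (E := fun ω : Choices n e.2.1.1 e.2.2.1 =>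
          ConflictOne ω.1 (merge ω.1 e.1.1.1 e.2.1.1 ω.2.1) (shift ω.1 (x₀, y)))
        ((rare_conflictOne he.1.2.1).mono (fun ω h => h) ?_)
        (fun ω i => i.1 = x₀ ∧ i.2.2 = ω.1 ∧ i.2.1.1.1 = merge ω.1 e.1.1.1 e.2.1.1 ω.2.1 ∧
          i.2.1.2.1 = merge ω.1 e.1.2.1 e.2.2.1 ω.2.2) ?_ ?_) (sq_nonneg _)).trans (le_of_eq ?_)
      · change 6 * (e.1.1.1.card + e.2.1.1.card) + 1 ≤ 6 * s + 1
        unfold size at hd hsz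
        omega
      · rintro ⟨x, D', k⟩ ⟨⟨e', h1, h2⟩, h3⟩
        have heq := he.left_unique h2
        simp only [Prod.mk.injEq] at heq h1 h3
        obtain ⟨rfl, rfl⟩ := heq
        obtain ⟨z, w, hz, hw⟩ := h1.exists_choices
        refine ⟨(k, z, w), ?_, rfl, rfl, hz, hw⟩
        simp only
        rw [← hz]
        by_contra hconf
        exact h3 (exists_FLRel_insert_one he h1 (by omega) hconf)
      · rintro ω ⟨x₁, D₁, k₁⟩ ⟨x₂, D₂, k₂⟩ ⟨h1, h2, h3, h4⟩ ⟨h1', h2', h3', h4'⟩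
        simp only at *
        rw [h1, h1', h2, h2', show D₁ = D₂ from Prod.ext (Subtype.ext (h3.trans h3'.symm))
          (Subtype.ext (h4.trans h4'.symm))]
      · have hde : d.2 = e.2 := he.2
        rw [mul_pow, amp_sq, wt_sq, card_choices]
        unfold choiceExp
        simp only
        rw [hde]
        push_cast
        field_simp
    · rw [count_of_forall_not fun i hi => ?_, zero_mul]
      · positivity
      · obtain ⟨⟨e, h1, h2⟩, -⟩ := hi
        exact hx ⟨_, _, h2⟩

end Intertwine

section Intertwine

open scoped Classical Matrix.Norms.L2Operator

variable {n s : ℕ}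

lemma FLk_mul_enc : FLk n * enc n = ind (fun i j => ∃ D', FLRel (i.1, i.2.1) (j.1, D') ∧
    DecD i.2.2 D' j.2) fun j => amp n * wt j.2 := by
  rw [enc, FLk_eq_ind, ind_mul_ind (c'' := fun j => amp n * wt j.2)]
  · refine ind_congr (fun i j => ⟨?_, ?_⟩) fun _ _ _ => rfl
    · rintro ⟨⟨m, D', k⟩, ⟨h1, h2⟩, h3, h4⟩
      simp only at h2 h3 h4 h1
      subst h2 h3
      exact ⟨D', h1, h4⟩
    · rintro ⟨D', h1, h2⟩
      exact ⟨(j.1, D', i.2.2), ⟨h1, rfl⟩, rfl, h2⟩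
  · exact fun i l j j' h _ h' _ => h.left_unique h'
  · exact fun _ _ _ _ _ => rfl

lemma keyed_two_FL_mul_enc : FLk n * (keyTwo n * (FLk n * enc n)) = ind (fun i j => ∃ z M D',
    FLRel (z, M) (j.1, D') ∧ FLRel (i.1, i.2.1) (z + i.2.2.2.1, M) ∧ DecD i.2.2 D' j.2)
      fun j => amp n * (amp n * wt j.2) := by
  rw [FLk_mul_enc, keyTwo, keyX_mul_ind, FLk_eq_ind,
    ind_mul_ind (c'' := fun j => amp n * (amp n * wt j.2))]
  · refine ind_congr (fun i j => ⟨?_, ?_⟩) fun _ _ _ => rfl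
    · rintro ⟨⟨m, M, k⟩, ⟨h1, h2⟩, D', h3, h4⟩
      simp only at h2 h3 h4 h1
      subst h2
      refine ⟨m + i.2.2.2.1, M, D', h3, ?_, h4⟩
      rw [bits_add_add_cancel]
      exact h1
    · rintro ⟨z, M, D', h1, h2, h3⟩
      refine ⟨(z + i.2.2.2.1, M, i.2.2), ⟨h2, rfl⟩, D', ?_, h3⟩
      simp only [bits_add_add_cancel]
      exact h1
  · exact fun i l j j' h _ h' _ => h.left_unique h'
  · exact fun _ _ _ _ _ => rfl

lemma enc_mul_onTwo_FL : enc n * onTwo (FL n) = ind (fun i j => ∃ d', DecD i.2.2 i.2.1 d' ∧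
    FLRelTwo (i.1, d') j) fun j => amp n * (amp n * wt j.2) := by
  rw [enc, onTwo_FL, ind_mul_ind (c'' := fun j => amp n * (amp n * wt j.2))]
  · refine ind_congr (fun i j => ⟨?_, ?_⟩) fun _ _ _ => rfl
    · rintro ⟨⟨m, d'⟩, ⟨h1, h2⟩, h3⟩
      simp only at h1 h2
      subst h1
      exact ⟨d', h2, h3⟩
    · rintro ⟨d', h1, h2⟩
      exact ⟨(i.1, d'), ⟨rfl, h1⟩, h2⟩
  · rintro i l j j' ⟨h1, h2⟩ _ ⟨h1', h2'⟩ _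
    exact Prod.ext (h1.symm.trans h1') (h2.unique h2')
  · intro i j l _ h
    rw [wt_of_FLRelTwo h, mul_comm]

/-- Two forward queries, with the key `k₂` in between, simulate a forward query to the second
oracle. -/
lemma opNorm_forward_two (hs : 2 * s + 2 < 2 ^ n) :
    ‖(FLk n * (keyTwo n * (FLk n * enc n)) - enc n * onTwo (FL n)) * sizeProj n s‖ ≤ err n s := by
  rw [keyed_two_FL_mul_enc, enc_mul_onTwo_FL]
  refine opNorm_sub_mul_sizeProj_le (fun _ => ()) ((9 * s + 3) / 2 ^ n) 0 (by positivity) le_rfl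
    ?_ ?_ ?_ ?_ ?_
  · rw [Fintype.card_unit, add_zero, ← mul_div_assoc]
    refine div_le_div_of_nonneg_right ?_ (by positivity)
    push_cast
    linarith [Nat.cast_nonneg (α := ℝ) s]
  · rintro ⟨y, D, k⟩ ⟨x, d⟩ ⟨x', d'⟩ ⟨z, M, D₁, h1, h2, h3⟩ ⟨z', M', D₁', h1', h2', h3'⟩ -
    have h := h2.left_unique h2'
    simp only [Prod.mk.injEq, add_left_inj] at h
    obtain ⟨rfl, rfl⟩ := h
    have h := h1.left_unique h1'
    simp only [Prod.mk.injEq] at h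
    obtain ⟨rfl, rfl⟩ := h
    exact Prod.ext rfl (h3.unique h3')
  · rintro i ⟨x, d⟩ ⟨x', d'⟩ ⟨D, h1, h2⟩ ⟨D', h1', h2'⟩ -
    rw [h1.unique h1'] at h2
    exact h2.left_unique h2'
  · intro x d hd
    refine (mul_le_mul_of_nonneg_right (count_le_of_rare (n := n) (m := 9 * s + 3)
      (E := fun ω : Bits n × Bits n × Choices n d.2.1.1 d.2.2.1 => ω.1 ∉ im d.2.1.1 ∧
        ConflictTwo ω.2.2.1 (merge ω.2.2.1 d.1.1.1 d.2.1.1 ω.2.2.2.1) (x, ω.2.1)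
          (ω.2.1 + ω.2.2.1.2.1, ω.1))
      (Rare.prod (E := fun y (ω : Bits n × Choices n d.2.1.1 d.2.2.1) => y ∉ im d.2.1.1 ∧
        ConflictTwo ω.2.1 (merge ω.2.1 d.1.1.1 d.2.1.1 ω.2.2.1) (x, ω.1)
          (ω.1 + ω.2.1.2.1, y)) fun y => ?_)
      (fun ω i => i.1 = ω.1 ∧ i.2.2 = ω.2.2.1 ∧
        i.2.1.1.1 = insert (ω.2.1 + ω.2.2.1.2.1, ω.1) (insert (x, ω.2.1)
          (merge ω.2.2.1 d.1.1.1 d.2.1.1 ω.2.2.2.1)) ∧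
        i.2.1.2.1 = merge ω.2.2.1 d.1.2.1 d.2.2.1 ω.2.2.2.2) ?_ ?_) (sq_nonneg _)).trans
      (le_of_eq ?_)
    · by_cases hy : y ∈ im d.2.1.1
      · simp [hy, Rare]
      · refine (rare_conflictTwo (A := d.1.1.1) hy).mono (fun ω h => h.2) ?_
        unfold size at hd
        omega
    · rintro ⟨y, D, k⟩ ⟨⟨z₀, M, D', h1, h2, h3⟩, h4⟩
      obtain ⟨z, w, hz, hw⟩ := h3.exists_choices
      simp only at h1 h2 h3 h4 hz hw
      have hD1 := h1.insert_pair_eq h2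
      have hM1 : M.1.1 = insert (x, z₀) D'.1.1 := h1.2.2.1
      refine ⟨(y, z₀, k, z, w), ⟨?_, ?_⟩, rfl, rfl, ?_, ?_⟩
      · intro hy
        obtain ⟨u, hu⟩ := mem_im.mp hy
        replace hu : (u, y) ∈ d.2.1.1 := hu
        rw [← h3.1.two, mem_decTwo] at hu
        obtain ⟨v, -, hv⟩ := hu
        exact h2.2.1 (mem_im.mpr ⟨_, by rw [hM1]; exact Finset.mem_insert_of_mem hv⟩)
      · simp only
        rw [← hz]
        by_contra hconf
        rw [ConflictTwo, not_or, not_or, not_or, not_not, ← hD1] at hconf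
        exact h4 (exists_decD_insert_two h1 h2 hconf.2.2.2 h3 (by omega))
      · simp only
        rw [← hz, ← hD1]
      · simp only
        rw [← hw, show D.2 = M.2 from h2.2.2.2, show M.2 = D'.2 from h1.2.2.2]
    · rintro ω ⟨v₁, D₁, k₁⟩ ⟨v₂, D₂, k₂⟩ ⟨h1, h2, h3, h4⟩ ⟨h1', h2', h3', h4'⟩
      simp only at *
      rw [h1, h1', h2, h2', show D₁ = D₂ from Prod.ext (Subtype.ext (h3.trans h3'.symm))
        (Subtype.ext (h4.trans h4'.symm))]
    · rw [mul_pow, mul_pow, amp_sq, wt_sq, Fintype.card_prod, Fintype.card_prod, card_choices,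
        card_bits]
      unfold choiceExp
      push_cast
      field_simp
  · intro x d hd
    rw [count_of_forall_not fun i hi => ?_, zero_mul]
    obtain ⟨⟨d', h1, h2⟩, h3⟩ := hi
    have hsz := h2.size_eq
    simp only at hsz
    exact h3 (exists_FLRel_erase_two h2 h1 (by omega))

lemma FLk_adjoint_mul_enc : (FLk n)ᴴ * enc n = ind (fun i j => ∃ D, FLRel (j.1, D) (i.1, i.2.1) ∧
    DecD i.2.2 D j.2) fun j => amp n * wt j.2 := by
  rw [enc, FLk_eq_ind, conjTranspose_ind, ind_mul_ind (c'' := fun j => amp n * wt j.2)]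
  · refine ind_congr (fun i j => ⟨?_, ?_⟩) fun _ _ _ => rfl
    · rintro ⟨⟨m, D', k⟩, ⟨h1, h2⟩, h3, h4⟩
      simp only at h2 h3 h4 h1
      subst h2 h3
      exact ⟨D', h1, h4⟩
    · rintro ⟨D', h1, h2⟩
      exact ⟨(j.1, D', i.2.2), ⟨h1, rfl⟩, rfl, h2⟩
  · rintro i l ⟨m, D, k⟩ ⟨m', D', k'⟩ ⟨h1, h2⟩ ⟨h3, h4⟩ ⟨h1', h2'⟩ ⟨h3', h4'⟩
    simp only at *
    subst h2 h2' h3 h3'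
    rw [h1.right_unique h1']
  · exact fun _ _ _ _ _ => rfl

lemma FLk_mul_enc_mul_onTwo_FL_adjoint : keyTwo n * (FLk n * (enc n * (onTwo (FL n))ᴴ)) =
    ind (fun i j => ∃ x D' d', FLRel (i.1 + i.2.2.2.1, i.2.1) (x, D') ∧ DecD i.2.2 D' d' ∧
      FLRelTwo j (x, d')) fun j => amp n * wt j.2 := by
  have h : enc n * (onTwo (FL n))ᴴ = ind (fun i j => ∃ d', DecD i.2.2 i.2.1 d' ∧
      FLRelTwo j (i.1, d')) fun j => wt j.2 := by
    rw [enc, onTwo_FL, conjTranspose_ind, ind_mul_ind (c'' := fun j => wt j.2)]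
    · refine ind_congr (fun i j => ⟨?_, ?_⟩) fun _ _ _ => rfl
      · rintro ⟨⟨m, d'⟩, ⟨h1, h2⟩, h3⟩
        simp only at h1 h2
        subst h1
        exact ⟨d', h2, h3⟩
      · rintro ⟨d', h1, h2⟩
        exact ⟨(i.1, d'), ⟨rfl, h1⟩, h2⟩
    · rintro i l j j' ⟨h1, h2⟩ _ ⟨h1', h2'⟩ _
      exact Prod.ext (h1.symm.trans h1') (h2.unique h2')
    · intro i j l _ h
      rw [wt_of_FLRelTwo h, mul_comm]
  rw [h, FLk_eq_ind, ind_mul_ind (c'' := fun j => amp n * wt j.2), keyTwo, keyX_mul_ind]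
  · refine ind_congr (fun i j => ⟨?_, ?_⟩) fun _ _ _ => rfl
    · rintro ⟨⟨m, D', k⟩, ⟨h1, h2⟩, d', h3, h4⟩
      simp only at h2 h3 h4 h1
      subst h2
      exact ⟨m, D', d', h1, h3, h4⟩
    · rintro ⟨x, D', d', h1, h2, h3⟩
      exact ⟨(x, D', i.2.2), ⟨h1, rfl⟩, d', h2, h3⟩
  · exact fun i l j j' h _ h' _ => h.left_unique h'
  · exact fun _ _ _ _ _ => rfl

/-- Undoing a forward query removes the second half of a linked pair: what is left is the first
half, that is, a forward query made after undoing a forward query to the second oracle. -/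
lemma opNorm_backward_two (hs : 2 * s + 2 < 2 ^ n) :
    ‖((FLk n)ᴴ * enc n - keyTwo n * (FLk n * (enc n * (onTwo (FL n))ᴴ))) * sizeProj n s‖ ≤
      err n s := by
  rw [FLk_adjoint_mul_enc, FLk_mul_enc_mul_onTwo_FL_adjoint]
  refine opNorm_sub_mul_sizeProj_le Prod.fst (s / (2 ^ n) ^ 2) ((9 * s + 3) / (2 ^ n) ^ 2)
    (by positivity) (by positivity) ?_ ?_ ?_ ?_ ?_
  · rw [card_bits, ← add_div]
    push_cast
    rw [← mul_div_assoc, div_le_div_iff₀ (by positivity) (by positivity)]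
    have h1 : (0 : ℝ) < 2 ^ n := by positivity
    have h2 : (0 : ℝ) ≤ s := Nat.cast_nonneg s
    nlinarith [mul_pos h1 h1, mul_nonneg h2 (mul_pos h1 h1).le]
  · rintro i ⟨y, d⟩ ⟨y', d'⟩ ⟨D, h1, h2⟩ ⟨D', h1', h2'⟩ h
    simp only at h h1 h2 h1' h2'
    subst h
    rw [h1.right_unique h1'] at h2
    rw [h2.unique h2']
  · rintro i ⟨y, d⟩ ⟨y', d'⟩ ⟨x, D, e, h1, h2, h3⟩ ⟨x', D', e', h1', h2', h3'⟩ h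
    simp only at h
    subst h
    have h := h1.left_unique h1'
    simp only [Prod.mk.injEq] at h
    obtain ⟨rfl, rfl⟩ := h
    rw [h2.unique h2'] at h3
    rw [h3.right_unique h3']
  · intro y d hd
    refine (mul_le_mul_of_nonneg_right (count_le_of_rare (n := n) (m := s)
      (E := fun ω : Choices n d.2.1.1 d.2.2.1 =>
        (∃ a ∈ d.1.1.1, y = a.2 + ω.1.2.2) ∨ ∃ c : d.2.1.1, y = ω.2.1 c)
      ((rare_hit_unlinked y).mono (fun ω h => h) ?_)
      (fun ω i => i.2.2 = ω.1 ∧ y ∉ im i.2.1.1.1 ∧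
        insert (i.1, y) i.2.1.1.1 = merge ω.1 d.1.1.1 d.2.1.1 ω.2.1 ∧
        i.2.1.2.1 = merge ω.1 d.1.2.1 d.2.2.1 ω.2.2) ?_ ?_) (sq_nonneg _)).trans (le_of_eq ?_)
    · unfold size at hd
      omega
    · rintro ⟨u, M, k⟩ ⟨⟨D, h1, h2⟩, h3⟩
      obtain ⟨z, w, hz, hw⟩ := h2.exists_choices
      simp only at h1 h2 h3 hz hw
      have hD1 : D.1.1 = insert (u, y) M.1.1 := h1.2.2.1
      refine ⟨(k, z, w), ?_, rfl, h1.2.1, ?_, ?_⟩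
      · have hmem := h1.mem
        rw [hz] at hmem
        rcases mem_merge.mp hmem with ⟨a, ha, e⟩ | ⟨c, e⟩ | ⟨c, e⟩
        · exact Or.inl ⟨a, ha, congrArg Prod.snd e⟩
        · exact Or.inr ⟨c, congrArg Prod.snd e⟩
        · exfalso
          have hu : u = z c + k.2.1 := congrArg Prod.fst e
          have hp : (c.1.1, z c) ∈ D.1.1 := by
            rw [hz, mem_merge]
            exact Or.inr (Or.inl ⟨c, rfl⟩)
          subst hu
          obtain ⟨D', hM⟩ := exists_FLRel_of_link h2.1.good h1 hp
            (h2.card_le.trans (by omega))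
          obtain ⟨d', hd1, hd2⟩ := exists_decD_erase_two hM h1 h2 (by omega)
          exact h3 ⟨_, D', d', by rw [bits_add_add_cancel]; exact hM, hd1, hd2⟩
      · simp only
        rw [← hz, ← hD1]
      · simp only
        rw [← hw, show D.2 = M.2 from h1.2.2.2]
    · rintro ω ⟨x₁, D₁, k₁⟩ ⟨x₂, D₂, k₂⟩ ⟨h1, h2, h3, h4⟩ ⟨h1', h2', h3', h4'⟩
      simp only at *
      subst h1 h1'
      obtain ⟨hx, hD⟩ := insert_inj_of_notMem_im (h3.trans h3'.symm) h2 h2'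
      rw [hx, show D₁ = D₂ from Prod.ext (Subtype.ext hD) (Subtype.ext (h4.trans h4'.symm))]
    · rw [mul_pow, amp_sq, wt_sq, card_choices]
      unfold choiceExp
      push_cast
      field_simp
  · intro y d hd
    -- the record `(x₀, y)` that is removed, if there is one
    by_cases hx : ∃ x₀ e, FLRelTwo (y, d) (x₀, e)
    · obtain ⟨x₀, e, he⟩ := hx
      have hsz := he.size_eq
      simp only at hsz
      refine (mul_le_mul_of_nonneg_right (count_le_of_rare (n := n) (m := 9 * s + 3)
        (E := fun ω : Bits n × Choices n e.2.1.1 e.2.2.1 =>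
          ConflictTwo ω.2.1 (merge ω.2.1 e.1.1.1 e.2.1.1 ω.2.2.1) (x₀, ω.1)
            (ω.1 + ω.2.1.2.1, y))
        ((rare_conflictTwo he.1.2.1).mono (fun ω h => h) ?_)
        (fun ω i => i.1 = ω.1 + ω.2.1.2.1 ∧ i.2.2 = ω.2.1 ∧
          i.2.1.1.1 = insert (x₀, ω.1) (merge ω.2.1 e.1.1.1 e.2.1.1 ω.2.2.1) ∧
          i.2.1.2.1 = merge ω.2.1 e.1.2.1 e.2.2.1 ω.2.2.2) ?_ ?_) (sq_nonneg _)).trans (le_of_eq ?_)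
      · change 9 * (e.1.1.1.card + e.2.1.1.card) + 3 ≤ 9 * s + 3
        unfold size at hd hsz
        omega
      · rintro ⟨u, M, k⟩ ⟨⟨x, D', e', h1, h2, h3⟩, h4⟩
        have heq := he.left_unique h3
        simp only [Prod.mk.injEq] at heq h1 h2 h4
        obtain ⟨rfl, rfl⟩ := heq
        obtain ⟨z, w, hz, hw⟩ := h2.exists_choices
        have hM1 : M.1.1 = insert (x₀, u + k.2.1) D'.1.1 := h1.2.2.1
        refine ⟨(u + k.2.1, k, z, w), ?_, ?_, rfl, ?_, ?_⟩
        · simp only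
          rw [← hz]
          by_contra hconf
          obtain ⟨D, hD, hdec⟩ := exists_FLRel_insert_two h1 he h2 (by omega) hconf
          rw [bits_add_add_cancel] at hD
          exact h4 ⟨D, hD, hdec⟩
        · exact (bits_add_add_cancel _ _).symm
        · simp only
          rw [hM1, hz]
        · simp only
          rw [← hw, show M.2 = D'.2 from h1.2.2.2]
      · rintro ω ⟨x₁, D₁, k₁⟩ ⟨x₂, D₂, k₂⟩ ⟨h1, h2, h3, h4⟩ ⟨h1', h2', h3', h4'⟩
        simp only at *
        rw [h1, h1', h2, h2', show D₁ = D₂ from Prod.ext (Subtype.ext (h3.trans h3'.symm))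
          (Subtype.ext (h4.trans h4'.symm))]
      · have h1 : d.2.1.1.card = e.2.1.1.card + 1 := he.1.card_eq
        have h2 : d.2.2 = e.2.2 := he.1.2.2.2
        rw [mul_pow, amp_sq, wt_sq, Fintype.card_prod, card_choices, card_bits]
        unfold choiceExp
        simp only
        rw [h1, h2]
        push_cast
        field_simp
        ring
    · rw [count_of_forall_not fun i hi => ?_, zero_mul]
      · positivity
      · obtain ⟨⟨x, D', e, h1, h2, h3⟩, -⟩ := hi
        exact hx ⟨_, _, h3⟩

end Intertwine

/-! ### Exchanging queries and answers -/

section Flip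

open scoped Classical Matrix.Norms.L2Operator

variable {n : ℕ}

/-- The inverse relation. -/
def flipSet (S : Finset (Bits n × Bits n)) : Finset (Bits n × Bits n) := S.image Prod.swap

@[simp] lemma mem_flipSet {S : Finset (Bits n × Bits n)} {p : Bits n × Bits n} :
    p ∈ flipSet S ↔ p.swap ∈ S := by
  simp only [flipSet, Finset.mem_image]
  exact ⟨fun ⟨q, hq, h⟩ => by rw [← h]; simpa using hq, fun h => ⟨p.swap, h, Prod.swap_swap p⟩⟩

@[simp] lemma flipSet_flipSet (S : Finset (Bits n × Bits n)) : flipSet (flipSet S) = S := by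
  ext p
  simp

lemma flipSet_inj {S S' : Finset (Bits n × Bits n)} : flipSet S = flipSet S' ↔ S = S' :=
  ⟨fun h => by rw [← flipSet_flipSet S, h, flipSet_flipSet], fun h => by rw [h]⟩

@[simp] lemma card_flipSet (S : Finset (Bits n × Bits n)) : (flipSet S).card = S.card :=
  Finset.card_image_of_injective _ Prod.swap_injective

lemma IDistinct.flip {S : Finset (Bits n × Bits n)} (h : IDistinct S) : DDistinct (flipSet S) :=
  fun _ hp _ hq hpq =>
    Prod.swap_injective (h _ (mem_flipSet.mp hp) _ (mem_flipSet.mp hq) hpq)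

lemma DDistinct.flip {S : Finset (Bits n × Bits n)} (h : DDistinct S) : IDistinct (flipSet S) :=
  fun _ hp _ hq hpq =>
    Prod.swap_injective (h _ (mem_flipSet.mp hp) _ (mem_flipSet.mp hq) hpq)

/-- Inverting both relations of a database and exchanging them turns `F^L` into `F^R`. -/
def flipDb : Database n ≃ Database n where
  toFun D := (⟨flipSet D.2.1, D.2.2.flip⟩, ⟨flipSet D.1.1, D.1.2.flip⟩)
  invFun D := (⟨flipSet D.2.1, D.2.2.flip⟩, ⟨flipSet D.1.1, D.1.2.flip⟩)
  left_inv D := by simp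
  right_inv D := by simp

/-- Exchanging the outer keys. -/
def flipKeys : Keys n ≃ Keys n where
  toFun k := (k.2.2, k.2.1, k.1)
  invFun k := (k.2.2, k.2.1, k.1)
  left_inv _ := rfl
  right_inv _ := rfl

/-- The exchange on the labels of a single database. -/
def flipOne : Bits n × Database n ≃ Bits n × Database n := (Equiv.refl _).prodCongr flipDb

/-- The exchange on the labels of two databases. -/
def flipSrc : Bits n × Src n ≃ Bits n × Src n := (Equiv.refl _).prodCongr (flipDb.prodCongr flipDb)

/-- The exchange on the labels of the keyed experiment. -/
def flipTgt : Bits n × Tgt n ≃ Bits n × Tgt n :=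
  (Equiv.refl _).prodCongr (flipDb.prodCongr flipKeys)

lemma FL_submatrix_flip : (FL n).submatrix flipOne flipOne = FR n := by
  ext ⟨x, L', R'⟩ ⟨y, L, R⟩
  simp only [FL, FR, Matrix.submatrix_apply, Matrix.of_apply, flipOne, flipDb, Equiv.prodCongr_apply,
    Equiv.coe_fn_mk, Equiv.coe_refl, Prod.map_apply, id_eq, card_flipSet]
  have h1 : x ∉ im (flipSet R.1) ↔ x ∉ dom R.1 := by simp [im, dom]
  have h2 : flipSet R'.1 = flipSet R.1 ∪ {(y, x)} ↔ R'.1 = R.1 ∪ {(x, y)} := by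
    have : flipSet R.1 ∪ {(y, x)} = flipSet (R.1 ∪ {(x, y)}) := by
      ext ⟨a, b⟩
      simp [and_comm]
    rw [this, flipSet_inj]
  have h3 : (⟨flipSet L'.1, L'.2.flip⟩ : RelD n) = ⟨flipSet L.1, L.2.flip⟩ ↔ L' = L := by
    rw [Subtype.mk.injEq, flipSet_inj, Subtype.ext_iff]
  refine if_congr ?_ rfl rfl
  rw [h1, h2, h3, add_comm]
  tauto

lemma onOne_FL_submatrix_flip : (onOne (FL n)).submatrix flipSrc flipSrc = onOne (FR n) := by
  ext ⟨a, d, e⟩ ⟨a', d', e'⟩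
  have h := congrFun (congrFun (FL_submatrix_flip (n := n)) (a, d)) (a', d')
  rw [Matrix.submatrix_apply] at h
  change (if flipDb e = flipDb e' then FL n (flipOne (a, d)) (flipOne (a', d')) else 0) =
    if e = e' then FR n (a, d) (a', d') else 0
  rw [h]
  exact if_congr flipDb.injective.eq_iff rfl rfl

lemma onTwo_FL_submatrix_flip : (onTwo (FL n)).submatrix flipSrc flipSrc = onTwo (FR n) := by
  ext ⟨a, d, e⟩ ⟨a', d', e'⟩
  have h := congrFun (congrFun (FL_submatrix_flip (n := n)) (a, e)) (a', e')
  rw [Matrix.submatrix_apply] at h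
  change (if flipDb d = flipDb d' then FL n (flipOne (a, e)) (flipOne (a', e')) else 0) =
    if d = d' then FR n (a, e) (a', e') else 0
  rw [h]
  exact if_congr flipDb.injective.eq_iff rfl rfl

lemma FLk_submatrix_flip : (FLk n).submatrix flipTgt flipTgt = FRk n := by
  ext ⟨a, d, k⟩ ⟨a', d', k'⟩
  have h := congrFun (congrFun (FL_submatrix_flip (n := n)) (a, d)) (a', d')
  rw [Matrix.submatrix_apply] at h
  change (if flipKeys k = flipKeys k' then FL n (flipOne (a, d)) (flipOne (a', d')) else 0) =
    if k = k' then FR n (a, d) (a', d') else 0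
  rw [h]
  exact if_congr flipKeys.injective.eq_iff rfl rfl

lemma keyX_submatrix_flip (f : Keys n → Bits n) :
    (keyX f).submatrix flipTgt flipTgt = keyX fun k => f (flipKeys k) := by
  ext ⟨a, d, k⟩ ⟨a', d', k'⟩
  change (if flipKeys k = flipKeys k' then if (a, flipDb d) = (a' + f (flipKeys k'), flipDb d')
    then (1 : ℂ) else 0 else 0) = if k = k' then if (a, d) = (a' + f (flipKeys k'), d')
    then 1 else 0 else 0
  refine if_congr flipKeys.injective.eq_iff (if_congr ?_ rfl rfl) rfl
  have h : (a, d) = (a' + f (flipKeys k'), d') ↔ a = a' + f (flipKeys k') ∧ d = d' :=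
    Prod.ext_iff
  exact Prod.ext_iff.trans ((and_congr_right fun _ => flipDb.injective.eq_iff).trans h.symm)

lemma keyThree_submatrix_flip : (keyThree n).submatrix flipTgt flipTgt = keyOne n :=
  keyX_submatrix_flip _

lemma keyOne_submatrix_flip : (keyOne n).submatrix flipTgt flipTgt = keyThree n :=
  keyX_submatrix_flip _

lemma keyTwo_submatrix_flip : (keyTwo n).submatrix flipTgt flipTgt = keyTwo n :=
  keyX_submatrix_flip _

section DecFlip

variable {k : Keys n} {L A B : Finset (Bits n × Bits n)}

lemma link_flip {p q : Bits n × Bits n} : Link (flipKeys k) p q ↔ Link k q.swap p.swap := by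
  change p.2 + k.2.1 = q.1 ↔ q.1 + k.2.1 = p.2
  rw [bits_add_eq_iff, eq_comm]

lemma Isolated.flip {p q : Bits n × Bits n} (h : Isolated k L q.swap p.swap) :
    Isolated (flipKeys k) (flipSet L) p q := by
  intro r hr
  obtain ⟨h1, h2, h3, h4⟩ := h r.swap (mem_flipSet.mp hr)
  rw [link_flip, link_flip, link_flip, link_flip]
  exact ⟨fun h => Prod.swap_injective (h2 h), fun h => Prod.swap_injective (h1 h), h4, h3⟩

lemma Dec.flip (h : Dec k L A B) : Dec (flipKeys k) (flipSet L) (flipSet A) (flipSet B) := by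
  refine ⟨fun p hp q hq hl => ?_, ?_, ?_⟩
  · exact (h.good _ (mem_flipSet.mp hq) _ (mem_flipSet.mp hp) (link_flip.mp hl)).flip
  · ext c
    rw [mem_flipSet, ← h.one, mem_decOne, mem_decOne, mem_flipSet]
    refine and_congr_right fun _ => ⟨fun hl r hr => ?_, fun hl r hr => ?_⟩
    · have := hl r.swap (by simpa using hr)
      rw [link_flip, link_flip, Prod.swap_swap] at this
      exact this.symm
    · rw [link_flip, link_flip]
      exact (hl r.swap (mem_flipSet.mp hr)).symm
  · ext c
    rw [mem_flipSet, ← h.two, mem_decTwo, mem_decTwo]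
    constructor
    · rintro ⟨z, h1, h2⟩
      refine ⟨z + k.2.1, mem_flipSet.mp h2, ?_⟩
      rw [bits_add_add_cancel]
      exact mem_flipSet.mp h1
    · rintro ⟨z, h1, h2⟩
      refine ⟨z + k.2.1, mem_flipSet.mpr h2, mem_flipSet.mpr ?_⟩
      change (c.2, z + k.2.1 + k.2.1) ∈ L
      rw [bits_add_add_cancel]
      exact h1

lemma dec_flip_iff : Dec (flipKeys k) (flipSet L) (flipSet A) (flipSet B) ↔ Dec k L A B :=
  ⟨fun h => by simpa using! h.flip, Dec.flip⟩

end DecFlip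

lemma enc_submatrix_flip : (enc n).submatrix flipTgt flipSrc = enc n := by
  ext ⟨a, D, k⟩ ⟨a', d, e⟩
  change (if EncRel (a, flipDb D, flipKeys k) (a', flipDb d, flipDb e) then
    ((wt (flipDb d, flipDb e) : ℝ) : ℂ) else 0) = if EncRel (a, D, k) (a', d, e) then
      ((wt (d, e) : ℝ) : ℂ) else 0
  have h : wt (flipDb d, flipDb e) = wt (d, e) := by
    have : choiceExp (flipDb d, flipDb e) = choiceExp (d, e) := by
      simp only [choiceExp, flipDb, Equiv.coe_fn_mk, card_flipSet]
      ring
    rw [wt, wt, this]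
  rw [h]
  refine if_congr ?_ rfl rfl
  refine and_congr_right fun _ => ?_
  rw [DecD, DecD, and_comm]
  exact and_congr dec_flip_iff dec_flip_iff

lemma sizeProj_submatrix_flip (s : ℕ) :
    (sizeProj n s).submatrix flipSrc flipSrc = sizeProj n s := by
  have h : ∀ j : Bits n × Src n, size (flipSrc j).2 = size j.2 := by
    rintro ⟨a, d, e⟩
    change size (flipDb d, flipDb e) = size (d, e)
    simp only [size, flipDb, Equiv.coe_fn_mk, card_flipSet]
    ring
  rw [sizeProj, proj, Matrix.submatrix_diagonal_equiv]
  congr 1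
  funext j
  by_cases hj : size j.2 ≤ s <;> simp [h, hj]

end Flip

section Intertwine

open scoped Classical Matrix.Norms.L2Operator

variable {n s : ℕ}

lemma opNorm_flip_le {M : Matrix (Bits n × Tgt n) (Bits n × Src n) ℂ} {c : ℝ} (h : ‖M‖ ≤ c) :
    ‖M.submatrix flipTgt flipSrc‖ ≤ c := (opNorm_submatrix_le M _ _).trans h

lemma sub_submatrix_flip (M M' : Matrix (Bits n × Tgt n) (Bits n × Src n) ℂ) :
    (M - M').submatrix flipTgt flipSrc = M.submatrix flipTgt flipSrc - M'.submatrix flipTgt flipSrc :=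
  rfl

lemma mul_submatrix_flip_src (M : Matrix (Bits n × Tgt n) (Bits n × Src n) ℂ)
    (M' : Matrix (Bits n × Src n) (Bits n × Src n) ℂ) : (M * M').submatrix flipTgt flipSrc =
    M.submatrix flipTgt flipSrc * M'.submatrix flipSrc flipSrc :=
  (Matrix.submatrix_mul_equiv _ _ _ flipSrc _).symm

lemma mul_submatrix_flip_tgt (M : Matrix (Bits n × Tgt n) (Bits n × Tgt n) ℂ)
    (M' : Matrix (Bits n × Tgt n) (Bits n × Src n) ℂ) : (M * M').submatrix flipTgt flipSrc =
    M.submatrix flipTgt flipTgt * M'.submatrix flipTgt flipSrc :=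
  (Matrix.submatrix_mul_equiv _ _ _ flipTgt _).symm

lemma FLk_adjoint_submatrix_flip : (FLk n)ᴴ.submatrix flipTgt flipTgt = (FRk n)ᴴ := by
  rw [← Matrix.conjTranspose_submatrix, FLk_submatrix_flip]

lemma onOne_FL_adjoint_submatrix_flip :
    (onOne (FL n))ᴴ.submatrix flipSrc flipSrc = (onOne (FR n))ᴴ := by
  rw [← Matrix.conjTranspose_submatrix, onOne_FL_submatrix_flip]

lemma onTwo_FL_adjoint_submatrix_flip :
    (onTwo (FL n))ᴴ.submatrix flipSrc flipSrc = (onTwo (FR n))ᴴ := by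
  rw [← Matrix.conjTranspose_submatrix, onTwo_FL_submatrix_flip]

/-- The four intertwining relations for `F^R` follow from those for `F^L` by the exchange. -/
lemma opNorm_forward_one' (hs : 2 * s + 2 < 2 ^ n) :
    ‖(keyOne n * (FRk n * (keyThree n * enc n)) - enc n * onOne (FR n)) * sizeProj n s‖ ≤
      err n s := by
  have h := opNorm_flip_le (opNorm_forward_one (n := n) hs)
  simpa only [mul_submatrix_flip_src, mul_submatrix_flip_tgt, sub_submatrix_flip,
    sizeProj_submatrix_flip, enc_submatrix_flip, keyOne_submatrix_flip, keyThree_submatrix_flip,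
    FLk_submatrix_flip, onOne_FL_submatrix_flip] using h

lemma opNorm_backward_one' (hs : 2 * s + 2 < 2 ^ n) :
    ‖(keyThree n * ((FRk n)ᴴ * (keyOne n * enc n)) - enc n * (onOne (FR n))ᴴ) * sizeProj n s‖ ≤
      err n s := by
  have h := opNorm_flip_le (opNorm_backward_one (n := n) hs)
  simpa only [mul_submatrix_flip_src, mul_submatrix_flip_tgt, sub_submatrix_flip,
    sizeProj_submatrix_flip, enc_submatrix_flip, keyOne_submatrix_flip, keyThree_submatrix_flip,
    FLk_adjoint_submatrix_flip, onOne_FL_adjoint_submatrix_flip] using h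

lemma opNorm_forward_two' (hs : 2 * s + 2 < 2 ^ n) :
    ‖(FRk n * (keyTwo n * (FRk n * enc n)) - enc n * onTwo (FR n)) * sizeProj n s‖ ≤ err n s := by
  have h := opNorm_flip_le (opNorm_forward_two (n := n) hs)
  simpa only [mul_submatrix_flip_src, mul_submatrix_flip_tgt, sub_submatrix_flip,
    sizeProj_submatrix_flip, enc_submatrix_flip, keyTwo_submatrix_flip,
    FLk_submatrix_flip, onTwo_FL_submatrix_flip] using h

lemma opNorm_backward_two' (hs : 2 * s + 2 < 2 ^ n) :
    ‖((FRk n)ᴴ * enc n - keyTwo n * (FRk n * (enc n * (onTwo (FR n))ᴴ))) * sizeProj n s‖ ≤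
      err n s := by
  have h := opNorm_flip_le (opNorm_backward_two (n := n) hs)
  simpa only [mul_submatrix_flip_src, mul_submatrix_flip_tgt, sub_submatrix_flip,
    sizeProj_submatrix_flip, enc_submatrix_flip, keyTwo_submatrix_flip, FLk_submatrix_flip,
    FLk_adjoint_submatrix_flip, onTwo_FL_adjoint_submatrix_flip] using h

/-! ### Operators on small databases -/

/-- The projection onto the databases of the single oracle with at most `r` records. -/
def tgtProj (n r : ℕ) : Matrix (Bits n × Tgt n) (Bits n × Tgt n) ℂ :=
  proj fun j => j.2.1.1.1.card + j.2.1.2.1.card ≤ r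

lemma tgtProj_submatrix_flip (r : ℕ) : (tgtProj n r).submatrix flipTgt flipTgt = tgtProj n r := by
  have h : ∀ j : Bits n × Tgt n, (flipTgt j).2.1.1.1.card + (flipTgt j).2.1.2.1.card =
      j.2.1.1.1.card + j.2.1.2.1.card := by
    rintro ⟨a, d, k⟩
    change (flipDb d).1.1.card + (flipDb d).2.1.card = _
    simp only [flipDb, Equiv.coe_fn_mk, card_flipSet]
    ring
  rw [tgtProj, proj, Matrix.submatrix_diagonal_equiv]
  congr 1
  funext j
  by_cases hj : j.2.1.1.1.card + j.2.1.2.1.card ≤ r <;> simp [h, hj]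

lemma ind_mul_proj {ι κ : Type*} [Fintype ι] [Fintype κ] [DecidableEq ι] [DecidableEq κ]
    (P : ι → κ → Prop) (c : κ → ℝ) (p : κ → Prop) :
    ind P c * proj p = ind (fun i j => P i j ∧ p j) c := by
  ext i j
  by_cases h1 : P i j <;> by_cases h2 : p j <;> simp [ind, proj, h1, h2]

lemma proj_mul_ind {ι κ : Type*} [Fintype ι] [Fintype κ] [DecidableEq ι] [DecidableEq κ]
    (P : ι → κ → Prop) (c : κ → ℝ) (p : ι → Prop) :
    proj p * ind P c = ind (fun i j => p i ∧ P i j) c := by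
  ext i j
  by_cases h1 : P i j <;> by_cases h2 : p i <;> simp [ind, proj, h1, h2]

lemma tgtProj_mul_enc_mul_sizeProj (n s : ℕ) :
    tgtProj n (2 * s) * (enc n * sizeProj n s) = enc n * sizeProj n s := by
  rw [enc, sizeProj, ind_mul_proj, tgtProj, proj_mul_ind]
  refine ind_congr (fun i j => and_iff_right_of_imp fun h => ?_) fun _ _ _ => rfl
  exact h.1.2.card_le.trans (Nat.mul_le_mul_left _ h.2)

/-- The relation `FLRel` for `F^R`. -/
def FRRelKeyed (i j : Bits n × Tgt n) : Prop := FLRelKeyed (flipTgt i) (flipTgt j)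

lemma FRk_eq_ind : FRk n = ind FRRelKeyed fun _ => amp n := by
  rw [← FLk_submatrix_flip, FLk_eq_ind]
  rfl

lemma FRRelKeyed.spec {i j : Bits n × Tgt n} (h : FRRelKeyed i j) :
    i.2.1.1 = j.2.1.1 ∧ i.2.2 = j.2.2 ∧ (i.1, j.1) ∉ j.2.1.2.1 ∧
      i.2.1.2.1 = insert (i.1, j.1) j.2.1.2.1 := by
  obtain ⟨a, D, k⟩ := i
  obtain ⟨b, E, k'⟩ := j
  have h1 : FLRel (a, flipDb D) (b, flipDb E) := h.1
  have h2 : flipKeys k = flipKeys k' := h.2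
  have h3 : flipSet D.1.1 = flipSet E.1.1 := congrArg Subtype.val h1.2.2.2
  have h4 : flipSet D.2.1 = insert (b, a) (flipSet E.2.1) := h1.2.2.1
  have h5 : (b, a) ∉ flipSet E.2.1 := h1.notMem
  refine ⟨Subtype.ext (flipSet_inj.mp h3), flipKeys.injective h2, by simpa using h5, ?_⟩
  ext p
  have h6 := congrArg (fun S => p.swap ∈ S) h4
  simp only [mem_flipSet, Finset.mem_insert, Prod.swap_swap, eq_iff_iff] at h6
  rw [h6, Finset.mem_insert]
  exact or_congr_left ⟨fun h => Prod.swap_injective h, fun h => by rw [h]; rfl⟩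

/-- `F^{L†} X^{k₂} F^R` is small: shifted by `k₂`, the fresh answer of a backward query is almost
never one of the `r` recorded answers of forward queries. -/
lemma opNorm_FL_adjoint_keyTwo_FR (r : ℕ) :
    ‖(FLk n)ᴴ * (keyTwo n * FRk n) * tgtProj n r‖ ≤ √(r / 2 ^ n) := by
  have hM : (FLk n)ᴴ * (keyTwo n * FRk n) = ind (fun i j => ∃ m, FLRelKeyed m i ∧
      FRRelKeyed (m.1 + m.2.2.2.1, m.2) j) fun _ => amp n * amp n := by
    rw [FLk_eq_ind, conjTranspose_ind, FRk_eq_ind, keyTwo, keyX_mul_ind,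
      ind_mul_ind (c'' := fun _ => amp n * amp n)]
    · rintro ⟨x, E, k⟩ ⟨y, D, k'⟩ ⟨a, M, l⟩ ⟨a', M', l'⟩ h1 h2 h1' h2'
      obtain ⟨e1, e2, e3, e4⟩ := h2.spec
      obtain ⟨e1', e2', e3', e4'⟩ := h2'.spec
      simp only at e1 e2 e3 e4 e1' e2' e3' e4'
      have hM1 : M.1 = M'.1 := e1.trans e1'.symm
      have hM2 : M.2 = M'.2 := h1.1.2.2.2.trans h1'.1.2.2.2.symm
      have hM : M = M' := Prod.ext hM1 hM2
      subst hM
      have ha : (x, a) ∈ M.1.1 := h1.1.mem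
      have ha' : (x, a') ∉ E.1.1 := h1'.1.notMem
      have h3 : M.1.1 = insert (x, a') E.1.1 := h1'.1.2.2.1
      rw [h3] at ha
      have haE : (x, a) ∉ E.1.1 := h1.1.notMem
      have haa : a = a' := by
        rcases Finset.mem_insert.mp ha with h | h
        · exact congrArg Prod.snd h
        · exact absurd h haE
      rw [haa, e2.trans e2'.symm]
    · exact fun _ _ _ _ _ => rfl
  rw [hM, tgtProj, ind_mul_proj]
  have h : √((2 ^ n : ℝ) * (r / (2 ^ n) ^ 2)) = √(r / 2 ^ n) := by
    congr 1
    field_simp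
  rw [← h]
  refine opNorm_ind_le (by positivity) (by positivity) (fun i => ?_) fun j => ?_
  · have hc : (2 ^ n : ℝ) = ((Finset.univ : Finset (Bits n)).card : ℝ) := by
      rw [Finset.card_univ, card_bits]
      push_cast
      rfl
    rw [hc, Nat.cast_le]
    have hex : ∀ j : Bits n × Tgt n, ∃ w : Bits n, (∃ m, FLRelKeyed m i ∧
        FRRelKeyed (m.1 + m.2.2.2.1, m.2) j) → ∃ m, FLRelKeyed m i ∧
        FRRelKeyed (m.1 + m.2.2.2.1, m.2) j ∧ m.1 = w := by
      intro j
      by_cases hm : ∃ m, FLRelKeyed m i ∧ FRRelKeyed (m.1 + m.2.2.2.1, m.2) j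
      · obtain ⟨m, h1, h2⟩ := hm
        exact ⟨m.1, fun _ => ⟨m, h1, h2, rfl⟩⟩
      · exact ⟨0, fun h => absurd h hm⟩
    choose w hw using hex
    refine Finset.card_le_card_of_injOn w (fun _ _ => Finset.mem_coe.mpr (Finset.mem_univ _)) ?_
    intro j hj j' hj' hww
    simp only [Finset.coe_filter, Finset.mem_univ, true_and, Set.mem_ofPred_eq] at hj hj'
    obtain ⟨⟨a, M, l⟩, h1, h2, h3⟩ := hw j hj.1
    obtain ⟨⟨a', M', l'⟩, h1', h2', h3'⟩ := hw j' hj'.1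
    simp only at h3 h3'
    rw [← h3, ← h3'] at hww
    subst hww
    have hl : l = l' := h1.2.trans h1'.2.symm
    have hM : M = M' := h1.1.right_unique h1'.1
    subst hl hM
    obtain ⟨y, D, k⟩ := j
    obtain ⟨y', D', k'⟩ := j'
    obtain ⟨e1, e2, e3, e4⟩ := h2.spec
    obtain ⟨e1', e2', e3', e4'⟩ := h2'.spec
    simp only at e1 e2 e3 e4 e1' e2' e3' e4'
    have hy : (a + l.2.1, y) = (a + l.2.1, y') :=
      M.2.2 _ (by rw [e4]; exact Finset.mem_insert_self _ _) _
        (by rw [e4']; exact Finset.mem_insert_self _ _) rfl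
    have hy : y = y' := congrArg Prod.snd hy
    subst hy
    have hD2 : D.2.1 = D'.2.1 := eq_of_insert_eq_insert (e4.symm.trans e4') e3 e3'
    rw [show D = D' from Prod.ext (e1.symm.trans e1') (Subtype.ext hD2), e2.symm.trans e2']
  · by_cases hj : j.2.1.1.1.card + j.2.1.2.1.card ≤ r
    · rw [mul_pow, amp_sq]
      have hle : count (fun i => (∃ m, FLRelKeyed m i ∧ FRRelKeyed (m.1 + m.2.2.2.1, m.2) j) ∧
          j.2.1.1.1.card + j.2.1.2.1.card ≤ r) ≤ r := by
        rw [count, Nat.cast_le]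
        have hex : ∀ i : Bits n × Tgt n, ∃ e : Bits n × Bits n, (∃ m, FLRelKeyed m i ∧
            FRRelKeyed (m.1 + m.2.2.2.1, m.2) j) → ∃ m, FLRelKeyed m i ∧
            FRRelKeyed (m.1 + m.2.2.2.1, m.2) j ∧ e = (i.1, m.1) := by
          intro i
          by_cases hm : ∃ m, FLRelKeyed m i ∧ FRRelKeyed (m.1 + m.2.2.2.1, m.2) j
          · obtain ⟨m, h1, h2⟩ := hm
            exact ⟨_, fun _ => ⟨m, h1, h2, rfl⟩⟩
          · exact ⟨0, fun h => absurd h hm⟩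
        choose e he using hex
        refine le_trans (Finset.card_le_card_of_injOn (t := j.2.1.1.1) e ?_ ?_)
          (le_trans (Nat.le_add_right _ _) hj)
        · intro i hi
          simp only [Finset.coe_filter, Finset.mem_univ, true_and, Set.mem_ofPred_eq] at hi
          obtain ⟨m, h1, h2, h3⟩ := he i hi.1
          rw [h3, ← h2.spec.1]
          exact h1.1.mem
        · intro i hi i' hi' hee
          simp only [Finset.coe_filter, Finset.mem_univ, true_and, Set.mem_ofPred_eq] at hi hi'
          obtain ⟨⟨a, M, l⟩, h1, h2, h3⟩ := he i hi.1
          obtain ⟨⟨a', M', l'⟩, h1', h2', h3'⟩ := he i' hi'.1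
          obtain ⟨y, D, k⟩ := j
          obtain ⟨e1, e2, e3, e4⟩ := h2.spec
          obtain ⟨e1', e2', e3', e4'⟩ := h2'.spec
          rw [h3, h3', Prod.mk.injEq] at hee
          simp only at e1 e2 e3 e4 e1' e2' e3' e4' hee
          obtain ⟨hx, rfl⟩ := hee
          have hl : l = l' := e2.trans e2'.symm
          subst hl
          have hM : M = M' := Prod.ext (e1.trans e1'.symm) (Subtype.ext (e4.trans e4'.symm))
          subst hM
          exact h1.left_unique h1'
      refine (mul_le_mul_of_nonneg_right hle (by positivity)).trans (le_of_eq ?_)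
      field_simp
    · rw [count_of_forall_not fun i hi => hj hi.2, zero_mul]
      positivity

lemma opNorm_FR_adjoint_keyTwo_FL (r : ℕ) :
    ‖(FRk n)ᴴ * (keyTwo n * FLk n) * tgtProj n r‖ ≤ √(r / 2 ^ n) := by
  have hR : (FRk n).submatrix flipTgt flipTgt = FLk n := by
    have h : (flipTgt ∘ flipTgt : Bits n × Tgt n → Bits n × Tgt n) = id :=
      funext fun j => flipTgt.symm_apply_apply j
    rw [← FLk_submatrix_flip, Matrix.submatrix_submatrix, h, Matrix.submatrix_id_id]
  have hR' : (FLk n)ᴴ.submatrix flipTgt flipTgt = (FRk n)ᴴ := FLk_adjoint_submatrix_flip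
  have h := (opNorm_submatrix_le _ flipTgt flipTgt).trans (opNorm_FL_adjoint_keyTwo_FR (n := n) r)
  rwa [← Matrix.submatrix_mul_equiv _ _ _ flipTgt, ← Matrix.submatrix_mul_equiv _ _ _ flipTgt,
    ← Matrix.submatrix_mul_equiv _ _ _ flipTgt, hR, hR', keyTwo_submatrix_flip,
    tgtProj_submatrix_flip] at h

end Intertwine

/-! ### Operators acting on some of the registers -/

section Blocks

open scoped Matrix.Norms.L2Operator

variable {ι ι' ι'' κ κ' κ'' β : Type*} [Fintype ι] [Fintype ι'] [Fintype ι''] [Fintype κ]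
  [Fintype κ'] [Fintype κ''] [Fintype β] [DecidableEq ι] [DecidableEq ι'] [DecidableEq ι'']
  [DecidableEq κ] [DecidableEq κ'] [DecidableEq κ''] [DecidableEq β]

/-- The operator that applies `M b` to the registers `κ` if the register `β` is in the state `b`,
where `e` and `f` split off the register `β`. -/
def blocks (e : ι ≃ κ × β) (f : ι' ≃ κ' × β) (M : β → Matrix κ κ' ℂ) : Matrix ι ι' ℂ :=
  (Matrix.blockDiagonal M).submatrix e f

variable (e : ι ≃ κ × β) (f : ι' ≃ κ' × β) (g : ι'' ≃ κ'' × β)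

lemma blocks_apply (M : β → Matrix κ κ' ℂ) (i : ι) (j : ι') :
    blocks e f M i j = if (e i).2 = (f j).2 then M (e i).2 (e i).1 (f j).1 else 0 := by
  rw [blocks, Matrix.submatrix_apply, Matrix.blockDiagonal_apply]

lemma blocks_mul (M : β → Matrix κ κ' ℂ) (M' : β → Matrix κ' κ'' ℂ) :
    blocks e f M * blocks f g M' = blocks e g fun b => M b * M' b := by
  rw [blocks, blocks, blocks, Matrix.submatrix_mul_equiv, Matrix.blockDiagonal_mul]

lemma blocks_sub (M M' : β → Matrix κ κ' ℂ) :
    blocks e f M - blocks e f M' = blocks e f fun b => M b - M' b := by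
  ext i j
  simp only [blocks_apply, Matrix.sub_apply]
  split_ifs <;> simp

lemma blocks_add (M M' : β → Matrix κ κ' ℂ) :
    blocks e f M + blocks e f M' = blocks e f fun b => M b + M' b := by
  ext i j
  simp only [blocks_apply, Matrix.add_apply]
  split_ifs <;> simp

lemma blocks_one : blocks e e (fun _ => (1 : Matrix κ κ ℂ)) = 1 := by
  have : (fun _ : β => (1 : Matrix κ κ ℂ)) = 1 := rfl
  rw [blocks, this, Matrix.blockDiagonal_one, Matrix.submatrix_one_equiv]

lemma conjTranspose_blocks (M : β → Matrix κ κ' ℂ) :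
    (blocks e f M)ᴴ = blocks f e fun b => (M b)ᴴ := by
  rw [blocks, Matrix.conjTranspose_submatrix, Matrix.blockDiagonal_conjTranspose, blocks]

lemma opNorm_blocks_le (M : β → Matrix κ κ' ℂ) {c : ℝ} (hc : 0 ≤ c) (h : ∀ b, ‖M b‖ ≤ c) :
    ‖blocks e f M‖ ≤ c :=
  (opNorm_submatrix_le _ _ _).trans (opNorm_blockDiagonal_le _ hc h)

lemma opNorm_mul_le_one {M : Matrix ι κ ℂ} {M' : Matrix κ κ' ℂ} (h : ‖M‖ ≤ 1) (h' : ‖M'‖ ≤ 1) :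
    ‖M * M'‖ ≤ 1 :=
  (Matrix.l2_opNorm_mul _ _).trans (mul_le_one₀ h (norm_nonneg _) h')

lemma opNorm_one_le (ι : Type*) [Fintype ι] [DecidableEq ι] : ‖(1 : Matrix ι ι ℂ)‖ ≤ 1 := by
  rw [← Matrix.diagonal_one]
  exact opNorm_diagonal_le _ zero_le_one fun _ => norm_one.le

lemma opNorm_conjTranspose_le {M : Matrix ι κ ℂ} {c : ℝ} (h : ‖M‖ ≤ c) : ‖Mᴴ‖ ≤ c := by
  rwa [Matrix.l2_opNorm_conjTranspose]

end Blocks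

section Registers

open scoped Classical Matrix.Norms.L2Operator

variable {n : ℕ}

/-- Splitting off the registers `S₂, T₂`. -/
def splitOne : Bits n × Src n ≃ (Bits n × Database n) × Database n := (Equiv.prodAssoc _ _ _).symm

/-- Splitting off the registers `S₁, T₁`. -/
def splitTwo : Bits n × Src n ≃ (Bits n × Database n) × Database n where
  toFun i := ((i.1, i.2.2), i.2.1)
  invFun j := (j.1.1, j.2, j.1.2)
  left_inv _ := rfl
  right_inv _ := rfl

/-- Splitting off the key registers. -/
def splitKeys : Bits n × Tgt n ≃ (Bits n × Database n) × Keys n := (Equiv.prodAssoc _ _ _).symm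

lemma onOne_eq_blocks (O : Matrix (Bits n × Database n) (Bits n × Database n) ℂ) :
    onOne O = blocks splitOne splitOne fun _ => O := by
  ext ⟨a, d, e⟩ ⟨a', d', e'⟩
  rw [blocks_apply]
  rfl

lemma onTwo_eq_blocks (O : Matrix (Bits n × Database n) (Bits n × Database n) ℂ) :
    onTwo O = blocks splitTwo splitTwo fun _ => O := by
  ext ⟨a, d, e⟩ ⟨a', d', e'⟩
  rw [blocks_apply]
  rfl

lemma controlled_eq_blocks (O : Keys n → Matrix (Bits n × Database n) (Bits n × Database n) ℂ) :
    controlled O = blocks splitKeys splitKeys O := by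
  ext ⟨a, d, e⟩ ⟨a', d', e'⟩
  rw [blocks_apply]
  change (if e = e' then O e' (a, d) (a', d') else 0) = if e = e' then O e (a, d) (a', d') else 0
  split_ifs with h
  · rw [h]
  · rfl

/-- The path-recording oracle as an expression in two operators `l`, `r`. -/
def pathRecording {ι : Type*} [Fintype ι] [DecidableEq ι] (l r : Matrix ι ι ℂ) : Matrix ι ι ℂ :=
  l * (1 - r * rᴴ) + (1 - l * lᴴ) * rᴴ

lemma conjTranspose_pathRecording {ι : Type*} [Fintype ι] [DecidableEq ι] (l r : Matrix ι ι ℂ) :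
    (pathRecording l r)ᴴ = pathRecording r l := by
  simp only [pathRecording, Matrix.conjTranspose_add, Matrix.conjTranspose_mul,
    Matrix.conjTranspose_sub, Matrix.conjTranspose_one, Matrix.conjTranspose_conjTranspose]
  noncomm_ring

lemma F₁_eq_pathRecording (n : ℕ) : F₁ n = pathRecording (onOne (FL n)) (onOne (FR n)) := by
  change onOne (F n) = _
  simp only [pathRecording, onOne_eq_blocks, conjTranspose_blocks, blocks_mul, blocks_add, F,
    ← blocks_one (splitOne (n := n)), blocks_sub]

lemma F₂_eq_pathRecording (n : ℕ) : F₂ n = pathRecording (onTwo (FL n)) (onTwo (FR n)) := by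
  change onTwo (F n) = _
  simp only [pathRecording, onTwo_eq_blocks, conjTranspose_blocks, blocks_mul, blocks_add, F,
    ← blocks_one (splitTwo (n := n)), blocks_sub]

lemma keyX_mul_self (f : Keys n → Bits n) : keyX f * keyX f = 1 := by
  rw [keyX, controlled_eq_blocks, blocks_mul, ← blocks_one splitKeys]
  congr 1
  funext k
  ext ⟨a, D⟩ ⟨a', D'⟩
  rw [Matrix.mul_apply, Finset.sum_eq_single (a' + f k, D')]
  · simp only [X, Matrix.of_apply, if_true, mul_one, bits_add_add_cancel, Matrix.one_apply]
  · intro j _ hj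
    simp [X, hj]
  · simp

lemma opNorm_keyX_le (f : Keys n → Bits n) : ‖keyX f‖ ≤ 1 := by
  have h := Matrix.l2_opNorm_conjTranspose_mul_self (keyX f)
  rw [conjTranspose_keyX, keyX_mul_self] at h
  have h1 := opNorm_one_le (Bits n × Tgt n)
  rw [h] at h1
  nlinarith [norm_nonneg (keyX f)]

lemma keyedOne_eq_pathRecording (n : ℕ) : keyedOne n =
    pathRecording (keyThree n * FLk n * keyOne n) (keyOne n * FRk n * keyThree n) := by
  have h1 : keyedOne n = keyThree n * pathRecording (FLk n) (FRk n) * keyOne n := by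
    simp only [pathRecording, keyThree, keyOne, keyX, FLk, FRk, controlled_eq_blocks,
      conjTranspose_blocks, blocks_mul, blocks_add, keyedOne, F, ← blocks_one (splitKeys (n := n)),
      blocks_sub]
  have hx : keyOne n * keyOne n = 1 := keyX_mul_self _
  have hy : keyThree n * keyThree n = 1 := keyX_mul_self _
  have hx' : (keyOne n)ᴴ = keyOne n := conjTranspose_keyX _
  have hy' : (keyThree n)ᴴ = keyThree n := conjTranspose_keyX _
  have hxm : ∀ M, keyOne n * (keyOne n * M) = M := fun M => by rw [← mul_assoc, hx, one_mul]
  have hym : ∀ M, keyThree n * (keyThree n * M) = M := fun M => by rw [← mul_assoc, hy, one_mul]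
  rw [h1]
  simp only [pathRecording, Matrix.conjTranspose_mul, hx', hy', mul_sub, sub_mul, mul_add, add_mul,
    mul_one, one_mul, mul_assoc, hxm, hym]

lemma keyedTwo_eq_mul (n : ℕ) : keyedTwo n =
    pathRecording (FLk n) (FRk n) * keyTwo n * pathRecording (FLk n) (FRk n) := by
  simp only [pathRecording, keyTwo, keyX, FLk, FRk, controlled_eq_blocks,
    conjTranspose_blocks, blocks_mul, blocks_add, keyedTwo, F, ← blocks_one (splitKeys (n := n)),
    blocks_sub]

lemma count_FLRel_le (j : Bits n × Database n) : count (fun i => FLRel i j) ≤ 2 ^ n := by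
  have hc : (2 ^ n : ℝ) = ((Finset.univ : Finset (Bits n)).card : ℝ) := by
    rw [Finset.card_univ, card_bits]
    push_cast
    rfl
  rw [hc, count, Nat.cast_le]
  refine Finset.card_le_card_of_injOn Prod.fst (fun _ _ => Finset.mem_coe.mpr (Finset.mem_univ _)) ?_
  rintro ⟨y, D⟩ hi ⟨y', D'⟩ hi' (rfl : y = y')
  simp only [Finset.coe_filter, Finset.mem_univ, true_and, Set.mem_ofPred_eq] at hi hi'
  rw [hi.right_unique hi']

lemma le_count_FLRel (j : Bits n × Database n) (hj : j.2.1.1.card + j.2.2.1.card < 2 ^ n) :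
    (2 ^ n : ℝ) - j.2.1.1.card ≤ count fun i => FLRel i j := by
  have h1 : (Finset.univ \ im j.2.1.1).card ≤ (Finset.univ.filter fun i => FLRel i j).card := by
    have hex : ∀ y : Bits n, ∃ D, y ∉ im j.2.1.1 → FLRel (y, D) j := fun y => by
      by_cases hy : y ∉ im j.2.1.1
      · obtain ⟨D, hD⟩ := exists_FLRel_of_notMem j.1 hj hy
        exact ⟨D, fun _ => hD⟩
      · exact ⟨j.2, fun h => absurd h hy⟩
    choose D hD using hex
    refine Finset.card_le_card_of_injOn (fun y => (y, D y)) (fun y hy => ?_) fun y _ y' _ h =>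
      congrArg Prod.fst h
    simp only [Finset.coe_sdiff, Finset.coe_univ, Set.mem_sdiff, Set.mem_univ, true_and,
      Finset.mem_coe] at hy
    simpa using hD y hy
  have h2 : (im j.2.1.1).card ≤ j.2.1.1.card := Finset.card_image_le
  have h3 := Finset.le_card_sdiff (im j.2.1.1) Finset.univ
  rw [Finset.card_univ, card_bits] at h3
  have h4 : 2 ^ n ≤ (Finset.univ.filter fun i => FLRel i j).card + j.2.1.1.card := by omega
  rw [count, sub_le_iff_le_add]
  exact_mod_cast h4

lemma opNorm_FL_le (n : ℕ) : ‖FL n‖ ≤ 1 := by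
  rw [FL_eq_ind]
  have h := opNorm_ind_le (P := FLRel (n := n)) (c := fun _ => amp n) zero_le_one zero_le_one
    (fun i => ?_) fun j => ?_
  · simpa using h
  · norm_cast
    refine Finset.card_le_one.mpr fun j hj j' hj' => ?_
    simp only [Finset.mem_filter, Finset.mem_univ, true_and] at hj hj'
    exact hj.left_unique hj'
  · rw [amp_sq, mul_one_div, div_le_one (by positivity)]
    exact count_FLRel_le j

lemma opNorm_FR_le (n : ℕ) : ‖FR n‖ ≤ 1 := by
  rw [← FL_submatrix_flip]
  exact (opNorm_submatrix_le _ _ _).trans (opNorm_FL_le n)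

lemma opNorm_onOne_le {O : Matrix (Bits n × Database n) (Bits n × Database n) ℂ} (h : ‖O‖ ≤ 1) :
    ‖onOne O‖ ≤ 1 := by
  rw [onOne_eq_blocks]
  exact opNorm_blocks_le _ _ _ zero_le_one fun _ => h

lemma opNorm_onTwo_le {O : Matrix (Bits n × Database n) (Bits n × Database n) ℂ} (h : ‖O‖ ≤ 1) :
    ‖onTwo O‖ ≤ 1 := by
  rw [onTwo_eq_blocks]
  exact opNorm_blocks_le _ _ _ zero_le_one fun _ => h

lemma opNorm_controlled_le {O : Keys n → Matrix (Bits n × Database n) (Bits n × Database n) ℂ}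
    (h : ∀ k, ‖O k‖ ≤ 1) : ‖controlled O‖ ≤ 1 := by
  rw [controlled_eq_blocks]
  exact opNorm_blocks_le _ _ _ zero_le_one h

lemma opNorm_FLk_le (n : ℕ) : ‖FLk n‖ ≤ 1 := opNorm_controlled_le fun _ => opNorm_FL_le n

lemma opNorm_FRk_le (n : ℕ) : ‖FRk n‖ ≤ 1 := opNorm_controlled_le fun _ => opNorm_FR_le n

/-- `F^L` is close to an isometry on small databases. -/
lemma opNorm_FL_adjoint_FL_sub_one (r : ℕ) (hr : r < 2 ^ n) :
    ‖((FLk n)ᴴ * FLk n - 1) * tgtProj n r‖ ≤ r / 2 ^ n := by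
  have hdiag : ((FLk n)ᴴ * FLk n - 1) * tgtProj n r = Matrix.diagonal fun j =>
      (((FLk n)ᴴ * FLk n - 1) * tgtProj n r) j j := by
    ext i j
    by_cases hij : i = j
    · rw [hij, Matrix.diagonal_apply_eq]
    · rw [Matrix.diagonal_apply_ne _ hij, tgtProj, proj, Matrix.mul_diagonal, Matrix.sub_apply,
        Matrix.one_apply_ne hij, Matrix.mul_apply, Finset.sum_eq_zero, sub_zero, zero_mul]
      intro m _
      rw [FLk_eq_ind, conjTranspose_ind]
      by_cases h1 : FLRelKeyed m i
      · have h2 : ¬FLRelKeyed m j := fun h2 => hij (h1.left_unique h2)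
        simp [ind, h2]
      · simp [ind, h1]
  rw [hdiag]
  refine opNorm_diagonal_le _ (by positivity) fun j => ?_
  rw [tgtProj, proj, Matrix.mul_diagonal]
  split_ifs with hj
  · have h1 : ((FLk n)ᴴ * FLk n) j j =
        ((count (fun i => FLRel i (j.1, j.2.1)) / 2 ^ n : ℝ) : ℂ) := by
      have hc : count (fun i => FLRelKeyed i j) = count fun i => FLRel i (j.1, j.2.1) := by
        rw [count, count, Nat.cast_inj]
        refine Finset.card_bij (fun i _ => (i.1, i.2.1)) (fun i hi => ?_) (fun i hi i' hi' h => ?_)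
          fun i hi => ?_
        · simp only [Finset.mem_filter, Finset.mem_univ, true_and] at hi ⊢
          exact hi.1
        · simp only [Finset.mem_filter, Finset.mem_univ, true_and] at hi hi'
          rw [Prod.mk.injEq] at h
          exact Prod.ext h.1 (Prod.ext h.2 (hi.2.trans hi'.2.symm))
        · simp only [Finset.mem_filter, Finset.mem_univ, true_and] at hi
          exact ⟨(i.1, i.2, j.2.2), by simpa using ⟨hi, rfl⟩, rfl⟩
      rw [← hc, div_eq_mul_one_div, ← amp_sq, count, ← nsmul_eq_mul, ← Finset.sum_const,
        Finset.sum_filter, FLk_eq_ind, conjTranspose_ind, Matrix.mul_apply]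
      push_cast
      refine Finset.sum_congr rfl fun i _ => ?_
      by_cases h1 : FLRelKeyed i j <;> simp [ind, h1, sq]
    have hN : (0 : ℝ) < 2 ^ n := by positivity
    have h2 := count_FLRel_le (j.1, j.2.1)
    have h3 := le_count_FLRel (j.1, j.2.1) (lt_of_le_of_lt hj hr)
    have h4 : (j.2.1.1.1.card : ℝ) ≤ r := by
      exact_mod_cast (Nat.le_add_right _ _).trans hj
    rw [Matrix.sub_apply, Matrix.one_apply_eq, h1, mul_one, ← Complex.ofReal_one,
      ← Complex.ofReal_sub, Complex.norm_real, Real.norm_eq_abs, abs_sub_comm, abs_of_nonneg,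
      one_sub_div hN.ne']
    · gcongr
      simp only at h3
      linarith
    · rw [sub_nonneg, div_le_one hN]
      exact h2
  · rw [mul_zero, norm_zero]
    positivity

lemma opNorm_FR_adjoint_FR_sub_one (r : ℕ) (hr : r < 2 ^ n) :
    ‖((FRk n)ᴴ * FRk n - 1) * tgtProj n r‖ ≤ r / 2 ^ n := by
  have h := (opNorm_submatrix_le _ flipTgt flipTgt).trans (opNorm_FL_adjoint_FL_sub_one r hr)
  rw [← Matrix.submatrix_mul_equiv _ _ _ flipTgt, tgtProj_submatrix_flip] at h
  have h1 : ((FLk n)ᴴ * FLk n - 1).submatrix flipTgt flipTgt = (FRk n)ᴴ * FRk n - 1 := by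
    rw [← FLk_adjoint_submatrix_flip, ← FLk_submatrix_flip, Matrix.submatrix_mul_equiv]
    exact congrArg (((FLk n)ᴴ * FLk n).submatrix flipTgt flipTgt - ·)
      (Matrix.submatrix_one_equiv flipTgt)
  rwa [h1] at h

end Registers

/-! ### Intertwining up to a small error -/

section Near

open scoped Classical Matrix.Norms.L2Operator

variable {n S : ℕ}

/-- The operator adds at most `c` records to the two databases. -/
def Grows (c : ℕ) (o : Matrix (Bits n × Src n) (Bits n × Src n) ℂ) : Prop :=
  ∀ i j, o i j ≠ 0 → size i.2 ≤ size j.2 + c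

lemma Grows.mono {c c' : ℕ} {o : Matrix (Bits n × Src n) (Bits n × Src n) ℂ} (h : Grows c o)
    (hc : c ≤ c') : Grows c' o := fun i j hij => (h i j hij).trans (by omega)

lemma Grows.mul {c c' : ℕ} {o o' : Matrix (Bits n × Src n) (Bits n × Src n) ℂ} (h : Grows c o)
    (h' : Grows c' o') : Grows (c + c') (o * o') := by
  intro i j hij
  rw [Matrix.mul_apply] at hij
  obtain ⟨m, -, hm⟩ := Finset.exists_ne_zero_of_sum_ne_zero hij
  have h1 := h i m (left_ne_zero_of_mul hm)
  have h2 := h' m j (right_ne_zero_of_mul hm)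
  omega

lemma Grows.add {c c' : ℕ} {o o' : Matrix (Bits n × Src n) (Bits n × Src n) ℂ} (h : Grows c o)
    (h' : Grows c' o') : Grows (c + c') (o + o') := by
  intro i j hij
  by_cases h0 : o i j = 0
  · have h1 : o' i j ≠ 0 := fun h1 => hij (by rw [Matrix.add_apply, h0, h1, add_zero])
    exact (h' i j h1).trans (by omega)
  · exact (h i j h0).trans (by omega)

lemma Grows.neg {c : ℕ} {o : Matrix (Bits n × Src n) (Bits n × Src n) ℂ} (h : Grows c o) :
    Grows c (-o) := fun i j hij => h i j fun h0 => hij (by rw [Matrix.neg_apply, h0, neg_zero])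

lemma Grows.sub {c c' : ℕ} {o o' : Matrix (Bits n × Src n) (Bits n × Src n) ℂ} (h : Grows c o)
    (h' : Grows c' o') : Grows (c + c') (o - o') := sub_eq_add_neg o o' ▸ h.add h'.neg

lemma Grows.mul_sizeProj {c s : ℕ} {o : Matrix (Bits n × Src n) (Bits n × Src n) ℂ}
    (h : Grows c o) : sizeProj n (s + c) * (o * sizeProj n s) = o * sizeProj n s := by
  ext i j
  simp only [sizeProj, proj, Matrix.diagonal_mul, Matrix.mul_diagonal]
  by_cases hj : size j.2 ≤ s
  · by_cases hij : o i j = 0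
    · simp [hij]
    · have : size i.2 ≤ s + c := (h i j hij).trans (by omega)
      simp [this]
  · simp [hj]

/-- Equality up to an error of `c` elementary operations on the databases that have room for `c`
more records below the bound `S`. -/
def Near (S c : ℕ) (M M' : Matrix (Bits n × Tgt n) (Bits n × Src n) ℂ) : Prop :=
  ∀ s, s + c ≤ S → ‖(M - M') * sizeProj n s‖ ≤ c * err n S

lemma opNorm_sizeProj_le (n s : ℕ) : ‖sizeProj n s‖ ≤ 1 := by
  refine opNorm_diagonal_le _ zero_le_one fun j => ?_
  split_ifs <;> simp

lemma err_nonneg (n s : ℕ) : 0 ≤ err n s := Real.sqrt_nonneg _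

lemma err_mono {s s' : ℕ} (h : s ≤ s') : err n s ≤ err n s' := by
  unfold err
  have : (s : ℝ) ≤ s' := by exact_mod_cast h
  gcongr

variable {c c' k : ℕ} {M M' M₁ M₁' M₂ : Matrix (Bits n × Tgt n) (Bits n × Src n) ℂ}

lemma Near.refl (M : Matrix (Bits n × Tgt n) (Bits n × Src n) ℂ) : Near S 0 M M := fun s _ => by
  simp

lemma Near.mono (h : Near S c M M') (hc : c ≤ c') : Near S c' M M' := fun s hs =>
  (h s (by omega)).trans (mul_le_mul_of_nonneg_right (by exact_mod_cast hc) (err_nonneg _ _))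

lemma Near.add (h : Near S c M M') (h' : Near S c' M₁ M₁') :
    Near S (c + c') (M + M₁) (M' + M₁') := fun s hs => by
  rw [add_sub_add_comm, Matrix.add_mul, Nat.cast_add, add_mul]
  exact (norm_add_le _ _).trans (add_le_add (h s (by omega)) (h' s (by omega)))

lemma Near.sub (h : Near S c M M') (h' : Near S c' M₁ M₁') :
    Near S (c + c') (M - M₁) (M' - M₁') := fun s hs => by
  rw [sub_sub_sub_comm, Matrix.sub_mul, Nat.cast_add, add_mul]
  exact (norm_sub_le _ _).trans (add_le_add (h s (by omega)) (h' s (by omega)))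

lemma Near.trans (h : Near S c M M') (h' : Near S c' M' M₂) : Near S (c + c') M M₂ :=
    fun s hs => by
  rw [← sub_add_sub_cancel M M' M₂, Matrix.add_mul, Nat.cast_add, add_mul]
  exact (norm_add_le _ _).trans (add_le_add (h s (by omega)) (h' s (by omega)))

lemma Near.mul_left {T : Matrix (Bits n × Tgt n) (Bits n × Tgt n) ℂ} (hT : ‖T‖ ≤ 1)
    (h : Near S c M M') : Near S c (T * M) (T * M') := fun s hs => by
  rw [← Matrix.mul_sub, Matrix.mul_assoc]
  exact (Matrix.l2_opNorm_mul _ _).trans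
    ((mul_le_of_le_one_left (norm_nonneg _) hT).trans (h s hs))

lemma Near.mul_right {o : Matrix (Bits n × Src n) (Bits n × Src n) ℂ} (ho : ‖o‖ ≤ 1)
    (hk : Grows k o) (h : Near S c M M') : Near S (c + k) (M * o) (M' * o) := fun s hs => by
  rw [← Matrix.sub_mul, Matrix.mul_assoc, ← hk.mul_sizeProj, ← Matrix.mul_assoc]
  refine (Matrix.l2_opNorm_mul _ _).trans ((mul_le_of_le_one_right (norm_nonneg _)
    (opNorm_mul_le_one ho (opNorm_sizeProj_le n s))).trans ((h (s + k) (by omega)).trans ?_))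
  exact mul_le_mul_of_nonneg_right (by exact_mod_cast Nat.le_add_right _ _) (err_nonneg _ _)

/-- Through the encoding, `T` acts as `o` up to a small error. The number `c` bounds both the error
and the number of records added by `o`. -/
structure Intertwines (S c : ℕ) (T : Matrix (Bits n × Tgt n) (Bits n × Tgt n) ℂ)
    (o : Matrix (Bits n × Src n) (Bits n × Src n) ℂ) : Prop where
  near : Near S c (T * enc n) (enc n * o)
  grows : Grows c o

variable {T T' : Matrix (Bits n × Tgt n) (Bits n × Tgt n) ℂ}
  {o o' : Matrix (Bits n × Src n) (Bits n × Src n) ℂ}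

lemma Intertwines.mono (h : Intertwines S c T o) (hc : c ≤ c') : Intertwines S c' T o :=
  ⟨h.near.mono hc, h.grows.mono hc⟩

lemma Intertwines.add (h : Intertwines S c T o) (h' : Intertwines S c' T' o') :
    Intertwines S (c + c') (T + T') (o + o') :=
  ⟨by rw [Matrix.add_mul, Matrix.mul_add]; exact h.near.add h'.near, h.grows.add h'.grows⟩

lemma Intertwines.sub (h : Intertwines S c T o) (h' : Intertwines S c' T' o') :
    Intertwines S (c + c') (T - T') (o - o') :=
  ⟨by rw [Matrix.sub_mul, Matrix.mul_sub]; exact h.near.sub h'.near, h.grows.sub h'.grows⟩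

lemma Intertwines.mul (h : Intertwines S c T o) (h' : Intertwines S c' T' o') (hT : ‖T‖ ≤ 1)
    (ho : ‖o'‖ ≤ 1) : Intertwines S (c + c') (T * T') (o * o') := by
  refine ⟨?_, h.grows.mul h'.grows⟩
  have h1 := h'.near.mul_left hT
  simp only [← Matrix.mul_assoc] at h1 ⊢
  intro s hs
  rw [← sub_add_sub_cancel _ (T * enc n * o') _, Matrix.add_mul, add_comm c, Nat.cast_add, add_mul]
  refine (norm_add_le _ _).trans (add_le_add (h1 s (by omega)) ?_)
  rw [← Matrix.sub_mul, Matrix.mul_assoc, ← h'.grows.mul_sizeProj, ← Matrix.mul_assoc]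
  exact (Matrix.l2_opNorm_mul _ _).trans ((mul_le_of_le_one_right (norm_nonneg _)
    (opNorm_mul_le_one ho (opNorm_sizeProj_le n s))).trans (h.near (s + c') (by omega)))

lemma pathRecording_eq {ι : Type*} [Fintype ι] [DecidableEq ι] (l r : Matrix ι ι ℂ) :
    pathRecording l r = l + rᴴ - l * (r * rᴴ) - l * (lᴴ * rᴴ) := by
  rw [pathRecording]
  noncomm_ring

/-- If two operators and their adjoints intertwine, then so do the path-recording oracles made of
them. -/
lemma intertwines_pathRecording {tl tr : Matrix (Bits n × Tgt n) (Bits n × Tgt n) ℂ}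
    {l r : Matrix (Bits n × Src n) (Bits n × Src n) ℂ} (htl : ‖tl‖ ≤ 1) (htr : ‖tr‖ ≤ 1)
    (hl : ‖l‖ ≤ 1) (hr : ‖r‖ ≤ 1) (h1 : Intertwines S 1 tl l) (h2 : Intertwines S 1 tr r)
    (h3 : Intertwines S 1 tlᴴ lᴴ) (h4 : Intertwines S 1 trᴴ rᴴ) :
    Intertwines S 8 (pathRecording tl tr) (pathRecording l r) := by
  have hr' := opNorm_conjTranspose_le hr
  rw [pathRecording_eq, pathRecording_eq]
  exact ((h1.add h4).sub (h1.mul (h2.mul h4 htr hr') htl (opNorm_mul_le_one hr hr'))).sub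
    (h1.mul (h3.mul h4 (opNorm_conjTranspose_le htl) hr') htl
      (opNorm_mul_le_one (opNorm_conjTranspose_le hl) hr'))

/-- Two path-recording oracles with the key `x` in between act as a single one. In the expanded
product, a forward query followed by a forward query is a forward query to the simulated oracle
(`h1`), and undoing a query leaves half of a linked pair (`h3`, `h4`), which the second oracle
undoes, too (`h7`). Undoing a query of the other kind than the one just made is unlikely (`h5`,
`h6`), so the terms that contain it vanish. -/
lemma intertwines_pathRecording_mul
    {L R x : Matrix (Bits n × Tgt n) (Bits n × Tgt n) ℂ}
    {l r : Matrix (Bits n × Src n) (Bits n × Src n) ℂ} (hL : ‖L‖ ≤ 1) (hR : ‖R‖ ≤ 1)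
    (hx : ‖x‖ ≤ 1) (hxx : x * x = 1) (hl : ‖l‖ ≤ 1) (hr : ‖r‖ ≤ 1)
    (gl : Grows 1 l) (gr : Grows 1 r) (gl' : Grows 1 lᴴ) (gr' : Grows 1 rᴴ)
    (h1 : Near S 1 (L * (x * (L * enc n))) (enc n * l))
    (h2 : Near S 1 (R * (x * (R * enc n))) (enc n * r))
    (h3 : Near S 1 (Lᴴ * enc n) (x * (L * (enc n * lᴴ))))
    (h4 : Near S 1 (Rᴴ * enc n) (x * (R * (enc n * rᴴ))))
    (h5 : Near S 1 (Lᴴ * (x * (R * enc n))) 0) (h6 : Near S 1 (Rᴴ * (x * (L * enc n))) 0)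
    (h7 : Near S 1 (Rᴴ * (R * enc n)) (enc n)) :
    Intertwines S 24 (pathRecording L R * x * pathRecording L R) (pathRecording l r) := by
  have hL' := opNorm_conjTranspose_le hL
  have hR' := opNorm_conjTranspose_le hR
  have hl' := opNorm_conjTranspose_le hl
  have hr' := opNorm_conjTranspose_le hr
  have hF : ‖pathRecording L R‖ ≤ 1 := opNorm_pathRecording_le hL hR
  have hxm : ∀ M : Matrix (Bits n × Tgt n) (Bits n × Src n) ℂ, x * (x * M) = M := fun M => by
    rw [← Matrix.mul_assoc, hxx, Matrix.one_mul]
  have e1 : ∀ M : Matrix (Bits n × Tgt n) (Bits n × Src n) ℂ, pathRecording L R * M =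
      L * M + Rᴴ * M - L * (R * (Rᴴ * M)) - L * (Lᴴ * (Rᴴ * M)) := fun M => by
    rw [pathRecording_eq]
    simp only [Matrix.sub_mul, Matrix.add_mul, Matrix.mul_assoc]
  -- the first of the two oracles
  have a1 : Near S 3 (L * (R * (Rᴴ * enc n))) (L * (enc n * (r * rᴴ))) := by
    have b1 := (h4.mul_left hR).mul_left hL
    have b2 := (h2.mul_right hr' gr').mul_left hL
    simp only [Matrix.mul_assoc] at b1 b2
    exact b1.trans b2
  have a2 : Near S 3 (L * (Lᴴ * (Rᴴ * enc n))) 0 := by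
    have b1 := (h4.mul_left hL').mul_left hL
    have b2 := (h5.mul_right hr' gr').mul_left hL
    simp only [Matrix.mul_assoc, Matrix.zero_mul, Matrix.mul_zero] at b1 b2
    exact b1.trans b2
  have a3 : Near S 7 (pathRecording L R * enc n)
      (L * enc n + x * (R * (enc n * rᴴ)) - L * (enc n * (r * rᴴ)) - 0) := by
    rw [e1]
    exact (((Near.refl _).add h4).sub a1).sub a2
  -- the second of the two oracles
  have a4 : Near S 4 (pathRecording L R * (x * (L * enc n))) (enc n * l) := by
    rw [e1]
    have b1 := (h6.mul_left hR).mul_left hL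
    have b2 := (h6.mul_left hL').mul_left hL
    simp only [Matrix.mul_zero] at b1 b2
    simpa using ((h1.add h6).sub b1).sub b2
  have a5 : Near S 6 (pathRecording L R * (R * enc n)) (enc n - enc n * (l * lᴴ)) := by
    rw [e1]
    have b1 := (h7.mul_left hR).mul_left hL
    have b2 := (h7.mul_left hL').mul_left hL
    have b3 := h3.mul_left hL
    have b4 := h1.mul_right hl' gl'
    simp only [Matrix.mul_assoc] at b4
    have b5 := (((Near.refl (L * (R * enc n))).add h7).sub b1).sub (b2.trans (b3.trans b4))
    simpa using b5
  have a6 : Near S 17 (pathRecording L R * (x * (L * enc n + x * (R * (enc n * rᴴ)) -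
      L * (enc n * (r * rᴴ)) - 0))) (enc n * pathRecording l r) := by
    have b1 := a5.mul_right hr' gr'
    have b2 := a4.mul_right (opNorm_mul_le_one hr hr') (gr.mul gr')
    have b3 := (a4.add b1).sub b2
    rw [pathRecording_eq l r]
    simp only [sub_zero, Matrix.mul_sub, Matrix.mul_add, Matrix.sub_mul, hxm,
      Matrix.mul_assoc] at b3 ⊢
    convert b3 using 1
    abel
  refine ⟨?_, ?_⟩
  · have b1 := (a3.mul_left hx).mul_left hF
    simp only [Matrix.mul_assoc] at b1 ⊢
    exact b1.trans a6
  · rw [pathRecording_eq]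
    exact (((gl.add gr').sub (gl.mul (gr.mul gr'))).sub (gl.mul (gl'.mul gr'))).mono (by norm_num)

end Near

/-! ### The oracles of the two experiments -/

section Oracles

open scoped Classical Matrix.Norms.L2Operator

variable {n S : ℕ}

lemma rel_of_ind_ne_zero {ι κ : Type*} [Fintype ι] [Fintype κ] [DecidableEq ι] [DecidableEq κ]
    {P : ι → κ → Prop} {c : κ → ℝ} {i : ι} {j : κ} (h : ind P c i j ≠ 0) : P i j := by
  by_contra hP
  exact h (by simp [ind, hP])

lemma grows_onOne_FL : Grows 1 (onOne (FL n)) := fun i j hij => by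
  rw [onOne_FL] at hij
  exact (rel_of_ind_ne_zero hij).size_eq.le

lemma grows_onTwo_FL : Grows 1 (onTwo (FL n)) := fun i j hij => by
  rw [onTwo_FL] at hij
  exact (rel_of_ind_ne_zero hij).size_eq.le

lemma grows_onOne_FL_adjoint : Grows 1 (onOne (FL n))ᴴ := fun i j hij => by
  rw [onOne_FL, conjTranspose_ind] at hij
  have := (rel_of_ind_ne_zero hij).size_eq
  omega

lemma grows_onTwo_FL_adjoint : Grows 1 (onTwo (FL n))ᴴ := fun i j hij => by
  rw [onTwo_FL, conjTranspose_ind] at hij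
  have := (rel_of_ind_ne_zero hij).size_eq
  omega

lemma size_flip (j : Bits n × Src n) : size (flipSrc j).2 = size j.2 := by
  obtain ⟨a, d, e⟩ := j
  change size (flipDb d, flipDb e) = size (d, e)
  simp only [size, flipDb, Equiv.coe_fn_mk, card_flipSet]
  ring

lemma Grows.flip {c : ℕ} {o : Matrix (Bits n × Src n) (Bits n × Src n) ℂ} (h : Grows c o) :
    Grows c (o.submatrix flipSrc flipSrc) := fun i j hij => by
  rw [← size_flip i, ← size_flip j]
  exact h _ _ hij

lemma near_one_of_forall {M M' : Matrix (Bits n × Tgt n) (Bits n × Src n) ℂ}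
    (h : ∀ s, s ≤ S → ‖(M - M') * sizeProj n s‖ ≤ err n s) : Near S 1 M M' := fun s hs => by
  rw [Nat.cast_one, one_mul]
  exact (h s (by omega)).trans (err_mono (by omega))

lemma opNorm_mul_enc_mul_sizeProj_le {M : Matrix (Bits n × Tgt n) (Bits n × Tgt n) ℂ} {s : ℕ}
    {c : ℝ} (h : ‖M * tgtProj n (2 * s)‖ ≤ c) : ‖M * enc n * sizeProj n s‖ ≤ c := by
  rw [Matrix.mul_assoc, ← tgtProj_mul_enc_mul_sizeProj, ← Matrix.mul_assoc]
  exact (Matrix.l2_opNorm_mul _ _).trans ((mul_le_of_le_one_right (norm_nonneg _)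
    (opNorm_mul_le_one (opNorm_enc_le n) (opNorm_sizeProj_le n s))).trans h)

lemma sqrt_le_err (n s : ℕ) : √((2 * s : ℕ) / 2 ^ n) ≤ err n s := by
  unfold err
  refine Real.sqrt_le_sqrt (div_le_div_of_nonneg_right ?_ (by positivity))
  push_cast
  linarith [Nat.cast_nonneg (α := ℝ) s]

lemma div_le_err {n s : ℕ} (hs : 2 * s < 2 ^ n) : ((2 * s : ℕ) : ℝ) / 2 ^ n ≤ err n s := by
  refine le_trans ?_ (sqrt_le_err n s)
  have h1 : ((2 * s : ℕ) : ℝ) / 2 ^ n ≤ 1 := by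
    rw [div_le_one (by positivity)]
    exact_mod_cast hs.le
  refine Real.le_sqrt_of_sq_le ?_
  rw [sq]
  exact mul_le_of_le_one_right (by positivity) h1


lemma intertwines_onOne_FL (hS : 2 * S + 2 < 2 ^ n) :
    Intertwines S 1 (keyThree n * FLk n * keyOne n) (onOne (FL n)) :=
  ⟨by simpa only [Matrix.mul_assoc] using
    near_one_of_forall fun s hs => opNorm_forward_one (n := n) (s := s) (by omega), grows_onOne_FL⟩

lemma intertwines_onOne_FR (hS : 2 * S + 2 < 2 ^ n) :
    Intertwines S 1 (keyOne n * FRk n * keyThree n) (onOne (FR n)) :=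
  ⟨by simpa only [Matrix.mul_assoc] using
    near_one_of_forall fun s hs => opNorm_forward_one' (n := n) (s := s) (by omega),
    onOne_FL_submatrix_flip (n := n) ▸ grows_onOne_FL.flip⟩

lemma intertwines_onOne_FL_adjoint (hS : 2 * S + 2 < 2 ^ n) :
    Intertwines S 1 (keyThree n * FLk n * keyOne n)ᴴ (onOne (FL n))ᴴ :=
  ⟨by
    have h := near_one_of_forall (S := S) fun s hs =>
      opNorm_backward_one (n := n) (s := s) (by omega)
    simpa only [Matrix.mul_assoc, Matrix.conjTranspose_mul, keyOne, keyThree,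
      conjTranspose_keyX] using h, grows_onOne_FL_adjoint⟩

lemma intertwines_onOne_FR_adjoint (hS : 2 * S + 2 < 2 ^ n) :
    Intertwines S 1 (keyOne n * FRk n * keyThree n)ᴴ (onOne (FR n))ᴴ :=
  ⟨by
    have h := near_one_of_forall (S := S) fun s hs =>
      opNorm_backward_one' (n := n) (s := s) (by omega)
    simpa only [Matrix.mul_assoc, Matrix.conjTranspose_mul, keyOne, keyThree,
      conjTranspose_keyX] using h,
    onOne_FL_adjoint_submatrix_flip (n := n) ▸ grows_onOne_FL_adjoint.flip⟩

lemma opNorm_keyThree_FL_keyOne_le (n : ℕ) : ‖keyThree n * FLk n * keyOne n‖ ≤ 1 :=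
  opNorm_mul_le_one (opNorm_mul_le_one (opNorm_keyX_le _) (opNorm_FLk_le n)) (opNorm_keyX_le _)

lemma opNorm_keyOne_FR_keyThree_le (n : ℕ) : ‖keyOne n * FRk n * keyThree n‖ ≤ 1 :=
  opNorm_mul_le_one (opNorm_mul_le_one (opNorm_keyX_le _) (opNorm_FRk_le n)) (opNorm_keyX_le _)

lemma intertwines_keyedOne (hS : 2 * S + 2 < 2 ^ n) : Intertwines S 24 (keyedOne n) (F₁ n) := by
  rw [keyedOne_eq_pathRecording, F₁_eq_pathRecording]
  exact (intertwines_pathRecording (opNorm_keyThree_FL_keyOne_le n)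
    (opNorm_keyOne_FR_keyThree_le n) (opNorm_onOne_le (opNorm_FL_le n))
    (opNorm_onOne_le (opNorm_FR_le n)) (intertwines_onOne_FL hS) (intertwines_onOne_FR hS)
    (intertwines_onOne_FL_adjoint hS) (intertwines_onOne_FR_adjoint hS)).mono (by norm_num)

lemma intertwines_keyedOne_adjoint (hS : 2 * S + 2 < 2 ^ n) :
    Intertwines S 24 (keyedOne n)ᴴ (F₁ n)ᴴ := by
  rw [keyedOne_eq_pathRecording, F₁_eq_pathRecording, conjTranspose_pathRecording,
    conjTranspose_pathRecording]
  exact (intertwines_pathRecording (opNorm_keyOne_FR_keyThree_le n)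
    (opNorm_keyThree_FL_keyOne_le n) (opNorm_onOne_le (opNorm_FR_le n))
    (opNorm_onOne_le (opNorm_FL_le n)) (intertwines_onOne_FR hS) (intertwines_onOne_FL hS)
    (intertwines_onOne_FR_adjoint hS) (intertwines_onOne_FL_adjoint hS)).mono (by norm_num)

lemma near_adjoint_keyTwo {M M' : Matrix (Bits n × Tgt n) (Bits n × Tgt n) ℂ}
    (h : ∀ r : ℕ, ‖M * (keyTwo n * M') * tgtProj n r‖ ≤ √(r / 2 ^ n)) :
    Near S 1 (M * (keyTwo n * (M' * enc n))) 0 := by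
  refine near_one_of_forall fun s _ => ?_
  have h1 := opNorm_mul_enc_mul_sizeProj_le ((h (2 * s)).trans (sqrt_le_err n s))
  simpa only [sub_zero, Matrix.mul_assoc] using h1

lemma near_adjoint_mul (hS : 2 * S + 2 < 2 ^ n) {M : Matrix (Bits n × Tgt n) (Bits n × Tgt n) ℂ}
    (h : ∀ r : ℕ, r < 2 ^ n → ‖(Mᴴ * M - 1) * tgtProj n r‖ ≤ r / 2 ^ n) :
    Near S 1 (Mᴴ * (M * enc n)) (enc n) := by
  refine near_one_of_forall fun s hs => ?_
  have h1 := opNorm_mul_enc_mul_sizeProj_le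
    ((h (2 * s) (by omega)).trans (div_le_err (by omega)))
  simpa only [Matrix.sub_mul, Matrix.one_mul, Matrix.mul_assoc] using h1

lemma intertwines_keyedTwo (hS : 2 * S + 2 < 2 ^ n) : Intertwines S 24 (keyedTwo n) (F₂ n) := by
  rw [keyedTwo_eq_mul, F₂_eq_pathRecording]
  exact intertwines_pathRecording_mul (opNorm_FLk_le n) (opNorm_FRk_le n) (opNorm_keyX_le _)
    (keyX_mul_self _) (opNorm_onTwo_le (opNorm_FL_le n)) (opNorm_onTwo_le (opNorm_FR_le n))
    grows_onTwo_FL (onTwo_FL_submatrix_flip (n := n) ▸ grows_onTwo_FL.flip)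
    grows_onTwo_FL_adjoint
    (onTwo_FL_adjoint_submatrix_flip (n := n) ▸ grows_onTwo_FL_adjoint.flip)
    (near_one_of_forall fun _ _ => opNorm_forward_two (by omega))
    (near_one_of_forall fun _ _ => opNorm_forward_two' (by omega))
    (near_one_of_forall fun _ _ => opNorm_backward_two (by omega))
    (near_one_of_forall fun _ _ => opNorm_backward_two' (by omega))
    (near_adjoint_keyTwo opNorm_FL_adjoint_keyTwo_FR)
    (near_adjoint_keyTwo opNorm_FR_adjoint_keyTwo_FL)
    (near_adjoint_mul hS opNorm_FR_adjoint_FR_sub_one)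

lemma conjTranspose_keyedTwo : (keyedTwo n)ᴴ =
    pathRecording (FRk n) (FLk n) * keyTwo n * pathRecording (FRk n) (FLk n) := by
  rw [keyedTwo_eq_mul, Matrix.conjTranspose_mul, Matrix.conjTranspose_mul,
    conjTranspose_pathRecording, keyTwo, conjTranspose_keyX, mul_assoc]

lemma intertwines_keyedTwo_adjoint (hS : 2 * S + 2 < 2 ^ n) :
    Intertwines S 24 (keyedTwo n)ᴴ (F₂ n)ᴴ := by
  rw [conjTranspose_keyedTwo, F₂_eq_pathRecording, conjTranspose_pathRecording]
  exact intertwines_pathRecording_mul (opNorm_FRk_le n) (opNorm_FLk_le n) (opNorm_keyX_le _)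
    (keyX_mul_self _) (opNorm_onTwo_le (opNorm_FR_le n)) (opNorm_onTwo_le (opNorm_FL_le n))
    (onTwo_FL_submatrix_flip (n := n) ▸ grows_onTwo_FL.flip) grows_onTwo_FL
    (onTwo_FL_adjoint_submatrix_flip (n := n) ▸ grows_onTwo_FL_adjoint.flip)
    grows_onTwo_FL_adjoint
    (near_one_of_forall fun _ _ => opNorm_forward_two' (by omega))
    (near_one_of_forall fun _ _ => opNorm_forward_two (by omega))
    (near_one_of_forall fun _ _ => opNorm_backward_two' (by omega))
    (near_one_of_forall fun _ _ => opNorm_backward_two (by omega))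
    (near_adjoint_keyTwo opNorm_FR_adjoint_keyTwo_FL)
    (near_adjoint_keyTwo opNorm_FL_adjoint_keyTwo_FR)
    (near_adjoint_mul hS opNorm_FL_adjoint_FL_sub_one)

lemma opNorm_F₁_le (n : ℕ) : ‖F₁ n‖ ≤ 1 := by
  rw [F₁_eq_pathRecording]
  exact opNorm_pathRecording_le (opNorm_onOne_le (opNorm_FL_le n)) (opNorm_onOne_le (opNorm_FR_le n))

lemma opNorm_F₂_le (n : ℕ) : ‖F₂ n‖ ≤ 1 := by
  rw [F₂_eq_pathRecording]
  exact opNorm_pathRecording_le (opNorm_onTwo_le (opNorm_FL_le n)) (opNorm_onTwo_le (opNorm_FR_le n))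

lemma opNorm_keyedOne_le (n : ℕ) : ‖keyedOne n‖ ≤ 1 := by
  rw [keyedOne_eq_pathRecording]
  exact opNorm_pathRecording_le (opNorm_keyThree_FL_keyOne_le n) (opNorm_keyOne_FR_keyThree_le n)

lemma opNorm_keyedTwo_le (n : ℕ) : ‖keyedTwo n‖ ≤ 1 := by
  rw [keyedTwo_eq_mul]
  have h := opNorm_pathRecording_le (opNorm_FLk_le n) (opNorm_FRk_le n)
  exact opNorm_mul_le_one (opNorm_mul_le_one h (opNorm_keyX_le _)) h

end Oracles

/-! ### The ancilla register -/

section Lift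

open scoped Classical Matrix.Norms.L2Operator

variable {n : ℕ} {B E E' E'' : Type*} [Fintype B] [DecidableEq B] [Fintype E] [DecidableEq E]
  [Fintype E'] [DecidableEq E'] [Fintype E''] [DecidableEq E'']

/-- Splitting off the ancilla register. -/
def splitAncilla (n : ℕ) (B E : Type*) : (Bits n × B) × E ≃ (Bits n × E) × B where
  toFun i := ((i.1.1, i.2), i.1.2)
  invFun j := ((j.1.1, j.2), j.1.2)
  left_inv _ := rfl
  right_inv _ := rfl

/-- An operator acting trivially on the ancilla register `B`; it may change the purifying
register. -/
def lift (B : Type*) [DecidableEq B] (M : Matrix (Bits n × E) (Bits n × E') ℂ) :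
    Matrix ((Bits n × B) × E) ((Bits n × B) × E') ℂ :=
  blocks (splitAncilla n B E) (splitAncilla n B E') fun _ => M

lemma onAE_eq_lift (O : Matrix (Bits n × E) (Bits n × E) ℂ) : onAE B O = lift B O := by
  ext ⟨⟨a, b⟩, e⟩ ⟨⟨a', b'⟩, e'⟩
  rw [lift, blocks_apply]
  rfl

lemma lift_mul (M : Matrix (Bits n × E) (Bits n × E') ℂ)
    (M' : Matrix (Bits n × E') (Bits n × E'') ℂ) : lift B M * lift B M' = lift B (M * M') :=
  blocks_mul _ _ _ _ _

lemma lift_sub (M M' : Matrix (Bits n × E) (Bits n × E') ℂ) :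
    lift B M - lift B M' = lift B (M - M') :=
  blocks_sub _ _ _ _

lemma conjTranspose_lift (M : Matrix (Bits n × E) (Bits n × E') ℂ) : (lift B M)ᴴ = lift B Mᴴ :=
  conjTranspose_blocks _ _ _

lemma opNorm_lift_le {M : Matrix (Bits n × E) (Bits n × E') ℂ} {c : ℝ} (h : ‖M‖ ≤ c) :
    ‖lift B M‖ ≤ c :=
  opNorm_blocks_le _ _ _ ((norm_nonneg _).trans h) fun _ => h

lemma opNorm_onAB_le {M : Matrix (Bits n × B) (Bits n × B) ℂ} {c : ℝ} (h : ‖M‖ ≤ c) :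
    ‖onAB E M‖ ≤ c := by
  have h1 : onAB E M = blocks (Equiv.refl _) (Equiv.refl _) fun _ => M := by
    ext ⟨p, e⟩ ⟨q, e'⟩
    rw [blocks_apply, onAB, Matrix.kronecker_apply, Matrix.one_apply, mul_ite, mul_one, mul_zero]
    rfl
  rw [h1]
  exact opNorm_blocks_le _ _ _ ((norm_nonneg _).trans h) fun _ => h

/-- An operator on the purifying register alone commutes with the unitaries of the adversary. -/
lemma onAB_mul_lift (U : Matrix (Bits n × B) (Bits n × B) ℂ) (w : Matrix E E' ℂ) :
    onAB E U * lift B ((1 : Matrix (Bits n) (Bits n) ℂ) ⊗ₖ w) =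
      lift B ((1 : Matrix (Bits n) (Bits n) ℂ) ⊗ₖ w) * onAB E' U := by
  have h : lift B ((1 : Matrix (Bits n) (Bits n) ℂ) ⊗ₖ w) =
      (1 : Matrix (Bits n × B) (Bits n × B) ℂ) ⊗ₖ w := by
    ext ⟨⟨a, b⟩, e⟩ ⟨⟨a', b'⟩, e'⟩
    rw [lift, blocks_apply, Matrix.kronecker_apply, Matrix.kronecker_apply]
    change (if b = b' then (1 : Matrix (Bits n) (Bits n) ℂ) a a' * w e e' else 0) = _
    by_cases h1 : a = a' <;> by_cases h2 : b = b' <;> simp [h1, h2, Matrix.one_apply]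
  rw [h, onAB, onAB, ← Matrix.mul_kronecker_mul, ← Matrix.mul_kronecker_mul, Matrix.mul_one,
    Matrix.one_mul, Matrix.mul_one, Matrix.one_mul]

lemma onAB_mul_lift_enc (U : Matrix (Bits n × B) (Bits n × B) ℂ) :
    onAB (Tgt n) U * lift B (enc n) = lift B (enc n) * onAB (Src n) U := by
  have h : enc n = (1 : Matrix (Bits n) (Bits n) ℂ) ⊗ₖ
      ind (fun i d => DecD i.2 i.1 d) wt := by
    ext ⟨a, i⟩ ⟨a', d⟩
    rw [Matrix.kronecker_apply]
    by_cases h1 : a = a' <;> by_cases h2 : DecD i.2 i.1 d <;>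
      simp [enc, ind, EncRel, h1, h2, Matrix.one_apply]
  rw [h, onAB_mul_lift]

lemma onAB_mul_lift_sizeProj (U : Matrix (Bits n × B) (Bits n × B) ℂ) (s : ℕ) :
    onAB (Src n) U * lift B (sizeProj n s) = lift B (sizeProj n s) * onAB (Src n) U := by
  have h : sizeProj n s = (1 : Matrix (Bits n) (Bits n) ℂ) ⊗ₖ proj fun d => size d ≤ s := by
    ext ⟨a, i⟩ ⟨a', d⟩
    rw [Matrix.kronecker_apply]
    by_cases h1 : a = a' <;> by_cases h2 : i = d <;>
      simp [sizeProj, proj, h1, h2, Matrix.one_apply]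
  rw [h, onAB_mul_lift]

/-- Databases that differ have orthogonal encodings, since decoding is unique. -/
lemma enc_adjoint_mul_enc_apply_of_ne {i j : Bits n × Src n} (hij : i ≠ j) :
    ((enc n)ᴴ * enc n) i j = 0 := by
  rw [Matrix.mul_apply, Finset.sum_eq_zero]
  intro m _
  rw [Matrix.conjTranspose_apply]
  by_cases h1 : EncRel m i
  · have h2 : ¬EncRel m j := fun h2 => hij (Prod.ext (h1.1.symm.trans h2.1) (h1.2.unique h2.2))
    simp [enc, ind, h2]
  · simp [enc, ind, h1]

lemma enc_adjoint_mul_enc_mul_sizeProj (s : ℕ) :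
    (enc n)ᴴ * enc n * sizeProj n s = sizeProj n s * ((enc n)ᴴ * enc n) := by
  ext i j
  rw [sizeProj, proj, Matrix.mul_diagonal, Matrix.diagonal_mul]
  by_cases hij : i = j
  · rw [hij, mul_comm]
  · rw [enc_adjoint_mul_enc_apply_of_ne hij, zero_mul, mul_zero]

lemma conjTranspose_sizeProj (s : ℕ) : (sizeProj n s)ᴴ = sizeProj n s := by
  rw [sizeProj, proj, Matrix.diagonal_conjTranspose]
  congr 1
  funext j
  by_cases hj : size j.2 ≤ s <;> simp [hj]

end Lift

/-! ### Comparing the two experiments -/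

section Compare

open scoped Classical Matrix.Norms.L2Operator

section Abstract

variable {α β γ : Type*} [Fintype α] [Fintype β] [Fintype γ] [DecidableEq α] [DecidableEq β]
  [DecidableEq γ]

lemma opNorm_mul_le_left {M : Matrix α β ℂ} {M' : Matrix β γ ℂ} {c : ℝ} (h : ‖M‖ ≤ 1)
    (h' : ‖M'‖ ≤ c) : ‖M * M'‖ ≤ c :=
  (Matrix.l2_opNorm_mul _ _).trans ((mul_le_of_le_one_left (norm_nonneg _) h).trans h')

lemma opNorm_mul_le_right {M : Matrix α β ℂ} {M' : Matrix β γ ℂ} {c : ℝ} (h : ‖M‖ ≤ c)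
    (h' : ‖M'‖ ≤ 1) : ‖M * M'‖ ≤ c :=
  (Matrix.l2_opNorm_mul _ _).trans ((mul_le_of_le_one_right (norm_nonneg _) h').trans h)

/-- If `o` and its adjoint are intertwined with `T` and its adjoint by `W`, then `W† W` almost
commutes with `o`. Hence if `W† W` almost fixes `Ψ`, it almost fixes `o Ψ`. -/
lemma opNorm_gram_sub_le {W : Matrix α β ℂ} {T : Matrix α α ℂ} {o P P' : Matrix β β ℂ}
    {Ψ : Matrix β γ ℂ} {a b g : ℝ} (hW : ‖W‖ ≤ 1) (ho : ‖o‖ ≤ 1) (hP' : ‖P'‖ ≤ 1)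
    (hΨ : ‖Ψ‖ ≤ 1) (hsa : P'ᴴ = P') (hcomm : Wᴴ * W * P' = P' * (Wᴴ * W)) (hPΨ : P * Ψ = Ψ)
    (hPo : P' * (o * Ψ) = o * Ψ) (h1 : ‖(T * W - W * o) * P‖ ≤ a)
    (h2 : ‖(Tᴴ * W - W * oᴴ) * P'‖ ≤ b) (h3 : ‖Wᴴ * (W * Ψ) - Ψ‖ ≤ g) :
    ‖Wᴴ * (W * (o * Ψ)) - o * Ψ‖ ≤ a + b + g := by
  have e1 : Wᴴ * (W * (o * Ψ)) = P' * (Wᴴ * (W * (o * Ψ))) := by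
    nth_rewrite 1 [← hPo]
    simp only [← Matrix.mul_assoc]
    rw [hcomm]
    simp only [Matrix.mul_assoc]
  have e2 : Wᴴ * (W * (o * Ψ)) - o * Ψ = ((Tᴴ * W - W * oᴴ) * P')ᴴ * (W * Ψ) -
      P' * (Wᴴ * ((T * W - W * o) * P * Ψ)) + P' * (o * (Wᴴ * (W * Ψ) - Ψ)) := by
    have e3 : ((Tᴴ * W - W * oᴴ) * P')ᴴ = P' * (Wᴴ * T - o * Wᴴ) := by
      rw [Matrix.conjTranspose_mul, hsa, Matrix.conjTranspose_sub, Matrix.conjTranspose_mul,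
        Matrix.conjTranspose_mul, Matrix.conjTranspose_conjTranspose,
        Matrix.conjTranspose_conjTranspose]
    have e4 : Wᴴ * (W * (o * Ψ)) - o * Ψ = P' * (Wᴴ * (W * (o * Ψ)) - o * Ψ) := by
      rw [Matrix.mul_sub, hPo, ← e1]
    rw [e4, e3, Matrix.mul_assoc _ P, hPΨ, Matrix.mul_assoc P', ← Matrix.mul_sub, ← Matrix.mul_add]
    congr 1
    simp only [Matrix.mul_sub, Matrix.sub_mul, Matrix.mul_assoc]
    abel
  have hW' := opNorm_conjTranspose_le hW
  rw [e2, add_comm a b]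
  refine (norm_add_le _ _).trans (add_le_add ((norm_sub_le _ _).trans (add_le_add ?_ ?_)) ?_)
  · exact opNorm_mul_le_right (opNorm_conjTranspose_le h2) (opNorm_mul_le_one hW hΨ)
  · exact opNorm_mul_le_left hP' (opNorm_mul_le_left hW' (opNorm_mul_le_right h1 hΨ))
  · exact opNorm_mul_le_left hP' (opNorm_mul_le_left ho h3)

/-- Replacing a vector by an approximate isometric image of it changes the expectation of an
observable only slightly. -/
lemma opNorm_expectation_sub_le {W : Matrix α β ℂ} {M : Matrix α α ℂ} {M' : Matrix β β ℂ}
    {Φ : Matrix α γ ℂ} {Ψ : Matrix β γ ℂ} {a g : ℝ} (hW : ‖W‖ ≤ 1) (hM : ‖M‖ ≤ 1)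
    (hM' : ‖M'‖ ≤ 1) (hΦ : ‖Φ‖ ≤ 1) (hΨ : ‖Ψ‖ ≤ 1) (hcomm : M * W = W * M')
    (h1 : ‖Φ - W * Ψ‖ ≤ a) (h2 : ‖Wᴴ * (W * Ψ) - Ψ‖ ≤ g) :
    ‖Ψᴴ * (M' * Ψ) - Φᴴ * (M * Φ)‖ ≤ a + a + g := by
  have e : Ψᴴ * (M' * Ψ) - Φᴴ * (M * Φ) = -((Φ - W * Ψ)ᴴ * (M * Φ)) -
      (W * Ψ)ᴴ * (M * (Φ - W * Ψ)) - (Wᴴ * (W * Ψ) - Ψ)ᴴ * (M' * Ψ) := by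
    have h3 : (W * Ψ)ᴴ * (M * (W * Ψ)) = (Wᴴ * (W * Ψ))ᴴ * (M' * Ψ) := by
      simp only [Matrix.conjTranspose_mul, Matrix.conjTranspose_conjTranspose, Matrix.mul_assoc]
      rw [← Matrix.mul_assoc M, hcomm, Matrix.mul_assoc]
    rw [Matrix.mul_sub, Matrix.mul_sub, h3]
    simp only [Matrix.conjTranspose_sub, Matrix.sub_mul]
    abel
  rw [e]
  refine (norm_sub_le _ _).trans (add_le_add ((norm_sub_le _ _).trans (add_le_add ?_ ?_)) ?_)
  · rw [norm_neg]
    exact opNorm_mul_le_right (opNorm_conjTranspose_le h1) (opNorm_mul_le_one hM hΦ)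
  · exact opNorm_mul_le_left (opNorm_conjTranspose_le (opNorm_mul_le_one hW hΨ))
      (opNorm_mul_le_left hM h1)
  · exact opNorm_mul_le_right (opNorm_conjTranspose_le h2) (opNorm_mul_le_one hM' hΨ)

end Abstract

variable {n S c : ℕ} {B : Type*} [Fintype B] [DecidableEq B]

/-- The state `Φ` of the keyed experiment is close to the encoding of the state `Ψ` of the
experiment with two oracles, whose databases have at most `c` records; and `Ψ` is almost fixed by
`W† W`, where `W` is the encoding map, so that the encoding of `Ψ` has almost the same inner products
as `Ψ`. -/
structure Close (S c : ℕ) (Ψ : Matrix ((Bits n × B) × Src n) Unit ℂ)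
    (Φ : Matrix ((Bits n × B) × Tgt n) Unit ℂ) : Prop where
  size_le : lift B (sizeProj n c) * Ψ = Ψ
  opNorm_le : ‖Ψ‖ ≤ 1
  near : ‖Φ - lift B (enc n) * Ψ‖ ≤ c * err n S
  gram : ‖(lift B (enc n))ᴴ * (lift B (enc n) * Ψ) - Ψ‖ ≤ 2 * c * err n S

variable {Ψ : Matrix ((Bits n × B) × Src n) Unit ℂ} {Φ : Matrix ((Bits n × B) × Tgt n) Unit ℂ}

lemma Close.onAB (h : Close S c Ψ Φ) {U : Matrix (Bits n × B) (Bits n × B) ℂ} (hU : ‖U‖ ≤ 1) :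
    Close S c (onAB (Src n) U * Ψ) (onAB (Tgt n) U * Φ) := by
  refine ⟨?_, opNorm_mul_le_one (opNorm_onAB_le hU) h.opNorm_le, ?_, ?_⟩
  · rw [← Matrix.mul_assoc, ← onAB_mul_lift_sizeProj, Matrix.mul_assoc, h.size_le]
  · rw [← Matrix.mul_assoc, ← onAB_mul_lift_enc, Matrix.mul_assoc, ← Matrix.mul_sub]
    exact opNorm_mul_le_left (opNorm_onAB_le hU) h.near
  · have h1 : (lift B (enc n))ᴴ * PathRecording.onAB (Tgt n) U =
        PathRecording.onAB (Src n) U * (lift B (enc n))ᴴ := by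
      have h2 := congrArg Matrix.conjTranspose (onAB_mul_lift_enc (n := n) (B := B) Uᴴ)
      have h3 : ∀ (E : Type _) [Fintype E] [DecidableEq E], (PathRecording.onAB E Uᴴ)ᴴ =
          PathRecording.onAB E U := fun E _ _ => by
        rw [PathRecording.onAB, Matrix.conjTranspose_kronecker, Matrix.conjTranspose_conjTranspose,
          Matrix.conjTranspose_one, PathRecording.onAB]
      rwa [Matrix.conjTranspose_mul, Matrix.conjTranspose_mul, h3, h3] at h2
    rw [← Matrix.mul_assoc (lift B (enc n)), ← onAB_mul_lift_enc, Matrix.mul_assoc,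
      ← Matrix.mul_assoc, h1, Matrix.mul_assoc, ← Matrix.mul_sub]
    exact opNorm_mul_le_left (opNorm_onAB_le hU) h.gram

lemma Close.onAE (h : Close S c Ψ Φ) {k : ℕ} {T : Matrix (Bits n × Tgt n) (Bits n × Tgt n) ℂ}
    {o : Matrix (Bits n × Src n) (Bits n × Src n) ℂ} (hT : ‖T‖ ≤ 1) (ho : ‖o‖ ≤ 1)
    (h1 : Intertwines S k T o) (h2 : Intertwines S k Tᴴ oᴴ) (hc : c + 2 * k ≤ S) :
    Close S (c + k) (onAE B o * Ψ) (onAE B T * Φ) := by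
  have hP := opNorm_lift_le (B := B) (opNorm_sizeProj_le n (c + k))
  have hW := opNorm_lift_le (B := B) (opNorm_enc_le n)
  have hT' := opNorm_lift_le (B := B) hT
  have ho' := opNorm_lift_le (B := B) ho
  have hsize : lift B (sizeProj n (c + k)) * (lift B o * Ψ) = lift B o * Ψ := by
    rw [← h.size_le, ← Matrix.mul_assoc (lift B o), lift_mul, ← Matrix.mul_assoc, lift_mul,
      h1.grows.mul_sizeProj]
  have hnear : ‖(lift B T * lift B (enc n) - lift B (enc n) * lift B o) * lift B (sizeProj n c)‖ ≤
      k * err n S := by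
    rw [lift_mul, lift_mul, lift_sub, lift_mul]
    exact opNorm_lift_le (h1.near c (by omega))
  rw [onAE_eq_lift, onAE_eq_lift]
  refine ⟨hsize, opNorm_mul_le_one ho' h.opNorm_le, ?_, ?_⟩
  · have e : lift B T * Φ - lift B (enc n) * (lift B o * Ψ) =
        lift B T * (Φ - lift B (enc n) * Ψ) +
          (lift B T * lift B (enc n) - lift B (enc n) * lift B o) * lift B (sizeProj n c) * Ψ := by
      simp only [Matrix.mul_assoc, h.size_le, Matrix.mul_sub, Matrix.sub_mul]
      abel
    rw [e, Nat.cast_add, add_mul]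
    exact (norm_add_le _ _).trans (add_le_add (opNorm_mul_le_left hT' h.near)
      (opNorm_mul_le_right hnear h.opNorm_le))
  · refine (opNorm_gram_sub_le (T := lift B T) (P' := lift B (sizeProj n (c + k))) (b := k * err n S)
      hW ho' hP h.opNorm_le ?_ ?_ h.size_le hsize hnear ?_ h.gram).trans (le_of_eq ?_)
    · rw [conjTranspose_lift, conjTranspose_sizeProj]
    · rw [conjTranspose_lift, lift_mul, lift_mul, lift_mul, enc_adjoint_mul_enc_mul_sizeProj]
    · rw [conjTranspose_lift, conjTranspose_lift, lift_mul, lift_mul, lift_sub, lift_mul]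
      exact opNorm_lift_le (h2.near (c + k) (by omega))
    · push_cast
      ring

end Compare

/-! ### The trace distance of the reduced states -/

section Final

open scoped Classical Matrix.Norms.L2Operator

variable {n S : ℕ} {B E : Type*} [Fintype B] [DecidableEq B] [Fintype E] [DecidableEq E]

/-- A vector as a matrix with one column, whose operator norm is the norm of the vector. -/
abbrev ket {ι : Type*} (ψ : ι → ℂ) : Matrix ι Unit ℂ := Matrix.replicateCol Unit ψ

lemma ket_apply {ι : Type*} (ψ : ι → ℂ) (i : ι) (u : Unit) : ket ψ i u = ψ i := rfl

lemma norm_apply_le_opNorm (M : Matrix Unit Unit ℂ) : ‖M () ()‖ ≤ ‖M‖ := by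
  have h := sum_sq_mulVec_le M fun _ => 1
  simp only [Matrix.mulVec, dotProduct, Finset.univ_unique, Finset.sum_singleton, mul_one, norm_one,
    one_pow] at h
  exact (pow_le_pow_iff_left₀ (norm_nonneg _) (norm_nonneg _) two_ne_zero).mp h

lemma opNorm_unitary_le {ι : Type*} [Fintype ι] [DecidableEq ι] (U : Matrix.unitaryGroup ι ℂ) :
    ‖U.1‖ ≤ 1 := by
  have h := Matrix.l2_opNorm_conjTranspose_mul_self U.1
  have h1 : U.1ᴴ * U.1 = 1 := Matrix.mem_unitaryGroup_iff'.mp U.2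
  have h2 := opNorm_one_le ι
  rw [← h1, h] at h2
  nlinarith [norm_nonneg U.1]

lemma trace_mul_reducedState (M : Matrix (Bits n × B) (Bits n × B) ℂ)
    (ψ : (Bits n × B) × E → ℂ) :
    (M * reducedState ψ).trace = ((ket ψ)ᴴ * (onAB E M * ket ψ)) () () := by
  have h : ∀ p e, (onAB E M * ket ψ) (p, e) () = ∑ q, M p q * ψ (q, e) := by
    intro p e
    rw [Matrix.mul_apply, Fintype.sum_prod_type]
    refine Finset.sum_congr rfl fun q _ => ?_
    simp [onAB, Matrix.one_apply]
  rw [Matrix.mul_apply, Fintype.sum_prod_type, Matrix.trace]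
  refine Finset.sum_congr rfl fun p _ => ?_
  simp only [h, Matrix.diag_apply, Matrix.mul_apply, reducedState, Matrix.of_apply,
    Matrix.conjTranspose_apply, Matrix.replicateCol_apply, Finset.mul_sum]
  rw [Finset.sum_comm]
  refine Finset.sum_congr rfl fun q _ => Finset.sum_congr rfl fun e _ => ?_
  ring

lemma isHermitian_reducedState (ψ : (Bits n × B) × E → ℂ) : (reducedState ψ).IsHermitian := by
  ext p q
  simp only [reducedState, Matrix.conjTranspose_apply, Matrix.of_apply, star_sum, star_mul',
    star_star, mul_comm]

lemma traceDistance_reducedState_le {E' : Type*} [Fintype E'] [DecidableEq E']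
    (ψ : (Bits n × B) × E → ℂ) (φ : (Bits n × B) × E' → ℂ) {c : ℝ}
    (h : ∀ M : Matrix (Bits n × B) (Bits n × B) ℂ, ‖M‖ ≤ 1 →
      ‖(ket ψ)ᴴ * (onAB E M * ket ψ) - (ket φ)ᴴ * (onAB E' M * ket φ)‖ ≤ 2 * c) :
    traceDistance (reducedState ψ) (reducedState φ) ≤ c := by
  obtain ⟨M, hM, hT⟩ := exists_traceNorm_eq _
    ((isHermitian_reducedState ψ).sub (isHermitian_reducedState φ))
  have h1 : (M * (reducedState ψ - reducedState φ)).trace =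
      ((ket ψ)ᴴ * (onAB E M * ket ψ) - (ket φ)ᴴ * (onAB E' M * ket φ)) () () := by
    rw [Matrix.mul_sub, Matrix.trace_sub, trace_mul_reducedState, trace_mul_reducedState,
      Matrix.sub_apply]
  rw [traceDistance, hT, h1]
  have h2 := (Complex.re_le_norm _).trans ((norm_apply_le_opNorm _).trans (h M hM))
  linarith

lemma ket_finalState_succ (O₁ O₂ : Matrix (Bits n × E) (Bits n × E) ℂ)
    (A : ℕ → Matrix.unitaryGroup (Bits n × B) ℂ) (ψ₀ : (Bits n × B) × E → ℂ) (t : ℕ) :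
    ket (finalState O₁ O₂ A ψ₀ (t + 1)) = onAE B O₂ᴴ * (onAB E (A (4 * t + 4)).1 *
      (onAE B O₁ᴴ * (onAB E (A (4 * t + 3)).1 * (onAE B O₂ * (onAB E (A (4 * t + 2)).1 *
        (onAE B O₁ * (onAB E (A (4 * t + 1)).1 * ket (finalState O₁ O₂ A ψ₀ t)))))))) := by
  rw [ket, finalState, Matrix.replicateCol_mulVec]
  simp only [Matrix.mul_assoc]

lemma opNorm_onAE_le {O : Matrix (Bits n × E) (Bits n × E) ℂ} (h : ‖O‖ ≤ 1) :
    ‖onAE B O‖ ≤ 1 := by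
  rw [onAE_eq_lift]
  exact opNorm_lift_le h

lemma opNorm_finalState_le {O₁ O₂ : Matrix (Bits n × E) (Bits n × E) ℂ} (h₁ : ‖O₁‖ ≤ 1)
    (h₂ : ‖O₂‖ ≤ 1) (A : ℕ → Matrix.unitaryGroup (Bits n × B) ℂ) {ψ₀ : (Bits n × B) × E → ℂ}
    (h₀ : ‖ket ψ₀‖ ≤ 1) (t : ℕ) : ‖ket (finalState O₁ O₂ A ψ₀ t)‖ ≤ 1 := by
  have hA : ∀ i, ‖onAB E (A i).1‖ ≤ 1 := fun i => opNorm_onAB_le (opNorm_unitary_le _)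
  induction t with
  | zero => exact h₀
  | succ t ih =>
    rw [ket_finalState_succ]
    exact opNorm_mul_le_one (opNorm_onAE_le (opNorm_conjTranspose_le h₂))
      (opNorm_mul_le_one (hA _) (opNorm_mul_le_one (opNorm_onAE_le (opNorm_conjTranspose_le h₁))
      (opNorm_mul_le_one (hA _) (opNorm_mul_le_one (opNorm_onAE_le h₂)
      (opNorm_mul_le_one (hA _) (opNorm_mul_le_one (opNorm_onAE_le h₁)
      (opNorm_mul_le_one (hA _) ih)))))))

/-- The label of two empty databases. -/
def emptySrc (n : ℕ) : Src n := ((emptyI n, emptyD n), (emptyI n, emptyD n))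

lemma decD_emptySrc {k : Keys n} {D : Database n} :
    DecD k D (emptySrc n) ↔ D = (emptyI n, emptyD n) := by
  constructor
  · intro h
    have h1 := h.card_le
    have h2 : size (emptySrc n) = 0 := by simp [size, emptySrc, emptyI, emptyD]
    rw [h2] at h1
    have h3 : D.1.1 = ∅ := Finset.card_eq_zero.mp (by omega)
    have h4 : D.2.1 = ∅ := Finset.card_eq_zero.mp (by omega)
    exact Prod.ext (Subtype.ext h3) (Subtype.ext h4)
  · rintro rfl
    have h : Dec k (∅ : Finset (Bits n × Bits n)) ∅ ∅ := by
      refine ⟨fun p hp => by simp at hp, ?_, ?_⟩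
      · ext c
        simp [mem_decOne]
      · ext c
        simp [mem_decTwo]
    exact ⟨h, h⟩

lemma wt_emptySrc : wt (emptySrc n) = 1 / √((2 ^ n : ℝ) ^ 3) := by
  simp [wt, choiceExp, emptySrc, emptyI, emptyD]

lemma enc_apply_emptySrc (a a' : Bits n) (D : Database n) (k : Keys n) :
    enc n (a, D, k) (a', emptySrc n) =
      if a = a' ∧ D = (emptyI n, emptyD n) then ((1 / √((2 ^ n : ℝ) ^ 3) : ℝ) : ℂ) else 0 := by
  rw [← wt_emptySrc]
  exact if_congr (and_congr_right fun _ => decD_emptySrc) rfl rfl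

lemma initTwo_eq (b₀ : B) : initTwo n b₀ = Pi.single ((0, b₀), emptySrc n) 1 := rfl

lemma ket_initKeyed (b₀ : B) : ket (initKeyed n b₀) = lift B (enc n) * ket (initTwo n b₀) := by
  ext ⟨⟨a, b⟩, D, k⟩ ⟨⟩
  rw [Matrix.mul_apply, Finset.sum_eq_single ((0, b₀), emptySrc n)]
  · rw [ket_apply, ket_apply, initTwo_eq, Pi.single_eq_same, mul_one,
      lift, blocks_apply]
    change _ = if b = b₀ then enc n (a, D, k) (0, emptySrc n) else 0
    rw [enc_apply_emptySrc, initKeyed, Pi.smul_apply, Finset.sum_apply,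
      Finset.sum_eq_single k]
    · by_cases h1 : a = 0 <;> by_cases h2 : b = b₀ <;> by_cases h3 : D = (emptyI n, emptyD n) <;>
        simp [h1, h2, h3]
    · intro k' _ hk
      rw [Pi.single_apply, if_neg]
      intro h
      exact hk (congrArg (fun x => x.2.2) h).symm
    · simp
  · intro j _ hj
    rw [ket_apply, initTwo_eq, Pi.single_eq_of_ne hj, mul_zero]
  · simp

lemma enc_adjoint_mul_enc_emptySrc (a : Bits n) :
    ((enc n)ᴴ * enc n) (a, emptySrc n) (a, emptySrc n) = 1 := by
  have h : ∀ D k, enc n (a, D, k) (a, emptySrc n) =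
      if D = (emptyI n, emptyD n) then ((wt (emptySrc n) : ℝ) : ℂ) else 0 := fun D k => by
    rw [enc_apply_emptySrc, wt_emptySrc]
    exact if_congr (and_iff_right rfl) rfl rfl
  rw [Matrix.mul_apply, Fintype.sum_prod_type, Finset.sum_eq_single a]
  · rw [Fintype.sum_prod_type, Finset.sum_eq_single (emptyI n, emptyD n)]
    · simp only [Matrix.conjTranspose_apply, h, if_true]
      rw [Finset.sum_const, Finset.card_univ, Complex.star_def, Complex.conj_ofReal,
        ← Complex.ofReal_mul, ← sq, wt_sq]
      have hc : Fintype.card (Keys n) = (2 ^ n) ^ 3 := by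
        rw [Fintype.card_prod, Fintype.card_prod, card_bits]
        ring
      have he : choiceExp (emptySrc n) = 3 := by simp [choiceExp, emptySrc, emptyI, emptyD]
      rw [hc, he, nsmul_eq_mul]
      push_cast
      field_simp
    · intro D _ hD
      simp [h, hD]
    · simp
  · intro a' _ ha
    refine Finset.sum_eq_zero fun i _ => ?_
    have : enc n (a', i) (a, emptySrc n) = 0 := by
      rw [enc_apply_emptySrc, if_neg fun h => ha h.1]
    rw [this, mul_zero]
  · simp

lemma opNorm_ket_initTwo_le (b₀ : B) : ‖ket (initTwo n b₀)‖ ≤ 1 := by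
  have h := opNorm_le_of_sparse (ket (initTwo n b₀)) zero_le_one zero_le_one (fun i => ?_)
    fun j => ?_
  · simpa using h
  · exact_mod_cast (Finset.card_le_univ _).trans (by simp)
  · rw [Finset.sum_eq_single ((0, b₀), emptySrc n)]
    · simp [initTwo_eq]
    · intro i _ hi
      rw [ket_apply, initTwo_eq, Pi.single_eq_of_ne hi, norm_zero]
      simp
    · simp

lemma opNorm_ket_initKeyed_le (b₀ : B) : ‖ket (initKeyed n b₀)‖ ≤ 1 := by
  rw [ket_initKeyed]
  exact opNorm_mul_le_one (opNorm_lift_le (opNorm_enc_le n)) (opNorm_ket_initTwo_le b₀)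

lemma lift_mul_ket_initTwo {M : Matrix (Bits n × Src n) (Bits n × Src n) ℂ}
    (h0 : ∀ i, i ≠ (0, emptySrc n) → M i (0, emptySrc n) = 0)
    (h1 : M (0, emptySrc n) (0, emptySrc n) = 1) (b₀ : B) :
    lift B M * ket (initTwo n b₀) = ket (initTwo n b₀) := by
  ext ⟨⟨a, b⟩, d⟩ ⟨⟩
  rw [Matrix.mul_apply, Finset.sum_eq_single ((0, b₀), emptySrc n)]
  · rw [ket_apply, ket_apply, initTwo_eq, Pi.single_eq_same, mul_one,
      lift, blocks_apply]
    change (if b = b₀ then M (a, d) (0, emptySrc n) else 0) = _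
    by_cases hb : b = b₀
    · by_cases hi : (a, d) = (0, emptySrc n)
      · obtain ⟨rfl, rfl⟩ := Prod.mk.inj hi
        rw [if_pos hb, h1, hb, Pi.single_eq_same]
      · rw [if_pos hb, h0 _ hi, Pi.single_eq_of_ne]
        intro h
        exact hi (congrArg (fun x => (x.1.1, x.2)) h)
    · rw [if_neg hb, Pi.single_eq_of_ne]
      intro h
      exact hb (congrArg (fun x => x.1.2) h)
  · intro j _ hj
    rw [ket_apply, initTwo_eq, Pi.single_eq_of_ne hj, mul_zero]
  · simp

lemma close_init (b₀ : B) : Close S 0 (ket (initTwo n b₀)) (ket (initKeyed n b₀)) := by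
  refine ⟨?_, opNorm_ket_initTwo_le b₀, ?_, ?_⟩
  · refine lift_mul_ket_initTwo (fun i hi => ?_) ?_ b₀
    · rw [sizeProj, proj, Matrix.diagonal_apply_ne _ hi]
    · rw [sizeProj, proj, Matrix.diagonal_apply_eq, if_pos]
      simp [size, emptySrc, emptyI, emptyD]
  · rw [ket_initKeyed, sub_self, norm_zero]
    simp
  · rw [← Matrix.mul_assoc, conjTranspose_lift, lift_mul, lift_mul_ket_initTwo
      (fun i hi => enc_adjoint_mul_enc_apply_of_ne hi) (enc_adjoint_mul_enc_emptySrc 0), sub_self,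
      norm_zero]
    simp

/-- Each of the `4 t` queries adds at most `24` to the error and to the number of records. -/
lemma close_finalState (hS : 2 * S + 2 < 2 ^ n) (b₀ : B)
    (A : ℕ → Matrix.unitaryGroup (Bits n × B) ℂ) (t : ℕ) (ht : 96 * t + 24 ≤ S) :
    Close S (96 * t) (ket (finalState (F₁ n) (F₂ n) A (initTwo n b₀) t))
      (ket (finalState (keyedOne n) (keyedTwo n) A (initKeyed n b₀) t)) := by
  induction t with
  | zero => exact close_init b₀
  | succ t ih =>
    rw [ket_finalState_succ, ket_finalState_succ]
    have hA : ∀ i, ‖(A i).1‖ ≤ 1 := fun i => opNorm_unitary_le _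
    have i1 := intertwines_keyedOne hS
    have i2 := intertwines_keyedTwo hS
    have i1' := intertwines_keyedOne_adjoint hS
    have i2' := intertwines_keyedTwo_adjoint hS
    have n1 := opNorm_F₁_le n
    have n2 := opNorm_F₂_le n
    have m1 := opNorm_keyedOne_le n
    have m2 := opNorm_keyedTwo_le n
    have c0 := (ih (by omega)).onAB (hA (4 * t + 1))
    have c1 := (c0.onAE m1 n1 i1 i1' (by omega)).onAB (hA (4 * t + 2))
    have c2 := (c1.onAE m2 n2 i2 i2' (by omega)).onAB (hA (4 * t + 3))
    have c3 := (c2.onAE (opNorm_conjTranspose_le m1) (opNorm_conjTranspose_le n1) i1'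
      (by simpa using i1) (by omega)).onAB (hA (4 * t + 4))
    have c4 := c3.onAE (opNorm_conjTranspose_le m2) (opNorm_conjTranspose_le n2) i2'
      (by simpa using i2) (by omega)
    exact c4

lemma traceDistance_le_of_close {t c : ℕ} (b₀ : B) (A : ℕ → Matrix.unitaryGroup (Bits n × B) ℂ)
    (h : Close S c (ket (finalState (F₁ n) (F₂ n) A (initTwo n b₀) t))
      (ket (finalState (keyedOne n) (keyedTwo n) A (initKeyed n b₀) t))) :
    traceDistance (rhoTwo n b₀ A t) (rhoKeyed n b₀ A t) ≤ 2 * c * err n S := by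
  refine traceDistance_reducedState_le _ _ fun M hM => ?_
  refine (opNorm_expectation_sub_le (opNorm_lift_le (opNorm_enc_le n)) (opNorm_onAB_le hM)
    (opNorm_onAB_le hM) (opNorm_finalState_le (opNorm_keyedOne_le n) (opNorm_keyedTwo_le n) A
      (opNorm_ket_initKeyed_le b₀) t) h.opNorm_le (onAB_mul_lift_enc M) h.near h.gram).trans
    (le_of_eq ?_)
  ring

lemma traceDistance_le_one (b₀ : B) (A : ℕ → Matrix.unitaryGroup (Bits n × B) ℂ) (t : ℕ) :
    traceDistance (rhoTwo n b₀ A t) (rhoKeyed n b₀ A t) ≤ 1 := by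
  refine traceDistance_reducedState_le _ _ fun M hM => ?_
  have h1 := opNorm_finalState_le (opNorm_F₁_le n) (opNorm_F₂_le n) A (opNorm_ket_initTwo_le b₀) t
  have h2 := opNorm_finalState_le (opNorm_keyedOne_le n) (opNorm_keyedTwo_le n) A
    (opNorm_ket_initKeyed_le b₀) t
  have h3 := opNorm_mul_le_one (opNorm_conjTranspose_le h1)
    (opNorm_mul_le_one (opNorm_onAB_le hM) h1)
  have h4 := opNorm_mul_le_one (opNorm_conjTranspose_le h2)
    (opNorm_mul_le_one (opNorm_onAB_le hM) h2)
  exact (norm_sub_le _ _).trans (by linarith)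

end Final

end PathRecording

end

theorem lemma4p7 :
    ∃ C : ℝ, ∀ (n t : ℕ) (B : Type) [Fintype B] [DecidableEq B] (b₀ : B)
      (A : ℕ → Matrix.unitaryGroup (PathRecording.Bits n × B) ℂ),
      PathRecording.traceDistance (PathRecording.rhoTwo n b₀ A t)
        (PathRecording.rhoKeyed n b₀ A t) ≤ C * ((t : ℝ) ^ 2 / √(2 ^ n : ℝ)) := by
  -- `10368 = 192 * 54`: the error is at most `2 * 96 t` elementary errors, each `54 t / √N` at most
  refine ⟨10368, fun n t B _ _ b₀ A => ?_⟩
  rcases Nat.eq_zero_or_pos t with rfl | ht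
  · have h := PathRecording.traceDistance_le_of_close (S := 0) (t := 0) b₀ A
      (PathRecording.close_init b₀)
    simpa using h
  have ht1 : (1 : ℝ) ≤ t := by exact_mod_cast ht
  have hN : (0 : ℝ) < √(2 ^ n : ℝ) := by positivity
  by_cases hS : 2 * (96 * t + 24) + 2 < 2 ^ n
  · refine (PathRecording.traceDistance_le_of_close b₀ A
      (PathRecording.close_finalState hS b₀ A t le_rfl)).trans ?_
    have h1 : PathRecording.err n (96 * t + 24) ≤ 54 * t / √(2 ^ n : ℝ) := by
      rw [PathRecording.err, Real.sqrt_div' _ (by positivity)]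
      refine div_le_div_of_nonneg_right ?_ hN.le
      refine Real.sqrt_le_iff.mpr ⟨by positivity, ?_⟩
      push_cast
      nlinarith
    refine (mul_le_mul_of_nonneg_left h1 (by positivity)).trans (le_of_eq ?_)
    push_cast
    ring
  · -- for `t` of the order of `N` or more, the claimed bound is at least `1`
    refine (PathRecording.traceDistance_le_one b₀ A t).trans ?_
    rw [← mul_div_assoc, le_div_iff₀ hN, one_mul]
    refine Real.sqrt_le_iff.mpr ⟨by positivity, ?_⟩
    have h1 : ((2 ^ n : ℕ) : ℝ) ≤ (2 * (96 * t + 24) + 2 : ℕ) := by exact_mod_cast not_lt.mp hS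
    push_cast at h1
    have h2 : (t : ℝ) ≤ (t : ℝ) ^ 2 := by nlinarith
    have h3 : (1 : ℝ) ≤ (t : ℝ) ^ 2 := by nlinarith
    have h4 : (t : ℝ) ^ 2 ≤ ((t : ℝ) ^ 2) ^ 2 := by nlinarith
    nlinarith
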